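/- Let $a:\mathbb R\to\mathbb R$ be measurable with $\delta\le a\le C$ a.e. for some constants $\delta,C>0$. For every $\varepsilon>0$ let $b_\varepsilon$ be a measurable function on $(-\varepsilon,\varepsilon)$ with $\delta_\varepsilon\le b_\varepsilon\le C_\varepsilon$ a.e. for some constants $\delta_\varepsilon,C_\varepsilon>0$, and put $$a_\varepsilon(x)=a(x-\varepsilon)\ (x\ge\varepsilon),\qquad a_\varepsilon(x)=b_\varepsilon(x)\ (|x|<\varepsilon),\qquad a_\varepsilon(x)=a(x+\varepsilon)\ (x\le-\varepsilon).$$ Let $\mathbb G=(-\infty,0-]\cup[0+,\infty)$ be the line with $0$ split into two points, so that $L^2(\mathbb G)=L^2(\mathbb R)$. Let $H^1(\mathbb G)$ be the set of $f\in L^2$ whose restrictions to both half-lines are in $H^1$, and let $C(\mathbb G)$ be the set of functions that are continuous on $(-\infty,0)$ and on $(0,\infty)$ and have finite limits at $0\pm$. For $\mathbb X\in\{\mathbb R,\mathbb G\}$ put $$\mathscr H(\mathbb X)=C_b([0,\infty),L^2(\mathbb X))\cap L^\infty([0,\infty),H^1(\mathbb X)).$$ For a coefficient $c$ and $u_0\in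 L^2(\mathbb R)$, a *weak solution in $\mathscr H(\mathbb X)$* of $\partial_tu=\frac12\nabla(c\nabla u)$, $u(0,\cdot)=u_0$, is a $u\in\mathscr H(\mathbb X)$ with $u(0,\cdot)=u_0$ and $$\int_{\mathbb R}(u_0(x)-u(t,x))g(x)\,dx=\frac12\int_0^t\int_{\mathbb R}c(x)\nabla u(s,x)\,g'(x)\,dx\,ds\qquad(t>0,\ g\in C_c^\infty(\mathbb R)),$$ where $\nabla u$ is the weak derivative on $\mathbb R$ if $\mathbb X=\mathbb R$ and on $\mathbb R\setminus\{0\}$ if $\mathbb X=\mathbb G$. Let $u_0\in H^1(\mathbb R)$, let $\varepsilon_n>0$ be a decreasing sequence with $\varepsilon_n\to0$, and set $\bar\gamma(n)=\int_{-\varepsilon_n}^{\varepsilon_n}\frac{dx}{b_{\varepsilon_n}(x)}$. Assume that $\varepsilon_n\bar\gamma(n)\to0$ and that $\bar\gamma=\lim_n\bar\gamma(n)\in[0,\infty]$ exists. **Theorem.** For every $n$ there is a unique weak solution $u^n$ in $\mathscr H(\mathbb R)$ for the coefficient $a_{\varepsilon_n}$ and the initial value $u_0$, and for every $t>0$ the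 limit $u_t=\lim_nu^n_t$ exists in $L^2(\mathbb R)$. Put $u(t,\cdot)=u_t$ for $t>0$ and $u(0,\cdot)=u_0$. Assume in addition that $a\in C(\mathbb G)$, and let $U_\alpha=\int_0^\infty e^{-\alpha t}u_t\,dt$ for $\alpha>0$. Below, a boundary condition at $0$ for a function $f$ includes the assertion that $f$ has a version that is continuously differentiable on each of the closed half-lines $(-\infty,0-]$ and $[0+,\infty)$. Consider the regularity condition $$(\ast)\qquad a\,u_0'\in H^1(\mathbb G),\qquad u_0'(0\pm)=0.$$ 1. If $\bar\gamma=\infty$, then $u$ is a weak solution in $\mathscr H(\mathbb G)$ for the coefficient $a$, and $U_\alpha'(0+)=U_\alpha'(0-)=0$ for every $\alpha>0$. If $(\ast)$ holds, then $u_t'(0+)=u_t'(0-)=0$ for every $t>0$. 2. If $0<\bar\gamma<\infty$, put $\kappa=2/\bar\gamma$. Then $u$ is a weak solution in $\mathscr H(\mathbb G)$ for the coefficient $a$, and for every $\alpha>0$ $$a(0+)U_\alpha'(0+)=a(0-)U_\alpha'(0-)=\frac\kappa2\bigl(U_\alpha(0+)-U_\alpha(0-)\bigr).$$ If $(\ast)$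 holds, then $a(0+)u_t'(0+)=a(0-)u_t'(0-)=\frac\kappa2\bigl(u_t(0+)-u_t(0-)\bigr)$ for every $t>0$. 3. If $\bar\gamma=0$, then $u$ is the unique weak solution in $\mathscr H(\mathbb R)$ for the coefficient $a$, and for every $t>0$ the function $u_t$ has a continuous version; in particular it is continuous at $0$. Moreover (without assuming $a\in C(\mathbb G)$), for the coefficient $a$ and the initial value $u_0$ there is exactly one weak solution in $\mathscr H(\mathbb R)$, whereas there is more than one in $\mathscr H(\mathbb G)$. -/

import Mathlib

open MeasureTheory Filter Set
open scoped Topology ENNReal ContDiff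

noncomputable section

/-- The Hilbert space `L²(ℝ)` (for Lebesgue measure). Since a point is a null set, it is also
`L²(𝔾)`, where `𝔾 = (-∞, 0-] ∪ [0+, ∞)` is the line with the origin split into two points. -/
abbrev L2R : Type := Lp ℝ 2 (volume : Measure ℝ)

/-- `g ∈ C_c^∞(Ω)`. -/
def IsTestFunction (Ω : Set ℝ) (g : ℝ → ℝ) : Prop :=
  ContDiff ℝ ∞ g ∧ HasCompactSupport g ∧ tsupport g ⊆ Ω

/-- `f'` is the weak derivative of `f` on the open set `Ω`. -/
def HasWeakDerivOn (Ω : Set ℝ) (f f' : ℝ → ℝ) : Prop :=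
  ∀ g : ℝ → ℝ, IsTestFunction Ω g → ∫ x, f x * deriv g x = - ∫ x, f' x * g x

/-- The open set `ℝ \ {0}`, the interior of `𝔾`. -/
def puncturedLine : Set ℝ := {(0 : ℝ)}ᶜ

/-- `f ∈ H¹(Ω)`, for `Ω` of full measure in `ℝ`. With `Ω = univ` this is `H¹(ℝ)`; with
`Ω = puncturedLine` it is `H¹(𝔾)`, the functions whose restrictions to the two half-lines
are both in `H¹`, with no condition linking them at `0`. -/
def MemH1 (Ω : Set ℝ) (f : ℝ → ℝ) : Prop :=
  MemLp f 2 volume ∧ ∃ f' : ℝ → ℝ, MemLp f' 2 volume ∧ HasWeakDerivOn Ω f f'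

/-- `u ∈ C_b([0, ∞), L²)`. Only the values `u t` with `t ≥ 0` matter. -/
def MemCbL2 (u : ℝ → L2R) : Prop :=
  ContinuousOn u (Ici 0) ∧ ∃ M : ℝ, ∀ t : ℝ, 0 ≤ t → ‖u t‖ ≤ M

/-- `u ∈ L^∞([0, ∞), H¹(Ω))`, with spatial gradient `du`: the pair `(u, du)` is strongly
measurable and essentially bounded in time with values in `L² × L²`, and at almost every time
`du t` is the weak derivative of `u t` on `Ω`. -/
def MemLinftyH1 (Ω : Set ℝ) (u du : ℝ → L2R) : Prop :=
  MemLp u ⊤ (volume.restrict (Ici (0 : ℝ))) ∧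
  MemLp du ⊤ (volume.restrict (Ici (0 : ℝ))) ∧
  ∀ᵐ t ∂(volume.restrict (Ici (0 : ℝ))), HasWeakDerivOn Ω (u t) (du t)

/-- `u` is a weak solution of `∂ₜ u = ½ ∇(a ∇u)`, `u(0, ·) = u₀`, in the class
`C_b([0, ∞), L²) ∩ L^∞([0, ∞), H¹(Ω))`. This class is `ℋ(ℝ)` for `Ω = univ` and `ℋ(𝔾)` for
`Ω = puncturedLine`; in both cases the test functions are those of `C_c^∞(ℝ)`. -/
def IsWeakSolution (Ω : Set ℝ) (a : ℝ → ℝ) (u₀ : L2R) (u : ℝ → L2R) : Prop :=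
  MemCbL2 u ∧ u 0 = u₀ ∧
  ∃ du : ℝ → L2R, MemLinftyH1 Ω u du ∧
    ∀ t : ℝ, 0 < t → ∀ g : ℝ → ℝ, IsTestFunction univ g →
      ∫ x, (u₀ x - u t x) * g x =
        (1 / 2) * ∫ s in (0 : ℝ)..t, ∫ x, a x * du s x * deriv g x

/-- `u` is the one and only weak solution in the class given by `Ω`. -/
def IsUniqueWeakSolution (Ω : Set ℝ) (a : ℝ → ℝ) (u₀ : L2R) (u : ℝ → L2R) : Prop :=
  IsWeakSolution Ω a u₀ u ∧
  ∀ v : ℝ → L2R, IsWeakSolution Ω a u₀ v → ∀ t : ℝ, 0 ≤ t → v t = u t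

/-- The conductivity `a_ε`: equal to `b` in the barrier `(-ε, ε)` and to the conductivity `a`,
shifted away from the origin by `ε`, outside it. -/
def barrierConductivity (a b : ℝ → ℝ) (ε : ℝ) (x : ℝ) : ℝ :=
  if ε ≤ x then a (x - ε) else if x ≤ -ε then a (x + ε) else b x

/-- `a ∈ C(𝔾)`, regarded as a function on `ℝ`, with `a(0+) = ap` and `a(0-) = am`. -/
structure IsContinuousOnG (a : ℝ → ℝ) (ap am : ℝ) : Prop where
  right : ContinuousOn a (Ioi 0)
  left : ContinuousOn a (Iio 0)
  right_lim : Tendsto a (𝓝[>] 0) (𝓝 ap)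
  left_lim : Tendsto a (𝓝[<] 0) (𝓝 am)

/-- The (almost everywhere defined) function `f` has a version that is continuously
differentiable on `𝔾`, i.e. on each closed half-line, with boundary values
`f(0+) = vp`, `f(0-) = vm`, `f'(0+) = dp`, `f'(0-) = dm`. -/
def HasBoundaryData (f : ℝ → ℝ) (vp vm dp dm : ℝ) : Prop :=
  ∃ fp fm : ℝ → ℝ,
    ContDiffOn ℝ 1 fp (Ici 0) ∧ ContDiffOn ℝ 1 fm (Iic 0) ∧
    f =ᵐ[volume.restrict (Ioi 0)] fp ∧ f =ᵐ[volume.restrict (Iio 0)] fm ∧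
    fp 0 = vp ∧ fm 0 = vm ∧
    derivWithin fp (Ici 0) 0 = dp ∧ derivWithin fm (Iic 0) 0 = dm

/-- `f'(0+) = f'(0-) = 0`. -/
def NeumannCondition (f : ℝ → ℝ) : Prop :=
  ∃ vp vm : ℝ, HasBoundaryData f vp vm 0 0

/-- `a(0+) f'(0+) = a(0-) f'(0-) = (κ/2) (f(0+) - f(0-))`, with `ap = a(0+)`, `am = a(0-)`. -/
def SemiPermeableCondition (ap am κ : ℝ) (f : ℝ → ℝ) : Prop :=
  ∃ vp vm dp dm : ℝ, HasBoundaryData f vp vm dp dm ∧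
    ap * dp = am * dm ∧ am * dm = κ / 2 * (vp - vm)

/-- `a u₀' ∈ H¹(𝔾)` and `u₀'(0±) = 0`. -/
def RegularInitialDatum (a u₀ : ℝ → ℝ) : Prop :=
  (∃ du₀ : ℝ → ℝ, MemLp du₀ 2 volume ∧ HasWeakDerivOn univ u₀ du₀ ∧
    MemH1 puncturedLine (fun x => a x * du₀ x)) ∧
  NeumannCondition u₀

/-- `U_α = ∫₀^∞ e^{-αt} u_t dt`, a Bochner integral in `L²`. -/
def laplaceTransform (u : ℝ → L2R) (α : ℝ) : L2R :=
  ∫ t in Ioi (0 : ℝ), Real.exp (-α * t) • u t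

/-- The total thermal resistance `∫_{-ε}^{ε} 1 / b(x) dx` of the barrier `(-ε, ε)`. -/
def totalResistance (b : ℝ → ℝ) (ε : ℝ) : ℝ :=
  ∫ x in (-ε)..ε, 1 / b x

end

noncomputable section

/-! Every problem in the statement is the flow `u_t = e^{-tA} u₀` of the nonnegative self-adjoint
operator `A` of a closed quadratic form on `L²`. With the barrier the form is `½∫ a_ε f' g'` on
`H¹(ℝ)`. The limit form is `½∫ a f' g' + k [f][g]` on `H¹(𝔾)`, where `[f]` is the jump at `0` and `k
= 1/(2γ̄)`; for `γ̄ = 0` the jump must vanish and the form lives on `H¹(ℝ)`. The value of `k` is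
that of a resistor: the least energy `½∫ b f'²` of a function that rises by `J` across a barrier of
resistance `γ` is `J²/(2γ)`, attained when `f'` is proportional to `1/b`.

Since `e^{-tA} = φ(R)` with `R = (1+A)⁻¹` and `φ(r) = exp(-t(1/r - 1))` continuous on `[0,1]`,
strong convergence of the resolvents suffices (`IsClosedForm.tendsto_semigroup`). To compare
resolvents, the barrier is cut out of the line (`squeeze`). A function on `𝔾` is lifted to the line
by filling the barrier with the optimal profile (`IsBarrier.exists_lift`); testing with this lift
shows that the squeezed solution solves the limit equation up to a small error
(`IsBarrier.abs_squeeze_resolvent_le`). Coercivity then gives convergence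
(`IsCoefficient.tendsto_of_approx`, `IsCoefficient.tendsto_of_approx_atTop`). The part of the
solution inside the barrier has `L²` norm of order `√ε + √(εγ)`, which is where `εγ → 0` enters
(`IsBarrier.norm_sub_unsqueeze_le`).

For `t > 0` both `u_t` and `U_α` lie in the range of the resolvent. There the flux `a f'` belongs to
`H¹(ℝ)`, hence is continuous through `0`, and testing with a function that jumps gives its value
`2k[f]` at `0` (`exists_hasBoundaryData`).

Uniqueness in `ℋ(ℝ)` is an energy argument for the time integral of the difference of two solutions
(`IsWeakSolution.eq_of_univ`). It fails in `ℋ(𝔾)` because test functions in `C_c^∞(ℝ)` have no jump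
and do not see how the two half-lines are coupled (`IsCoefficient.exists_isWeakSolution_ne`). -/

/-! ### Continuous functional calculus for symmetric operators between `0` and `1` -/

/-- A symmetric operator `R` on a real inner product space with `0 ≤ R ≤ 1`. -/
structure IsUnitSymmetric {H : Type*} [NormedAddCommGroup H] [InnerProductSpace ℝ H]
    (R : H →L[ℝ] H) : Prop where
  symm : ∀ x y, inner ℝ (R x) y = inner ℝ x (R y)
  nonneg : ∀ x, 0 ≤ inner ℝ (R x) x
  le : ∀ x, inner ℝ (R x) x ≤ ‖x‖ ^ 2

section FunctionalCalculus

variable {H : Type*} [NormedAddCommGroup H] [InnerProductSpace ℝ H]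

/-- In an orthonormal eigenbasis `p(T)` is diagonal with entries `p(l i)`, and the two form bounds
place the eigenvalues in `[0, 1]`. -/
theorem norm_aeval_apply_le_of_finiteDimensional [FiniteDimensional ℝ H] {T : H →ₗ[ℝ] H}
    (hT : T.IsSymmetric) (h0 : ∀ x, 0 ≤ inner ℝ (T x) x) (h1 : ∀ x, inner ℝ (T x) x ≤ ‖x‖ ^ 2)
    (p : Polynomial ℝ) {M : ℝ} (hM : ∀ r ∈ Icc (0 : ℝ) 1, |p.eval r| ≤ M) (x : H) :
    ‖Polynomial.aeval T p x‖ ≤ M * ‖x‖ := by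
  set b := hT.eigenvectorBasis rfl
  set l := hT.eigenvalues rfl
  have hrepr : ∀ (q : Polynomial ℝ) (y : H) i,
      b.repr (Polynomial.aeval T q y) i = q.eval (l i) * b.repr y i := by
    intro q
    induction q using Polynomial.induction_on' with
    | add p q hp hq =>
      intro y i
      simp only [map_add, LinearMap.add_apply, Polynomial.eval_add, PiLp.add_apply, hp, hq]
      ring
    | monomial n c =>
      induction n with
      | zero =>
        intro y i
        simp [Module.algebraMap_end_apply]
      | succ n ih =>
        intro y i
        have h := ih (T y) i
        have h2 : b.repr (T y) i = l i * b.repr y i := by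
          simpa using hT.eigenvectorBasis_apply_self_apply rfl y i
        rw [h2] at h
        simp only [Polynomial.aeval_monomial, Polynomial.eval_monomial] at h ⊢
        rw [pow_succ, ← mul_assoc, Module.End.mul_apply, h]
        ring
  have hl : ∀ i, l i ∈ Icc (0 : ℝ) 1 := by
    intro i
    have h2 : T (b i) = l i • b i := hT.apply_eigenvectorBasis rfl i
    have hn : ‖b i‖ = 1 := b.norm_eq_one i
    have h3 := h0 (b i)
    have h4 := h1 (b i)
    rw [h2, inner_smul_left, real_inner_self_eq_norm_sq, hn] at h3 h4
    simp at h3 h4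
    exact ⟨h3, h4⟩
  have hM0 : 0 ≤ M := (abs_nonneg _).trans (hM 0 (by simp))
  refine le_of_sq_le_sq ?_ (by positivity)
  rw [mul_pow, ← b.repr.norm_map, ← b.repr.norm_map x, EuclideanSpace.norm_sq_eq,
    EuclideanSpace.norm_sq_eq, Finset.mul_sum]
  refine Finset.sum_le_sum fun i _ => ?_
  rw [hrepr, norm_mul, mul_pow]
  gcongr
  exact hM _ (hl i)

/-- Only the vectors `R^k x` with `k ≤ deg p` matter. Compressing `R` to their finite-dimensional
span keeps symmetry and both bounds, and does not change these powers applied to `x`, so the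
infinite-dimensional estimate follows from the finite-dimensional one. -/
theorem IsUnitSymmetric.norm_aeval_apply_le {R : H →L[ℝ] H} (hR : IsUnitSymmetric R)
    (p : Polynomial ℝ) {M : ℝ} (hM : ∀ r ∈ Icc (0 : ℝ) 1, |p.eval r| ≤ M) (x : H) :
    ‖Polynomial.aeval R p x‖ ≤ M * ‖x‖ := by
  set U : Submodule ℝ H :=
    Submodule.span ℝ (Set.range fun k : Fin (p.natDegree + 1) => (R ^ (k : ℕ)) x)
  have hU : FiniteDimensional ℝ U := FiniteDimensional.span_of_finite ℝ (Set.finite_range _)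
  have hmem : ∀ k ≤ p.natDegree, (R ^ k) x ∈ U := fun k hk =>
    Submodule.subset_span ⟨⟨k, by omega⟩, rfl⟩
  set T : U →ₗ[ℝ] U := (U.orthogonalProjectionOnto ∘L R ∘L U.subtypeL).toLinearMap
  have hTi : ∀ y z : U, inner ℝ (T y) z = inner ℝ (R y) (z : H) := by
    intro y z
    simp [T]
  have hT : T.IsSymmetric := by
    intro y z
    rw [hTi, real_inner_comm (T z) y, hTi, hR.symm, real_inner_comm]
  have hx : x ∈ U := by simpa using hmem 0 (by omega)
  have hpow : ∀ k ≤ p.natDegree, (((T ^ k) ⟨x, hx⟩ : U) : H) = (R ^ k) x := by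
    intro k
    induction k with
    | zero => intro _; simp
    | succ k ih =>
      intro hk
      rw [pow_succ', pow_succ', Module.End.mul_apply, mul_apply_eq_comp]
      have h1 : R ((T ^ k) ⟨x, hx⟩ : U) = (R ^ (k + 1)) x := by
        rw [ih (by omega), pow_succ', mul_apply_eq_comp]
      have h2 : ((T ((T ^ k) ⟨x, hx⟩) : U) : H) =
          (U.orthogonalProjectionOnto (R ((T ^ k) ⟨x, hx⟩ : U)) : H) := rfl
      rw [h2, h1, ← Submodule.starProjection_apply,
        Submodule.starProjection_eq_self_iff.2 (hmem _ hk), pow_succ',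
        mul_apply_eq_comp]
  have haeval : ((Polynomial.aeval T p ⟨x, hx⟩ : U) : H) = Polynomial.aeval R p x := by
    rw [Polynomial.aeval_eq_sum_range, Polynomial.aeval_eq_sum_range]
    simp only [LinearMap.sum_apply, LinearMap.smul_apply, sum_apply,
      smul_apply, Submodule.coe_sum, Submodule.coe_smul]
    refine Finset.sum_congr rfl fun k hk => ?_
    rw [hpow k (by simpa [Nat.lt_succ_iff] using hk)]
  have := norm_aeval_apply_le_of_finiteDimensional hT (fun y => by rw [hTi]; exact hR.nonneg y)
    (fun y => by rw [hTi]; exact hR.le y) p hM ⟨x, hx⟩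
  rw [← haeval]
  exact this

/-- Polynomials approximating a continuous function on `[0, 1]`. -/
theorem exists_polynomial_approx (f : C(Icc (0 : ℝ) 1, ℝ)) (n : ℕ) :
    ∃ p : Polynomial ℝ, ‖p.toContinuousMapOn (Icc (0 : ℝ) 1) - f‖ < 1 / ((n : ℝ) + 1) :=
  exists_polynomial_near_continuousMap 0 1 f _ (by positivity)

/-- A sequence of polynomials converging to `f` uniformly on `[0, 1]`. -/
def polyApprox (f : C(Icc (0 : ℝ) 1, ℝ)) (n : ℕ) : Polynomial ℝ :=
  (exists_polynomial_approx f n).choose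

theorem norm_polyApprox_sub (f : C(Icc (0 : ℝ) 1, ℝ)) (n : ℕ) :
    ‖(polyApprox f n).toContinuousMapOn (Icc (0 : ℝ) 1) - f‖ < 1 / ((n : ℝ) + 1) :=
  (exists_polynomial_approx f n).choose_spec

theorem tendsto_polyApprox (f : C(Icc (0 : ℝ) 1, ℝ)) :
    Tendsto (fun n => (polyApprox f n).toContinuousMapOn (Icc (0 : ℝ) 1)) atTop (𝓝 f) := by
  rw [tendsto_iff_norm_sub_tendsto_zero]
  exact squeeze_zero (fun _ => norm_nonneg _) (fun n => (norm_polyApprox_sub f n).le)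
    tendsto_one_div_add_atTop_nhds_zero_nat

theorem IsUnitSymmetric.norm_aeval_le {R : H →L[ℝ] H} (hR : IsUnitSymmetric R)
    (p : Polynomial ℝ) : ‖Polynomial.aeval R p‖ ≤ ‖p.toContinuousMapOn (Icc (0 : ℝ) 1)‖ := by
  refine ContinuousLinearMap.opNorm_le_bound _ (norm_nonneg _) fun x => ?_
  refine hR.norm_aeval_apply_le p (fun r hr => ?_) x
  exact (p.toContinuousMapOn (Icc (0 : ℝ) 1)).norm_coe_le_norm ⟨r, hr⟩

/-- The operator `f(R)`, for `f` continuous on `[0, 1]`. -/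
def funCalc (R : H →L[ℝ] H) (f : C(Icc (0 : ℝ) 1, ℝ)) : H →L[ℝ] H :=
  limUnder atTop fun n => Polynomial.aeval R (polyApprox f n)

variable [CompleteSpace H]

theorem IsUnitSymmetric.tendsto_funCalc_polyApprox {R : H →L[ℝ] H} (hR : IsUnitSymmetric R)
    (f : C(Icc (0 : ℝ) 1, ℝ)) :
    Tendsto (fun n => Polynomial.aeval R (polyApprox f n)) atTop (𝓝 (funCalc R f)) := by
  refine CauchySeq.tendsto_limUnder ?_
  have h := (tendsto_polyApprox f).cauchySeq
  rw [Metric.cauchySeq_iff] at h ⊢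
  intro ε hε
  obtain ⟨N, hN⟩ := h ε hε
  refine ⟨N, fun m hm n hn => lt_of_le_of_lt ?_ (hN m hm n hn)⟩
  rw [dist_eq_norm, dist_eq_norm, ← map_sub]
  refine (hR.norm_aeval_le _).trans (le_of_eq ?_)
  congr 1
  ext x
  simp

theorem IsUnitSymmetric.norm_funCalc_sub_aeval_le {R : H →L[ℝ] H} (hR : IsUnitSymmetric R)
    (f : C(Icc (0 : ℝ) 1, ℝ)) (p : Polynomial ℝ) :
    ‖funCalc R f - Polynomial.aeval R p‖ ≤ ‖f - p.toContinuousMapOn (Icc (0 : ℝ) 1)‖ := by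
  refine le_of_tendsto_of_tendsto ((hR.tendsto_funCalc_polyApprox f).sub_const _).norm
    ((tendsto_polyApprox f).sub_const _).norm (Eventually.of_forall fun n => ?_)
  dsimp only
  rw [← map_sub]
  refine (hR.norm_aeval_le _).trans (le_of_eq ?_)
  congr 1
  ext x
  simp

/-- Makes `funCalc` independent of the chosen approximants, so that algebraic identities can be
checked on any convenient sequence of polynomials. -/
theorem IsUnitSymmetric.tendsto_aeval {R : H →L[ℝ] H} (hR : IsUnitSymmetric R)
    {f : C(Icc (0 : ℝ) 1, ℝ)} {p : ℕ → Polynomial ℝ}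
    (hp : Tendsto (fun n => (p n).toContinuousMapOn (Icc (0 : ℝ) 1)) atTop (𝓝 f)) :
    Tendsto (fun n => Polynomial.aeval R (p n)) atTop (𝓝 (funCalc R f)) := by
  rw [tendsto_iff_norm_sub_tendsto_zero] at hp ⊢
  refine squeeze_zero (fun _ => norm_nonneg _) (fun n => ?_) hp
  rw [norm_sub_rev, norm_sub_rev _ f]
  exact hR.norm_funCalc_sub_aeval_le f (p n)

theorem IsUnitSymmetric.funCalc_toContinuousMapOn {R : H →L[ℝ] H} (hR : IsUnitSymmetric R)
    (p : Polynomial ℝ) : funCalc R (p.toContinuousMapOn (Icc (0 : ℝ) 1)) = Polynomial.aeval R p :=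
  tendsto_nhds_unique (hR.tendsto_aeval (p := fun _ => p) tendsto_const_nhds) tendsto_const_nhds

theorem IsUnitSymmetric.funCalc_mul {R : H →L[ℝ] H} (hR : IsUnitSymmetric R)
    (f g : C(Icc (0 : ℝ) 1, ℝ)) : funCalc R (f * g) = funCalc R f * funCalc R g := by
  refine tendsto_nhds_unique (hR.tendsto_aeval (p := fun n => polyApprox f n * polyApprox g n) ?_)
    ?_
  · convert (tendsto_polyApprox f).mul (tendsto_polyApprox g) using 2 with n
    ext x
    simp
  · simpa using (hR.tendsto_funCalc_polyApprox f).mul (hR.tendsto_funCalc_polyApprox g)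

theorem IsUnitSymmetric.funCalc_sub {R : H →L[ℝ] H} (hR : IsUnitSymmetric R)
    (f g : C(Icc (0 : ℝ) 1, ℝ)) : funCalc R (f - g) = funCalc R f - funCalc R g := by
  refine tendsto_nhds_unique (hR.tendsto_aeval (p := fun n => polyApprox f n - polyApprox g n) ?_)
    ?_
  · convert (tendsto_polyApprox f).sub (tendsto_polyApprox g) using 2 with n
    ext x
    simp
  · simpa using (hR.tendsto_funCalc_polyApprox f).sub (hR.tendsto_funCalc_polyApprox g)

theorem IsUnitSymmetric.norm_funCalc_le {R : H →L[ℝ] H} (hR : IsUnitSymmetric R)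
    (f : C(Icc (0 : ℝ) 1, ℝ)) : ‖funCalc R f‖ ≤ ‖f‖ := by
  simpa [show (0 : Polynomial ℝ).toContinuousMapOn (Icc (0 : ℝ) 1) = 0 by ext; simp]
    using hR.norm_funCalc_sub_aeval_le f 0

/-- Used with `j` the embedding of the form domain, `K = j* j` and `R = j j*`: the semigroup on the
form domain is the restriction of the one on `H`. -/
theorem IsUnitSymmetric.intertwine_funCalc {V : Type*} [NormedAddCommGroup V]
    [InnerProductSpace ℝ V] [CompleteSpace V] {R : H →L[ℝ] H} (hR : IsUnitSymmetric R)
    {K : V →L[ℝ] V} (hK : IsUnitSymmetric K) {j : V →L[ℝ] H} (h : ∀ v, j (K v) = R (j v))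
    (f : C(Icc (0 : ℝ) 1, ℝ)) (v : V) : j (funCalc K f v) = funCalc R f (j v) := by
  have hpow : ∀ (n : ℕ) (v : V), j ((K ^ n) v) = (R ^ n) (j v) := by
    intro n
    induction n with
    | zero => intro v; simp
    | succ n ih =>
      intro v
      rw [pow_succ, pow_succ, mul_apply_eq_comp, mul_apply_eq_comp, ih, h]
  have hp : ∀ p : Polynomial ℝ, j (Polynomial.aeval K p v) = Polynomial.aeval R p (j v) := by
    intro p
    rw [Polynomial.aeval_eq_sum_range, Polynomial.aeval_eq_sum_range]
    simp only [sum_apply, smul_apply, map_sum, map_smul, hpow]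
  have h1 : Tendsto (fun n => j (Polynomial.aeval K (polyApprox f n) v)) atTop
      (𝓝 (j (funCalc K f v))) :=
    (j.continuous.tendsto _).comp
      (((ContinuousLinearMap.apply ℝ V v).continuous.tendsto _).comp
        (hK.tendsto_funCalc_polyApprox f))
  have h2 : Tendsto (fun n => Polynomial.aeval R (polyApprox f n) (j v)) atTop
      (𝓝 (funCalc R f (j v))) :=
    ((ContinuousLinearMap.apply ℝ H (j v)).continuous.tendsto _).comp
      (hR.tendsto_funCalc_polyApprox f)
  simp only [hp] at h1
  exact tendsto_nhds_unique h1 h2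

/-- Strong convergence of operators implies strong convergence of continuous functions of them. -/
theorem IsUnitSymmetric.tendsto_funCalc {R : ℕ → H →L[ℝ] H} {S : H →L[ℝ] H}
    (hR : ∀ n, IsUnitSymmetric (R n)) (hS : IsUnitSymmetric S)
    (h : ∀ x, Tendsto (fun n => R n x) atTop (𝓝 (S x)))
    (f : C(Icc (0 : ℝ) 1, ℝ)) (x : H) :
    Tendsto (fun n => funCalc (R n) f x) atTop (𝓝 (funCalc S f x)) := by
  -- The uniform bound lets strong convergence pass to powers; without it products of strongly
  -- convergent operators are out of control.
  have hnorm : ∀ n, ‖R n‖ ≤ 1 := fun n => by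
    refine ContinuousLinearMap.opNorm_le_bound _ zero_le_one fun x => ?_
    have := (hR n).norm_aeval_apply_le Polynomial.X (M := 1)
      (fun r hr => by simpa [abs_of_nonneg hr.1] using hr.2) x
    simpa using this
  have hpow : ∀ (k : ℕ) (x : H), Tendsto (fun n => (R n ^ k) x) atTop (𝓝 ((S ^ k) x)) := by
    intro k
    induction k with
    | zero => intro x; simp
    | succ k ih =>
      intro x
      have h1 := h ((S ^ k) x)
      have h2 : Tendsto (fun n => R n ((R n ^ k) x - (S ^ k) x)) atTop (𝓝 0) := by
        refine squeeze_zero_norm (fun n => ?_) (tendsto_iff_norm_sub_tendsto_zero.1 (ih x))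
        simpa using (R n).le_of_opNorm_le (hnorm n) ((R n ^ k) x - (S ^ k) x)
      have h3 := h2.add h1
      simpa [pow_succ'] using h3
  have hp : ∀ p : Polynomial ℝ, Tendsto (fun n => Polynomial.aeval (R n) p x) atTop
      (𝓝 (Polynomial.aeval S p x)) := by
    intro p
    simp only [Polynomial.aeval_eq_sum_range, sum_apply,
      smul_apply]
    exact tendsto_finsetSum _ fun k _ => (hpow k x).const_smul _
  rw [Metric.tendsto_atTop]
  intro ε hε
  obtain ⟨m, hm⟩ := exists_nat_one_div_lt (show 0 < ε / (3 * (‖x‖ + 1)) by positivity)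
  set p := polyApprox f m
  have hb : ∀ T : H →L[ℝ] H, IsUnitSymmetric T →
      ‖funCalc T f x - Polynomial.aeval T p x‖ ≤ ε / 3 := by
    intro T hT
    have h1 : ‖funCalc T f - Polynomial.aeval T p‖ ≤ ε / (3 * (‖x‖ + 1)) := by
      refine (hT.norm_funCalc_sub_aeval_le f p).trans ?_
      rw [norm_sub_rev]
      exact ((norm_polyApprox_sub f m).trans hm).le
    have h2 := (funCalc T f - Polynomial.aeval T p).le_of_opNorm_le h1 x
    rw [sub_apply] at h2
    refine h2.trans ?_
    rw [div_mul_eq_mul_div, div_le_div_iff₀ (by positivity) (by positivity)]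
    nlinarith [norm_nonneg x]
  obtain ⟨N, hN⟩ := Metric.tendsto_atTop.1 (hp p) (ε / 3) (by positivity)
  refine ⟨N, fun n hn => ?_⟩
  have h1 := hb _ (hR n)
  have h2 := hb _ hS
  have h3 := hN n hn
  rw [dist_eq_norm] at h3 ⊢
  have : funCalc (R n) f x - funCalc S f x =
      (funCalc (R n) f x - Polynomial.aeval (R n) p x)
      + (Polynomial.aeval (R n) p x - Polynomial.aeval S p x)
      - (funCalc S f x - Polynomial.aeval S p x) := by abel
  rw [this]
  calc _ ≤ _ := norm_sub_le _ _
    _ ≤ _ := add_le_add_left (norm_add_le _ _) _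
    _ < ε := by linarith

end FunctionalCalculus

/-! ### The semigroup `exp (-t (K⁻¹ - 1))` -/

/-- The function `r ↦ exp (-t (r⁻¹ - 1))` on `[0, 1]`, for `t > 0`; the constant `1` for `t ≤ 0`. -/
def heatFun (t : ℝ) : C(Icc (0 : ℝ) 1, ℝ) :=
  -- `expNegInvGlue (r / t)` is `exp (-t / r)` for `r > 0` and `0` at `r = 0`, which gives
  -- continuity up to the endpoint where `r⁻¹` blows up.
  if 0 < t then ⟨fun r => Real.exp t * expNegInvGlue (r / t), by
    have := (expNegInvGlue.contDiff (n := 0)).continuous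
    fun_prop⟩ else 1

/-- The function `r ↦ r⁻¹ exp (-t (r⁻¹ - 1))` on `[0, 1]`, for `t > 0`. -/
def heatFunDiv (t : ℝ) : C(Icc (0 : ℝ) 1, ℝ) :=
  ⟨fun r => Real.exp t * t⁻¹ * ((r / t : ℝ)⁻¹ * expNegInvGlue (r / t)), by
    have := expNegInvGlue.continuous_polynomial_eval_inv_mul Polynomial.X
    simp only [Polynomial.eval_X] at this
    have h2 : Continuous fun r : Icc (0 : ℝ) 1 => (r : ℝ) / t := by fun_prop
    exact continuous_const.mul (this.comp h2)⟩

theorem heatFun_of_nonpos {t : ℝ} (ht : t ≤ 0) : heatFun t = 1 := by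
  simp [heatFun, not_lt.2 ht]

theorem heatFun_apply_zero {t : ℝ} (ht : 0 < t) (r : Icc (0 : ℝ) 1) (hr : (r : ℝ) = 0) :
    heatFun t r = 0 := by
  simp [heatFun, ht, hr]

theorem heatFun_apply {t : ℝ} (ht : 0 ≤ t) (r : Icc (0 : ℝ) 1) (hr : (0 : ℝ) < r) :
    heatFun t r = Real.exp (-(t * ((r : ℝ)⁻¹ - 1))) := by
  rcases ht.eq_or_lt with rfl | ht
  · simp [heatFun]
  · have h : ¬ (r : ℝ) / t ≤ 0 := by have := div_pos hr ht; linarith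
    simp only [heatFun, ht, if_true, ContinuousMap.coe_mk, expNegInvGlue, h, if_false]
    rw [← Real.exp_add]
    congr 1
    field_simp
    ring

theorem inv_sub_one_nonneg (r : Icc (0 : ℝ) 1) (hr : (0 : ℝ) < r) : 0 ≤ (r : ℝ)⁻¹ - 1 := by
  have := (one_le_inv₀ hr).2 r.2.2
  linarith

theorem heatFun_mem_Icc (t : ℝ) (r : Icc (0 : ℝ) 1) : heatFun t r ∈ Icc (0 : ℝ) 1 := by
  rcases le_or_gt t 0 with ht | ht
  · simp [heatFun_of_nonpos ht]
  rcases r.2.1.eq_or_lt with hr | hr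
  · simp [heatFun_apply_zero ht r hr.symm]
  · rw [heatFun_apply ht.le r hr]
    refine ⟨(Real.exp_pos _).le, Real.exp_le_one_iff.2 ?_⟩
    have := mul_nonneg ht.le (inv_sub_one_nonneg r hr)
    linarith

theorem norm_heatFun_le (t : ℝ) : ‖heatFun t‖ ≤ 1 := by
  rw [ContinuousMap.norm_le _ zero_le_one]
  intro r
  have := heatFun_mem_Icc t r
  rw [Real.norm_eq_abs, abs_of_nonneg this.1]
  exact this.2

theorem heatFun_add {s t : ℝ} (hs : 0 ≤ s) (ht : 0 ≤ t) :
    heatFun (s + t) = heatFun s * heatFun t := by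
  rcases hs.eq_or_lt with rfl | hs'
  · rw [heatFun_of_nonpos le_rfl]; simp
  rcases ht.eq_or_lt with rfl | ht'
  · rw [heatFun_of_nonpos le_rfl]; simp
  ext r
  rcases r.2.1.eq_or_lt with hr | hr
  · simp [heatFun_apply_zero hs' r hr.symm, heatFun_apply_zero (add_pos hs' ht') r hr.symm]
  · rw [ContinuousMap.mul_apply, heatFun_apply hs r hr, heatFun_apply ht r hr,
      heatFun_apply (add_nonneg hs ht) r hr, ← Real.exp_add]
    congr 1
    ring

/-- The identity function on `[0, 1]`. -/
def unitId : C(Icc (0 : ℝ) 1, ℝ) := ⟨fun r => r, continuous_subtype_val⟩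

/-- The exponential decay at `r = 0` absorbs a factor `r⁻¹`. On the operator side this is smoothing:
`heatOp` maps into the range of `K` for `t > 0`. -/
theorem unitId_mul_heatFunDiv {t : ℝ} (ht : 0 < t) : unitId * heatFunDiv t = heatFun t := by
  ext r
  rcases r.2.1.eq_or_lt with hr | hr
  · simp [heatFun_apply_zero ht r hr.symm, unitId, hr.symm]
  · simp only [ContinuousMap.mul_apply, unitId, heatFunDiv, heatFun, ht, if_true,
      ContinuousMap.coe_mk]
    field_simp

theorem norm_heatFun_mul_unitId_sub_le {t : ℝ} (ht : 0 ≤ t) :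
    ‖heatFun t * unitId - unitId‖ ≤ t := by
  rw [ContinuousMap.norm_le _ ht]
  intro r
  simp only [ContinuousMap.sub_apply, ContinuousMap.mul_apply, unitId, ContinuousMap.coe_mk]
  rcases r.2.1.eq_or_lt with hr | hr
  · simpa [hr.symm] using ht
  have h1 := heatFun_mem_Icc t r
  rw [show heatFun t r * (r : ℝ) - r = -(r * (1 - heatFun t r)) by ring, norm_neg,
    Real.norm_eq_abs, abs_of_nonneg (mul_nonneg hr.le (by linarith [h1.2])),
    heatFun_apply ht r hr]
  have h2 := Real.add_one_le_exp (-(t * ((r : ℝ)⁻¹ - 1)))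
  have h3 : (r : ℝ) * (1 - Real.exp (-(t * ((r : ℝ)⁻¹ - 1)))) ≤ r * (t * ((r : ℝ)⁻¹ - 1)) :=
    mul_le_mul_of_nonneg_left (by linarith) hr.le
  refine h3.trans ?_
  have h4 : (r : ℝ) * (t * ((r : ℝ)⁻¹ - 1)) = t * (1 - r) := by field_simp
  rw [h4]
  nlinarith

/-- From `e^y ≥ 1 + y` and `(1 + y)(1 - y + y²) = 1 + y³ ≥ 1`. -/
theorem exp_neg_le_one_sub_add_sq {y : ℝ} (hy : 0 ≤ y) : Real.exp (-y) ≤ 1 - y + y ^ 2 := by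
  have h1 := Real.add_one_le_exp y
  rw [Real.exp_neg, inv_le_comm₀ (Real.exp_pos _) (by nlinarith)]
  refine le_trans ?_ h1
  rw [inv_le_iff_one_le_mul₀ (by nlinarith)]
  nlinarith [pow_nonneg hy 3]

/-- With `s = r⁻¹ - 1`, the function is `r² (e^{-ts} - 1 + ts)`, at most `(rs)² t²`, and `rs = 1 - r
≤ 1`. The two factors of `r` are what makes the Taylor remainder uniform in `r`, so the semigroup is
differentiated after multiplication by `K²`. -/
theorem norm_heatFun_deriv_le {t : ℝ} (ht : 0 ≤ t) :
    ‖(heatFun t - 1) * (unitId * unitId) + t • (unitId * (1 - unitId))‖ ≤ t ^ 2 := by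
  rw [ContinuousMap.norm_le _ (by positivity)]
  intro r
  simp only [ContinuousMap.add_apply, ContinuousMap.sub_apply, ContinuousMap.mul_apply, unitId,
    ContinuousMap.coe_mk, ContinuousMap.smul_apply, ContinuousMap.one_apply, smul_eq_mul]
  rcases r.2.1.eq_or_lt with hr | hr
  · simpa [hr.symm] using by positivity
  rw [heatFun_apply ht r hr]
  set s := (r : ℝ)⁻¹ - 1 with hs
  have hs0 : 0 ≤ s := inv_sub_one_nonneg r hr
  have hrs : (r : ℝ) * s = 1 - r := by rw [hs]; field_simp
  have h1 := Real.add_one_le_exp (-(t * s))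
  have h2 := exp_neg_le_one_sub_add_sq (mul_nonneg ht hs0)
  have h3 : (Real.exp (-(t * s)) - 1) * ((r : ℝ) * r) + t * (r * (1 - r)) =
      (r : ℝ) ^ 2 * (Real.exp (-(t * s)) - 1 + t * s) := by
    rw [← hrs]; ring
  rw [h3, Real.norm_eq_abs, abs_of_nonneg (mul_nonneg (sq_nonneg _) (by linarith))]
  calc (r : ℝ) ^ 2 * (Real.exp (-(t * s)) - 1 + t * s) ≤ (r : ℝ) ^ 2 * (t * s) ^ 2 := by
        gcongr; linarith
    _ = (r * s) ^ 2 * t ^ 2 := by ring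
    _ ≤ 1 * t ^ 2 := by
        gcongr
        rw [hrs]
        have := r.2.2
        nlinarith
    _ = t ^ 2 := one_mul _

section Semigroup

variable {V : Type*} [NormedAddCommGroup V] [InnerProductSpace ℝ V] [CompleteSpace V]

/-- The semigroup `exp (-t (K⁻¹ - 1))`, for `t ≥ 0`, extended by the identity to `t ≤ 0`. -/
def heatOp (K : V →L[ℝ] V) (t : ℝ) : V →L[ℝ] V := funCalc K (heatFun t)

variable {K : V →L[ℝ] V}

theorem IsUnitSymmetric.funCalc_one (hK : IsUnitSymmetric K) : funCalc K 1 = 1 := by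
  have := hK.funCalc_toContinuousMapOn 1
  rw [map_one] at this
  rw [← this]
  congr 1
  ext; simp

theorem IsUnitSymmetric.funCalc_unitId (hK : IsUnitSymmetric K) : funCalc K unitId = K := by
  have := hK.funCalc_toContinuousMapOn Polynomial.X
  rw [Polynomial.aeval_X] at this
  nth_rw 2 [← this]
  congr 1
  ext; simp [unitId]

theorem IsUnitSymmetric.heatOp_of_nonpos (hK : IsUnitSymmetric K) {t : ℝ} (ht : t ≤ 0) :
    heatOp K t = 1 := by
  rw [heatOp, heatFun_of_nonpos ht, hK.funCalc_one]

theorem IsUnitSymmetric.norm_heatOp_apply_le (hK : IsUnitSymmetric K) (t : ℝ) (v : V) :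
    ‖heatOp K t v‖ ≤ ‖v‖ := by
  simpa using (heatOp K t).le_of_opNorm_le ((hK.norm_funCalc_le _).trans (norm_heatFun_le t)) v

theorem IsUnitSymmetric.heatOp_add (hK : IsUnitSymmetric K) {s t : ℝ} (hs : 0 ≤ s) (ht : 0 ≤ t) :
    heatOp K (s + t) = heatOp K s * heatOp K t := by
  rw [heatOp, heatFun_add hs ht, hK.funCalc_mul, heatOp, heatOp]

theorem IsUnitSymmetric.heatOp_comm (hK : IsUnitSymmetric K) (t : ℝ) (v : V) :
    heatOp K t (K v) = K (heatOp K t v) := by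
  have h := hK.funCalc_mul (heatFun t) unitId
  rw [mul_comm, hK.funCalc_mul, hK.funCalc_unitId] at h
  exact (congrArg (fun T : V →L[ℝ] V => T v) h).symm

theorem IsUnitSymmetric.heatOp_mem_range (hK : IsUnitSymmetric K) {t : ℝ} (ht : 0 < t) (v : V) :
    ∃ w, heatOp K t v = K w := by
  refine ⟨funCalc K (heatFunDiv t) v, ?_⟩
  rw [heatOp, ← unitId_mul_heatFunDiv ht, hK.funCalc_mul, hK.funCalc_unitId]
  rfl

theorem IsUnitSymmetric.norm_heatOp_range_sub_le (hK : IsUnitSymmetric K) {t : ℝ} (ht : 0 ≤ t)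
    (v : V) : ‖heatOp K t (K v) - K v‖ ≤ t * ‖v‖ := by
  have h := hK.funCalc_sub (heatFun t * unitId) unitId
  rw [hK.funCalc_mul, hK.funCalc_unitId] at h
  have h2 := ContinuousLinearMap.le_of_opNorm_le _
    ((hK.norm_funCalc_le _).trans (norm_heatFun_mul_unitId_sub_le ht)) v
  rw [h] at h2
  exact h2

/-- For a symmetric operator, the orthogonal complement of the range is the kernel. -/
theorem IsUnitSymmetric.denseRange (hK : IsUnitSymmetric K) (hinj : Function.Injective K) :
    DenseRange K := by
  have h : Dense (LinearMap.range K.toLinearMap : Set V) := by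
    rw [Submodule.dense_iff_topologicalClosure_eq_top, Submodule.topologicalClosure_eq_top_iff,
      Submodule.eq_bot_iff]
    intro v hv
    refine hinj ?_
    rw [map_zero, ← inner_self_eq_zero (𝕜 := ℝ), hK.symm, real_inner_comm]
    exact (Submodule.mem_orthogonal _ _).1 hv _ ⟨_, rfl⟩
  rw [LinearMap.coe_range] at h
  exact h

/-- On the dense range of `K` there is the rate `t‖w‖`; contractivity extends the convergence to all
vectors. -/
theorem IsUnitSymmetric.tendsto_heatOp_zero (hK : IsUnitSymmetric K)
    (hinj : Function.Injective K) (v : V) :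
    Tendsto (fun h : ℝ => ‖heatOp K |h| v - v‖) (𝓝 0) (𝓝 0) := by
  rw [Metric.tendsto_nhds_nhds]
  intro ε hε
  obtain ⟨w, hw⟩ := (hK.denseRange hinj).exists_dist_lt v (show 0 < ε / 3 by positivity)
  rw [dist_eq_norm] at hw
  refine ⟨ε / (3 * (‖w‖ + 1)), by positivity, fun {h} hh => ?_⟩
  simp only [dist_zero_right, Real.norm_eq_abs, abs_norm] at hh ⊢
  have h1 : heatOp K |h| v - v =
      heatOp K |h| (v - K w) + (heatOp K |h| (K w) - K w) - (v - K w) := by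
    rw [map_sub]; abel
  have h2 := hK.norm_heatOp_apply_le |h| (v - K w)
  have h3 := hK.norm_heatOp_range_sub_le (abs_nonneg h) w
  have h4 : |h| * ‖w‖ ≤ ε / 3 := by
    have : |h| * ‖w‖ ≤ ε / (3 * (‖w‖ + 1)) * ‖w‖ := by gcongr
    refine this.trans ?_
    rw [div_mul_eq_mul_div, div_le_div_iff₀ (by positivity) (by positivity)]
    nlinarith [norm_nonneg w]
  rw [h1]
  calc _ ≤ _ := norm_sub_le _ _
    _ ≤ _ := add_le_add_left (norm_add_le _ _) _
    _ < ε := by linarith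

theorem IsUnitSymmetric.continuous_heatOp (hK : IsUnitSymmetric K)
    (hinj : Function.Injective K) (v : V) : Continuous fun t => heatOp K t v := by
  have hmax : ∀ t, heatOp K t = heatOp K (max t 0) := by
    intro t
    rcases le_total t 0 with h | h
    · rw [max_eq_right h, hK.heatOp_of_nonpos h, hK.heatOp_of_nonpos le_rfl]
    · rw [max_eq_left h]
  have hle : ∀ s t : ℝ, 0 ≤ s → s ≤ t →
      ‖heatOp K t v - heatOp K s v‖ ≤ ‖heatOp K |t - s| v - v‖ := by
    intro s t hs hst
    have h1 : heatOp K t = heatOp K s * heatOp K (t - s) := by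
      rw [← hK.heatOp_add hs (by linarith)]; congr 1; ring
    rw [h1, mul_apply_eq_comp, ← map_sub, abs_of_nonneg (by linarith)]
    exact hK.norm_heatOp_apply_le _ _
  refine continuous_iff_continuousAt.2 fun s => ?_
  rw [ContinuousAt, tendsto_iff_norm_sub_tendsto_zero]
  have hlim : Tendsto (fun t : ℝ => ‖heatOp K |max t 0 - max s 0| v - v‖) (𝓝 s) (𝓝 0) := by
    refine (hK.tendsto_heatOp_zero hinj v).comp ?_
    have : Continuous fun t : ℝ => max t 0 - max s 0 := by fun_prop
    simpa using this.tendsto s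
  refine squeeze_zero (fun _ => norm_nonneg _) (fun t => ?_) hlim
  rw [hmax t, hmax s]
  rcases le_total (max s 0) (max t 0) with h | h
  · exact hle _ _ (le_max_right _ _) h
  · rw [norm_sub_rev, abs_sub_comm]
    exact hle _ _ (le_max_right _ _) h

/-- This is the integrated equation `x' = -Ax` with `A = K⁻¹ - 1`, multiplied by `K` so that only
bounded operators occur (`KA = 1 - K`). The identity is proved with one more factor `K`, which
injectivity cancels at the end. -/
theorem IsUnitSymmetric.heatOp_integral (hK : IsUnitSymmetric K) (hinj : Function.Injective K)
    (v : V) {t : ℝ} (ht : 0 ≤ t) :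
    K v - K (heatOp K t v) = ∫ s in (0 : ℝ)..t, (heatOp K s v - K (heatOp K s v)) := by
  have hc := hK.continuous_heatOp hinj v
  have hcs : Continuous fun s => heatOp K s v - K (heatOp K s v) := hc.sub (K.continuous.comp hc)
  have hstep : ∀ (h : ℝ), 0 ≤ h → ∀ w : V,
      ‖K (K (heatOp K h w)) - K (K w) + h • K (w - K w)‖ ≤ h ^ 2 * ‖w‖ := by
    intro h hh w
    have h1 : funCalc K ((heatFun h - 1) * (unitId * unitId) + h • (unitId * (1 - unitId))) w =
        K (K (heatOp K h w)) - K (K w) + h • K (w - K w) := by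
      have e : (heatFun h - 1) * (unitId * unitId) + h • (unitId * (1 - unitId)) =
          unitId * (unitId * heatFun h) - unitId * unitId
            - (h • (1 : C(Icc (0 : ℝ) 1, ℝ))) * (unitId * (unitId - 1)) := by
        ext r
        simp
        ring
      have e2 : funCalc K (h • (1 : C(Icc (0 : ℝ) 1, ℝ))) = h • 1 := by
        have := hK.funCalc_toContinuousMapOn (Polynomial.C h)
        rw [Polynomial.aeval_C] at this
        rw [show (h • (1 : C(Icc (0 : ℝ) 1, ℝ))) =
          (Polynomial.C h).toContinuousMapOn (Icc (0 : ℝ) 1) by ext; simp, this]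
        rfl
      rw [e, hK.funCalc_sub, hK.funCalc_sub, hK.funCalc_mul, hK.funCalc_mul, hK.funCalc_mul,
        hK.funCalc_mul, hK.funCalc_mul, hK.funCalc_sub, hK.funCalc_one, hK.funCalc_unitId, e2]
      simp only [sub_apply, mul_apply_eq_comp, smul_apply, one_apply_eq_self, heatOp, map_sub, smul_sub]
      abel
    rw [← h1]
    exact ContinuousLinearMap.le_of_opNorm_le _
      ((hK.norm_funCalc_le _).trans (norm_heatFun_deriv_le hh)) w
  have hderiv : ∀ s ∈ Ioo 0 t, HasDerivWithinAt (fun s => K (K (heatOp K s v)))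
      (-K (heatOp K s v - K (heatOp K s v))) (Ioi s) s := by
    intro s hs
    rw [hasDerivWithinAt_iff_isLittleO]
    have hO : (fun x => K (K (heatOp K x v)) - K (K (heatOp K s v))
        - (x - s) • -K (heatOp K s v - K (heatOp K s v))) =O[𝓝[>] s] fun x => (x - s) ^ 2 := by
      refine Asymptotics.IsBigO.of_bound ‖v‖ ?_
      filter_upwards [self_mem_nhdsWithin] with x hx
      have hx' : 0 ≤ x - s := sub_nonneg.2 (le_of_lt hx)
      have h1 : heatOp K x v = heatOp K (x - s) (heatOp K s v) := by
        rw [← mul_apply_eq_comp, ← hK.heatOp_add hx' hs.1.le]; congr 2; ring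
      rw [h1, smul_neg, sub_neg_eq_add]
      refine (hstep _ hx' _).trans ?_
      rw [Real.norm_eq_abs, abs_of_nonneg (by positivity), mul_comm]
      gcongr
      exact hK.norm_heatOp_apply_le _ _
    refine hO.trans_isLittleO ?_
    have h2 : Tendsto (fun x : ℝ => x - s) (𝓝[>] s) (𝓝 0) := by
      have : Continuous fun x : ℝ => x - s := by fun_prop
      simpa using (this.tendsto s).mono_left nhdsWithin_le_nhds
    have h3 := (Asymptotics.isLittleO_one_iff ℝ).2 h2
    simpa [sq] using h3.mul_isBigO (Asymptotics.isBigO_refl (fun x : ℝ => x - s) (𝓝[>] s))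
  have hftc := intervalIntegral.integral_eq_sub_of_hasDeriv_right_of_le ht
    ((K.continuous.comp (K.continuous.comp hc)).continuousOn) hderiv
    (((K.continuous.comp hcs).neg).intervalIntegrable _ _)
  have h0 : heatOp K 0 v = v := by rw [hK.heatOp_of_nonpos le_rfl]; rfl
  refine hinj ?_
  rw [← ContinuousLinearMap.intervalIntegral_comp_comm K (hcs.intervalIntegrable _ _)]
  rw [intervalIntegral.integral_neg] at hftc
  simp only [Function.comp_apply, h0] at hftc
  have h1 := neg_eq_iff_eq_neg.1 hftc
  rw [neg_sub] at h1
  rw [map_sub]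
  exact h1.symm

end Semigroup

/-! ### The evolution associated with a closed quadratic form -/

section HilbertTriple

variable {H V : Type*} [NormedAddCommGroup H] [InnerProductSpace ℝ H] [CompleteSpace H]
  [NormedAddCommGroup V] [InnerProductSpace ℝ V] [CompleteSpace V] {j : V →L[ℝ] H}

/-- If `V` is the form domain, normed by the form plus the inner product of `H`, then `⟨j* h, v⟩ =
⟨h, j v⟩` is the weak resolvent equation. Hence `j j*` is `(1 + A)⁻¹` on `H`, and `j* j` is the same
operator on `V`. -/
theorem isUnitSymmetric_comp_adjoint (hj : ∀ v, ‖j v‖ ≤ ‖v‖) :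
    IsUnitSymmetric (j ∘L j.adjoint) where
  symm x y := by
    simp only [ContinuousLinearMap.comp_apply]
    rw [← ContinuousLinearMap.adjoint_inner_right, ContinuousLinearMap.adjoint_inner_left]
  nonneg x := by
    simp only [ContinuousLinearMap.comp_apply]
    rw [← ContinuousLinearMap.adjoint_inner_right]
    exact real_inner_self_nonneg
  le x := by
    simp only [ContinuousLinearMap.comp_apply]
    have h1 : ‖j.adjoint x‖ ^ 2 ≤ ‖j.adjoint x‖ * ‖x‖ := by
      rw [← real_inner_self_eq_norm_sq, ContinuousLinearMap.adjoint_inner_right]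
      exact (real_inner_le_norm _ _).trans (by gcongr; exact hj _)
    rw [← ContinuousLinearMap.adjoint_inner_right, real_inner_self_eq_norm_sq]
    nlinarith [norm_nonneg x, norm_nonneg (j.adjoint x)]

theorem isUnitSymmetric_adjoint_comp (hj : ∀ v, ‖j v‖ ≤ ‖v‖) :
    IsUnitSymmetric (j.adjoint ∘L j) where
  symm x y := by
    simp only [ContinuousLinearMap.comp_apply]
    rw [ContinuousLinearMap.adjoint_inner_right, ContinuousLinearMap.adjoint_inner_left]
  nonneg x := by
    simp only [ContinuousLinearMap.comp_apply]
    rw [ContinuousLinearMap.adjoint_inner_left]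
    exact real_inner_self_nonneg
  le x := by
    simp only [ContinuousLinearMap.comp_apply]
    rw [ContinuousLinearMap.adjoint_inner_left, real_inner_self_eq_norm_sq]
    gcongr
    exact hj x

theorem injective_adjoint_comp (hinj : Function.Injective j) :
    Function.Injective (j.adjoint ∘L j) := by
  rw [injective_iff_map_eq_zero]
  intro v hv
  refine hinj ?_
  rw [map_zero, ← inner_self_eq_zero (𝕜 := ℝ), ← ContinuousLinearMap.adjoint_inner_left]
  simp only [ContinuousLinearMap.comp_apply] at hv
  rw [hv, inner_zero_left]

theorem heatOp_adjoint_comp (hj : ∀ v, ‖j v‖ ≤ ‖v‖) (t : ℝ) (v : V) :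
    j (heatOp (j.adjoint ∘L j) t v) = heatOp (j ∘L j.adjoint) t (j v) :=
  (isUnitSymmetric_comp_adjoint hj).intertwine_funCalc (isUnitSymmetric_adjoint_comp hj)
    (fun _ => rfl) _ _

/-- The identity `heatOp_integral` is paired with `k` in `V`; there `⟨Kw, k⟩ = ⟨j w, j k⟩`, so each
factor `K` turns the inner product of `V` into that of `H`. -/
theorem heatOp_weak_equation (hj : ∀ v, ‖j v‖ ≤ ‖v‖) (hinj : Function.Injective j)
    (v k : V) {t : ℝ} (ht : 0 ≤ t) :
    inner ℝ (j v - j (heatOp (j.adjoint ∘L j) t v)) (j k) =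
      ∫ s in (0 : ℝ)..t, (inner ℝ (heatOp (j.adjoint ∘L j) s v) k
        - inner ℝ (j (heatOp (j.adjoint ∘L j) s v)) (j k)) := by
  have hK := isUnitSymmetric_adjoint_comp hj
  have hKi := injective_adjoint_comp hinj
  set K := j.adjoint ∘L j with hKdef
  have h1 := hK.heatOp_integral hKi v ht
  have hc := hK.continuous_heatOp hKi v
  have h2 := congrArg (fun w => innerSL ℝ k w) h1
  have hcs : Continuous fun s => heatOp K s v - K (heatOp K s v) := hc.sub (K.continuous.comp hc)
  rw [← ContinuousLinearMap.intervalIntegral_comp_comm _ (hcs.intervalIntegrable _ _)] at h2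
  have h3 : ∀ w : V, inner ℝ k (K w) = inner ℝ (j w) (j k) := by
    intro w
    rw [hKdef, ContinuousLinearMap.comp_apply, ContinuousLinearMap.adjoint_inner_right,
      real_inner_comm]
  rw [← map_sub, innerSL_apply_apply, h3, map_sub] at h2
  rw [h2]
  refine intervalIntegral.integral_congr fun s _ => ?_
  simp only [innerSL_apply_apply, inner_sub_right, h3, real_inner_comm]

theorem integrableOn_exp_smul_heatOp (hj : ∀ v, ‖j v‖ ≤ ‖v‖) (hinj : Function.Injective j)
    (v : V) {α : ℝ} (hα : 0 < α) :
    IntegrableOn (fun t : ℝ => Real.exp (-α * t) • heatOp (j.adjoint ∘L j) t v) (Ioi 0) := by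
  have hK := isUnitSymmetric_adjoint_comp hj
  have hc := hK.continuous_heatOp (injective_adjoint_comp hinj) v
  have he : IntegrableOn (fun t : ℝ => Real.exp (-α * t) * ‖v‖) (Ioi 0) :=
    (exp_neg_integrableOn_Ioi 0 hα).mul_const _
  refine he.mono' ?_ (Eventually.of_forall fun t => ?_)
  · exact (Continuous.smul (by fun_prop) hc).aestronglyMeasurable
  · rw [norm_smul, Real.norm_eq_abs, Real.abs_exp]
    gcongr
    exact hK.norm_heatOp_apply_le _ _

/-- Integrating the derivative of `e^{-αt} K P_t v`, with `P_t` the semigroup, over `(0, ∞)` gives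
`w = K (v + (1 - α) w)` for the Laplace transform `w`, and `K = j* j`. -/
theorem laplace_heatOp_mem_range (hj : ∀ v, ‖j v‖ ≤ ‖v‖) (hinj : Function.Injective j)
    (v : V) {α : ℝ} (hα : 0 < α) :
    ∃ h, ∫ t in Ioi (0 : ℝ), Real.exp (-α * t) • heatOp (j.adjoint ∘L j) t v = j.adjoint h := by
  have hK := isUnitSymmetric_adjoint_comp hj
  have hKi := injective_adjoint_comp hinj
  have hint := integrableOn_exp_smul_heatOp hj hinj v hα
  set K := j.adjoint ∘L j with hKdef
  have hc := hK.continuous_heatOp hKi v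
  have hcs : Continuous fun s => heatOp K s v - K (heatOp K s v) := hc.sub (K.continuous.comp hc)
  -- `y` equals `K P_t v` for `t ≥ 0` and is differentiable on all of `ℝ`, whereas `heatOp` is
  -- frozen at the identity for negative times.
  set y : ℝ → V := fun t => K v - ∫ s in (0 : ℝ)..t, (heatOp K s v - K (heatOp K s v))
  have hy : ∀ t, 0 ≤ t → y t = K (heatOp K t v) := by
    intro t ht
    simp only [y, ← hK.heatOp_integral hKi v ht, sub_sub_cancel]
  have hyd : ∀ t, HasDerivAt y (-(heatOp K t v - K (heatOp K t v))) t := fun t =>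
    (hcs.integral_hasStrictDerivAt 0 t).hasDerivAt.const_sub _
  set w := ∫ t in Ioi (0 : ℝ), Real.exp (-α * t) • heatOp K t v
  have hed : ∀ t, HasDerivAt (fun t : ℝ => Real.exp (-α * t) • y t)
      (Real.exp (-α * t) • -(heatOp K t v - K (heatOp K t v))
        + (Real.exp (-α * t) * -α) • y t) t := by
    intro t
    have h1 : HasDerivAt (fun t : ℝ => Real.exp (-α * t)) (Real.exp (-α * t) * -α) t := by
      simpa using ((hasDerivAt_id t).const_mul (-α)).exp
    exact h1.smul (hyd t)
  set L : V →L[ℝ] V := (1 - α) • K - 1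
  have hL : ∀ t ∈ Ioi (0 : ℝ), Real.exp (-α * t) • -(heatOp K t v - K (heatOp K t v))
        + (Real.exp (-α * t) * -α) • y t = L (Real.exp (-α * t) • heatOp K t v) := by
    intro t ht
    rw [hy t (le_of_lt ht)]
    simp only [L, sub_apply, smul_apply, one_apply_eq_self, map_smul, smul_sub, sub_smul, mul_smul,
      smul_neg, neg_smul, one_smul]
    abel
  have hlim : Tendsto (fun t : ℝ => Real.exp (-α * t) • y t) atTop (𝓝 0) := by
    have h1 : Tendsto (fun t : ℝ => Real.exp (-α * t) * ‖K v‖) atTop (𝓝 0) := by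
      have : Tendsto (fun t : ℝ => Real.exp (-(α * t))) atTop (𝓝 0) :=
        Real.tendsto_exp_neg_atTop_nhds_zero.comp (tendsto_id.const_mul_atTop hα)
      simpa using this.mul_const ‖K v‖
    refine squeeze_zero_norm' ?_ h1
    filter_upwards [eventually_ge_atTop 0] with t ht
    rw [hy t ht, ← hK.heatOp_comm, norm_smul, Real.norm_eq_abs, Real.abs_exp]
    gcongr
    exact hK.norm_heatOp_apply_le _ _
  have hmain := integral_Ioi_of_hasDerivAt_of_tendsto (a := 0)
    (hed 0).continuousAt.continuousWithinAt (fun t _ => hed t)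
    ((integrableOn_congr_fun hL measurableSet_Ioi).2 (L.integrable_comp hint)) hlim
  rw [setIntegral_congr_fun measurableSet_Ioi hL, L.integral_comp_comm hint, hy 0 le_rfl,
    hK.heatOp_of_nonpos le_rfl] at hmain
  refine ⟨j (v + (1 - α) • w), ?_⟩
  change w = K _
  have h2 : (1 - α) • K w - w = 0 - K v := by
    rw [mul_zero, Real.exp_zero, one_smul] at hmain
    exact hmain
  rw [map_add, map_smul]
  have h3 : w = (1 - α) • K w - (0 - K v) := by rw [← h2]; abel
  rw [zero_sub, sub_neg_eq_add, add_comm] at h3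
  exact h3

end HilbertTriple

/-! ### Closed forms, their resolvents and semigroups -/

/-- A closed form on the Hilbert space `H`: a Banach space `X`, a continuous embedding `i` of `X`
into `H`, and a representation `inner (ι x) (ι y)` of the form plus the inner product of `H`. -/
structure IsClosedForm {X Y H : Type*} [NormedAddCommGroup X] [NormedSpace ℝ X]
    [NormedAddCommGroup Y] [InnerProductSpace ℝ Y] [NormedAddCommGroup H] [InnerProductSpace ℝ H]
    (i : X →L[ℝ] H) (ι : X →L[ℝ] Y) : Prop where
  injective : Function.Injective i
  norm_le : ∀ x, ‖i x‖ ≤ ‖ι x‖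
  coercive : ∃ C : ℝ, ∀ x, ‖x‖ ≤ C * ‖ι x‖

section ClosedForm

variable {X Y H : Type*} [NormedAddCommGroup X] [NormedSpace ℝ X] [CompleteSpace X]
    [NormedAddCommGroup Y] [InnerProductSpace ℝ Y] [CompleteSpace Y]
    [NormedAddCommGroup H] [InnerProductSpace ℝ H] [CompleteSpace H]
    {i : X →L[ℝ] H} {ι : X →L[ℝ] Y}

/-- Coercivity makes `ι` an isomorphism of `X` onto a closed subspace of `Y`. With the inner product
inherited from `Y` this subspace is the form domain `V`, and the results on `j : V → H` are carried
back to `X`. All properties share one existential so that they refer to the same `S`. -/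
theorem IsClosedForm.exists_resolvent (hf : IsClosedForm i ι) :
    ∃ S : H →L[ℝ] X, (∀ h x, inner ℝ (ι (S h)) (ι x) = inner ℝ h (i x)) ∧
      IsUnitSymmetric (i ∘L S) ∧
      (∀ t : ℝ, 0 < t → ∀ h, ∃ h', heatOp (i ∘L S) t h = i (S h')) ∧
      ∀ x₀ : X, ∃ x : ℝ → X, Continuous x ∧ x 0 = x₀ ∧ (∃ M, ∀ t, ‖x t‖ ≤ M) ∧
        (∀ t, i (x t) = heatOp (i ∘L S) t (i x₀)) ∧
        (∀ t, 0 ≤ t → ∀ y, inner ℝ (i x₀ - i (x t)) (i y) =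
          ∫ s in (0 : ℝ)..t, (inner ℝ (ι (x s)) (ι y) - inner ℝ (i (x s)) (i y))) ∧
        (∀ t, 0 < t → ∃ h, x t = S h) ∧
        ∀ α, 0 < α → ∃ h, ∫ t in Ioi (0 : ℝ), Real.exp (-α * t) • i (x t) = i (S h) := by
  obtain ⟨C, hC⟩ := hf.coercive
  have hι : Function.Injective ι := by
    rw [injective_iff_map_eq_zero]
    intro x hx
    have := hC x
    rw [hx, norm_zero, mul_zero] at this
    exact norm_le_zero_iff.1 this
  have hanti : AntilipschitzWith C.toNNReal ι := by
    refine ContinuousLinearMap.antilipschitz_of_bound ι fun x => ?_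
    exact (hC x).trans (by gcongr; exact Real.le_coe_toNNReal C)
  set V : Submodule ℝ Y := LinearMap.range ι.toLinearMap
  have hVc : IsClosed (V : Set Y) := hanti.isClosed_range ι.uniformContinuous
  have : CompleteSpace V := hVc.completeSpace_coe
  set e₀ : X →L[ℝ] V := ι.codRestrict V fun x => ⟨x, rfl⟩
  have he₀ : Function.Bijective e₀ := by
    refine ⟨fun x y h => hι (congrArg Subtype.val h), ?_⟩
    rintro ⟨_, x, rfl⟩
    exact ⟨x, rfl⟩
  set e : X ≃L[ℝ] V := ContinuousLinearEquiv.ofBijective e₀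
    (LinearMap.ker_eq_bot.2 he₀.1) (LinearMap.range_eq_top.2 he₀.2)
  have he : ∀ x, (e x : Y) = ι x := fun x => rfl
  have hes : ∀ v, ι (e.symm v) = v := fun v => by rw [← he, e.apply_symm_apply]
  set j : V →L[ℝ] H := i ∘L (e.symm : V →L[ℝ] X)
  have hje : ∀ x, j (e x) = i x := fun x => by simp [j]
  have hj : ∀ v, ‖j v‖ ≤ ‖v‖ := fun v => by
    have := hf.norm_le (e.symm v)
    rwa [hes] at this
  have hinj : Function.Injective j := hf.injective.comp e.symm.injective
  set S : H →L[ℝ] X := (e.symm : V →L[ℝ] X) ∘L j.adjoint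
  have hiS : i ∘L S = j ∘L j.adjoint := rfl
  have hK := isUnitSymmetric_adjoint_comp hj
  have hKi := injective_adjoint_comp hinj
  have hR := isUnitSymmetric_comp_adjoint hj
  refine ⟨S, ?_, hR, ?_, ?_⟩
  · intro h x
    have h1 : inner ℝ (j.adjoint h) (e x) = inner ℝ h (i x) := by
      rw [ContinuousLinearMap.adjoint_inner_left, hje]
    rw [← h1, ← he, Submodule.coe_inner]
    simp [S, he]
  · intro t ht h
    obtain ⟨w, hw⟩ := hR.heatOp_mem_range ht h
    exact ⟨w, hw⟩
  intro x₀
  refine ⟨fun t => e.symm (heatOp (j.adjoint ∘L j) t (e x₀)), ?_, ?_, ?_, ?_, ?_, ?_, ?_⟩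
  · exact e.symm.continuous.comp (hK.continuous_heatOp hKi _)
  · simp [hK.heatOp_of_nonpos le_rfl]
  · refine ⟨‖(e.symm : V →L[ℝ] X)‖ * ‖e x₀‖, fun t => ?_⟩
    refine ((e.symm : V →L[ℝ] X).le_opNorm _).trans ?_
    gcongr
    exact hK.norm_heatOp_apply_le _ _
  · intro t
    rw [hiS, ← hje x₀, ← heatOp_adjoint_comp hj]
    rfl
  · intro t ht y
    have := heatOp_weak_equation hj hinj (e x₀) (e y) ht
    simp only [hje] at this
    refine this.trans (intervalIntegral.integral_congr fun s _ => ?_)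
    simp only [hes]
    rfl
  · intro t ht
    obtain ⟨w, hw⟩ := hK.heatOp_mem_range ht (e x₀)
    exact ⟨j w, congrArg e.symm hw⟩
  · intro α hα
    obtain ⟨h, hh⟩ := laplace_heatOp_mem_range hj hinj (e x₀) hα
    refine ⟨h, ?_⟩
    have := j.integral_comp_comm (integrableOn_exp_smul_heatOp hj hinj (e x₀) hα)
    rw [hh] at this
    refine Eq.trans ?_ this
    refine integral_congr_ae (Eventually.of_forall fun t => ?_)
    simp only [map_smul]
    rfl

/-- The resolvent at `1` of the operator associated with a closed form, as a map into the form
domain. -/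
def IsClosedForm.resolvent (hf : IsClosedForm i ι) : H →L[ℝ] X := hf.exists_resolvent.choose

/-- The semigroup associated with a closed form. -/
def IsClosedForm.semigroup (hf : IsClosedForm i ι) (t : ℝ) : H →L[ℝ] H :=
  heatOp (i ∘L hf.resolvent) t

theorem IsClosedForm.inner_resolvent (hf : IsClosedForm i ι) (h : H) (x : X) :
    inner ℝ (ι (hf.resolvent h)) (ι x) = inner ℝ h (i x) :=
  hf.exists_resolvent.choose_spec.1 h x

theorem IsClosedForm.isUnitSymmetric (hf : IsClosedForm i ι) :
    IsUnitSymmetric (i ∘L hf.resolvent) :=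
  hf.exists_resolvent.choose_spec.2.1

theorem IsClosedForm.semigroup_mem_range (hf : IsClosedForm i ι) {t : ℝ} (ht : 0 < t) (h : H) :
    ∃ h', hf.semigroup t h = i (hf.resolvent h') :=
  hf.exists_resolvent.choose_spec.2.2.1 t ht h

theorem IsClosedForm.exists_evolution (hf : IsClosedForm i ι) (x₀ : X) :
    ∃ x : ℝ → X, Continuous x ∧ x 0 = x₀ ∧ (∃ M, ∀ t, ‖x t‖ ≤ M) ∧
      (∀ t, i (x t) = hf.semigroup t (i x₀)) ∧
      (∀ t, 0 ≤ t → ∀ y, inner ℝ (i x₀ - i (x t)) (i y) =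
        ∫ s in (0 : ℝ)..t, (inner ℝ (ι (x s)) (ι y) - inner ℝ (i (x s)) (i y))) ∧
      (∀ t, 0 < t → ∃ h, x t = hf.resolvent h) ∧
      ∀ α, 0 < α →
        ∃ h, ∫ t in Ioi (0 : ℝ), Real.exp (-α * t) • i (x t) = i (hf.resolvent h) :=
  hf.exists_resolvent.choose_spec.2.2.2 x₀

end ClosedForm

/-- Strong resolvent convergence implies strong convergence of the semigroups. -/
theorem IsClosedForm.tendsto_semigroup {X X' Y Y' H : Type*}
    [NormedAddCommGroup X] [NormedSpace ℝ X] [CompleteSpace X]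
    [NormedAddCommGroup Y] [InnerProductSpace ℝ Y] [CompleteSpace Y]
    [NormedAddCommGroup X'] [NormedSpace ℝ X'] [CompleteSpace X']
    [NormedAddCommGroup Y'] [InnerProductSpace ℝ Y'] [CompleteSpace Y']
    [NormedAddCommGroup H] [InnerProductSpace ℝ H] [CompleteSpace H]
    {i : X →L[ℝ] H} {ι : ℕ → X →L[ℝ] Y} (hf : ∀ n, IsClosedForm i (ι n))
    {i' : X' →L[ℝ] H} {ι' : X' →L[ℝ] Y'} (hf' : IsClosedForm i' ι')
    (h : ∀ u, Tendsto (fun n => i ((hf n).resolvent u)) atTop (𝓝 (i' (hf'.resolvent u))))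
    (t : ℝ) (u : H) :
    Tendsto (fun n => (hf n).semigroup t u) atTop (𝓝 (hf'.semigroup t u)) :=
  IsUnitSymmetric.tendsto_funCalc (fun n => (hf n).isUnitSymmetric) hf'.isUnitSymmetric h _ _

/-! ### The space `L²(ℝ)` -/

theorem l2_inner (f g : L2R) : inner ℝ f g = ∫ x, f x * g x := by
  rw [L2.inner_def]
  refine integral_congr_ae (Eventually.of_forall fun x => ?_)
  simp [mul_comm]

theorem l2_norm_sq (f : L2R) : ‖f‖ ^ 2 = ∫ x, f x ^ 2 := by
  rw [← real_inner_self_eq_norm_sq, l2_inner]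
  simp only [sq]

theorem l2_locallyIntegrable (f : L2R) : LocallyIntegrable f volume :=
  (Lp.memLp f).locallyIntegrable (by norm_num)

theorem l2_integrable_mul (f g : L2R) : Integrable (fun x => f x * g x) :=
  (Lp.memLp f).integrable_mul (Lp.memLp g)

theorem integral_abs_mul_le {μ : Measure ℝ} {u v : ℝ → ℝ} (hu : MemLp u 2 μ) (hv : MemLp v 2 μ) :
    ∫ x, |u x * v x| ∂μ ≤ √(∫ x, u x ^ 2 ∂μ) * √(∫ x, v x ^ 2 ∂μ) := by
  have hn : ∀ {w : ℝ → ℝ} (hw : MemLp w 2 μ), ‖hw.norm.toLp _‖ = √(∫ x, w x ^ 2 ∂μ) := by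
    intro w hw
    rw [← Real.sqrt_sq (norm_nonneg _), ← real_inner_self_eq_norm_sq, L2.inner_def]
    congr 1
    refine integral_congr_ae ?_
    filter_upwards [hw.norm.coeFn_toLp] with x hx
    rw [hx, real_inner_self_eq_norm_sq, norm_norm, Real.norm_eq_abs, sq_abs]
  rw [← hn hu, ← hn hv]
  refine le_trans (le_of_eq ?_) (real_inner_le_norm _ _)
  rw [L2.inner_def]
  refine integral_congr_ae ?_
  filter_upwards [hu.norm.coeFn_toLp, hv.norm.coeFn_toLp] with x hx hy
  rw [hx, hy, real_inner_comm, Real.norm_eq_abs, Real.norm_eq_abs, abs_mul]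
  rfl

theorem setIntegral_abs_le_l2 (f : L2R) {s : Set ℝ} (hfin : volume s ≠ ⊤) :
    ∫ x in s, |f x| ≤ √(volume.real s) * ‖f‖ := by
  have : IsFiniteMeasure (volume.restrict s) := ⟨by simpa using hfin.lt_top⟩
  have h := integral_abs_mul_le (memLp_const (1 : ℝ) (μ := volume.restrict s) (p := 2))
    ((Lp.memLp f).restrict s)
  simp only [one_mul, one_pow, integral_const, smul_eq_mul, mul_one] at h
  refine h.trans ?_
  rw [measureReal_restrict_apply_univ]
  gcongr
  rw [Real.sqrt_le_left (norm_nonneg _), l2_norm_sq]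
  exact setIntegral_le_integral (Lp.memLp f).integrable_sq (Eventually.of_forall fun x => sq_nonneg _)

/-! ### Multiplication operators on `L²(ℝ)` -/

/-- A bounded measurable multiplier. -/
structure IsBddMultiplier (m : ℝ → ℝ) : Prop where
  meas : AEStronglyMeasurable m volume
  bdd : ∃ C : ℝ, ∀ᵐ x ∂(volume : Measure ℝ), |m x| ≤ C

theorem IsBddMultiplier.memLp {m : ℝ → ℝ} (hm : IsBddMultiplier m) {f : ℝ → ℝ}
    (hf : MemLp f 2 volume) : MemLp (fun x => m x * f x) 2 volume := by
  obtain ⟨C, hC⟩ := hm.bdd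
  refine hf.of_le_mul (c := C) (hm.meas.mul hf.aestronglyMeasurable) ?_
  filter_upwards [hC] with x hx
  rw [norm_mul]
  gcongr
  exact hx

/-- Multiplication by a bounded function, on `L²(ℝ)`. -/
def mulL2 {m : ℝ → ℝ} (hm : IsBddMultiplier m) : L2R →L[ℝ] L2R :=
  LinearMap.mkContinuous
    { toFun := fun f => (hm.memLp (Lp.memLp f)).toLp
      map_add' := fun f g => by
        refine Lp.ext ?_
        filter_upwards [(hm.memLp (Lp.memLp (f + g))).coeFn_toLp, (hm.memLp (Lp.memLp f)).coeFn_toLp,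
          (hm.memLp (Lp.memLp g)).coeFn_toLp, Lp.coeFn_add f g,
          Lp.coeFn_add (hm.memLp (Lp.memLp f)).toLp (hm.memLp (Lp.memLp g)).toLp]
          with x h1 h2 h3 h4 h5
        rw [h1, h5, Pi.add_apply, h2, h3, h4, Pi.add_apply, mul_add]
      map_smul' := fun c f => by
        refine Lp.ext ?_
        filter_upwards [(hm.memLp (Lp.memLp (c • f))).coeFn_toLp, (hm.memLp (Lp.memLp f)).coeFn_toLp,
          Lp.coeFn_smul c f, Lp.coeFn_smul c (hm.memLp (Lp.memLp f)).toLp] with x h1 h2 h3 h4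
        simp only [RingHom.id_apply]
        rw [h1, h4, Pi.smul_apply, h2, h3, Pi.smul_apply, smul_eq_mul, smul_eq_mul]
        ring }
    hm.bdd.choose fun f => by
      refine Lp.norm_le_mul_norm_of_ae_le_mul ?_
      simp only [LinearMap.coe_mk, AddHom.coe_mk]
      filter_upwards [(hm.memLp (Lp.memLp f)).coeFn_toLp, hm.bdd.choose_spec] with x h1 h2
      rw [h1, norm_mul]
      gcongr
      exact h2

theorem coeFn_mulL2 {m : ℝ → ℝ} (hm : IsBddMultiplier m) (f : L2R) :
    mulL2 hm f =ᵐ[volume] fun x => m x * f x :=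
  (hm.memLp (Lp.memLp f)).coeFn_toLp

theorem inner_mulL2 {m : ℝ → ℝ} (hm : IsBddMultiplier m) (f g : L2R) :
    inner ℝ (mulL2 hm f) g = ∫ x, m x * f x * g x := by
  rw [l2_inner]
  refine integral_congr_ae ?_
  filter_upwards [coeFn_mulL2 hm f] with x hx
  rw [hx]

theorem inner_mulL2_comm {m : ℝ → ℝ} (hm : IsBddMultiplier m) (f g : L2R) :
    inner ℝ (mulL2 hm f) g = inner ℝ f (mulL2 hm g) := by
  rw [inner_mulL2, real_inner_comm, inner_mulL2]
  congr 1
  ext x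
  ring

theorem norm_mulL2_le {m : ℝ → ℝ} (hm : IsBddMultiplier m) {C : ℝ}
    (hC : ∀ᵐ x ∂(volume : Measure ℝ), |m x| ≤ C) (f : L2R) : ‖mulL2 hm f‖ ≤ C * ‖f‖ := by
  refine Lp.norm_le_mul_norm_of_ae_le_mul ?_
  filter_upwards [coeFn_mulL2 hm f, hC] with x h1 h2
  rw [h1, norm_mul]
  gcongr
  exact h2

/-! ### Test functions -/

/-- A continuous compactly supported function, as an element of `L²(ℝ)`. -/
def ccL2 {g : ℝ → ℝ} (hg : Continuous g) (hc : HasCompactSupport g) : L2R :=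
  (hg.memLp_of_hasCompactSupport (p := 2) (μ := volume) hc).toLp

theorem coeFn_ccL2 {g : ℝ → ℝ} (hg : Continuous g) (hc : HasCompactSupport g) :
    ccL2 hg hc =ᵐ[volume] g :=
  MemLp.coeFn_toLp _

theorem inner_ccL2 (f : L2R) {g : ℝ → ℝ} (hg : Continuous g) (hc : HasCompactSupport g) :
    inner ℝ f (ccL2 hg hc) = ∫ x, f x * g x := by
  rw [l2_inner]
  refine integral_congr_ae ?_
  filter_upwards [coeFn_ccL2 hg hc] with x hx
  rw [hx]

theorem IsTestFunction.mono {Ω Ω' : Set ℝ} {g : ℝ → ℝ} (hg : IsTestFunction Ω g) (h : Ω ⊆ Ω') :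
    IsTestFunction Ω' g := ⟨hg.1, hg.2.1, hg.2.2.trans h⟩

section TestFunction

variable {Ω : Set ℝ} {g : ℝ → ℝ}

theorem IsTestFunction.continuous (hg : IsTestFunction Ω g) : Continuous g := hg.1.continuous

theorem IsTestFunction.continuous_deriv (hg : IsTestFunction Ω g) : Continuous (deriv g) :=
  hg.1.continuous_deriv (by simp)

theorem IsTestFunction.hasCompactSupport_deriv (hg : IsTestFunction Ω g) :
    HasCompactSupport (deriv g) := hg.2.1.deriv

theorem IsTestFunction.hasDerivAt (hg : IsTestFunction Ω g) (x : ℝ) :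
    HasDerivAt g (deriv g x) x :=
  (hg.1.differentiable (by simp) x).hasDerivAt

/-- A test function as an element of `L²(ℝ)`. -/
def IsTestFunction.toL2 (hg : IsTestFunction Ω g) : L2R := ccL2 hg.continuous hg.2.1

/-- The derivative of a test function as an element of `L²(ℝ)`. -/
def IsTestFunction.derivL2 (hg : IsTestFunction Ω g) : L2R :=
  ccL2 hg.continuous_deriv hg.hasCompactSupport_deriv

theorem IsTestFunction.inner_toL2 (hg : IsTestFunction Ω g) (f : L2R) :
    inner ℝ f hg.toL2 = ∫ x, f x * g x := inner_ccL2 f _ _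

theorem IsTestFunction.inner_derivL2 (hg : IsTestFunction Ω g) (f : L2R) :
    inner ℝ f hg.derivL2 = ∫ x, f x * deriv g x := inner_ccL2 f _ _

/-- A fixed test function equal to `1` at the origin. -/
def bump : ℝ → ℝ := (⟨1, 2, one_pos, one_lt_two⟩ : ContDiffBump (0 : ℝ))

theorem isTestFunction_bump : IsTestFunction univ bump :=
  ⟨ContDiffBump.contDiff _, ContDiffBump.hasCompactSupport _, subset_univ _⟩

theorem bump_zero : bump 0 = 1 :=
  ContDiffBump.one_of_mem_closedBall _ (by simp)

theorem IsTestFunction.apply_zero (hg : IsTestFunction Ω g) (h0 : (0 : ℝ) ∉ Ω) : g 0 = 0 :=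
  image_eq_zero_of_notMem_tsupport fun h => h0 (hg.2.2 h)

theorem HasCompactSupport.eventually_atTop (hg : HasCompactSupport g) : ∀ᶠ x in atTop, g x = 0 := by
  have := hasCompactSupport_iff_eventuallyEq.1 hg
  rw [coclosedCompact_eq_cocompact] at this
  exact this.filter_mono atTop_le_cocompact

theorem HasCompactSupport.eventually_atBot (hg : HasCompactSupport g) : ∀ᶠ x in atBot, g x = 0 := by
  have := hasCompactSupport_iff_eventuallyEq.1 hg
  rw [coclosedCompact_eq_cocompact] at this
  exact this.filter_mono atBot_le_cocompact

end TestFunction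

/-! ### Primitives and integration by parts -/

/-- The primitive of `F` with value `c` at `0`. -/
def prim (c : ℝ) (F : ℝ → ℝ) (x : ℝ) : ℝ := c + ∫ t in (0 : ℝ)..x, F t

section Prim

variable {F G : ℝ → ℝ}

theorem prim_zero (c : ℝ) (F : ℝ → ℝ) : prim c F 0 = c := by simp [prim]

theorem LocallyIntegrable.intervalIntegrable' (hF : LocallyIntegrable F volume) (a b : ℝ) :
    IntervalIntegrable F volume a b :=
  (hF.integrableOn_isCompact isCompact_uIcc).intervalIntegrable

theorem prim_sub_prim (hF : LocallyIntegrable F volume) (c x y : ℝ) :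
    prim c F y - prim c F x = ∫ t in x..y, F t := by
  have h1 := LocallyIntegrable.intervalIntegrable' hF
  simp only [prim]
  rw [← intervalIntegral.integral_add_adjacent_intervals (h1 0 x) (h1 x y)]
  ring

theorem continuous_prim (hF : LocallyIntegrable F volume) (c : ℝ) : Continuous (prim c F) :=
  continuous_const.add (intervalIntegral.continuous_primitive
    (LocallyIntegrable.intervalIntegrable' hF) 0)

theorem prim_congr {c : ℝ} (h : F =ᵐ[volume] G) : prim c F = prim c G := by
  ext x
  simp only [prim]
  rw [intervalIntegral.integral_congr_ae (h.mono fun x hx _ => hx)]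

theorem absolutelyContinuousOnInterval_prim (hF : LocallyIntegrable F volume) (c a b : ℝ) :
    AbsolutelyContinuousOnInterval (prim c F) a b := by
  -- The interval is enlarged to contain `0`, the base point of the integral.
  have h1 : AbsolutelyContinuousOnInterval (fun x => ∫ t in (0 : ℝ)..x, F t)
      (min 0 (min a b)) (max 0 (max a b)) := by
    refine (LocallyIntegrable.intervalIntegrable' hF _ _).absolutelyContinuousOnInterval_intervalIntegral ?_
    exact Icc_subset_uIcc ⟨min_le_left _ _, le_max_left _ _⟩
  have h2 : AbsolutelyContinuousOnInterval (fun _ : ℝ => c) (min 0 (min a b)) (max 0 (max a b)) :=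
    (contDiff_const (n := 1)).contDiffOn.absolutelyContinuousOnInterval
  refine (h2.add h1).mono ?_
  rw [uIcc, uIcc_of_le ((min_le_left _ _).trans (le_max_left _ _))]
  exact Icc_subset_Icc (min_le_right _ _) (le_max_right _ _)

theorem deriv_prim_ae (hF : LocallyIntegrable F volume) (c : ℝ) :
    ∀ᵐ x, deriv (prim c F) x = F x := by
  filter_upwards [LocallyIntegrable.ae_hasDerivAt_integral hF] with x hx
  exact ((hx 0).const_add c).deriv

theorem integral_prim_mul_prim (hF : LocallyIntegrable F volume) (hG : LocallyIntegrable G volume)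
    (c d a b : ℝ) :
    ∫ x in a..b, (F x * prim d G x + prim c F x * G x) =
      prim c F b * prim d G b - prim c F a * prim d G a := by
  rw [← (absolutelyContinuousOnInterval_prim hF c a b).integral_deriv_mul_eq_sub
    (absolutelyContinuousOnInterval_prim hG d a b)]
  refine intervalIntegral.integral_congr_ae ?_
  filter_upwards [deriv_prim_ae hF c, deriv_prim_ae hG d] with x h1 h2 _
  rw [h1, h2]

variable {Ω : Set ℝ} {g : ℝ → ℝ}

theorem IsTestFunction.eq_prim (hg : IsTestFunction Ω g) : g = prim (g 0) (deriv g) := by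
  ext x
  rw [prim, intervalIntegral.integral_eq_sub_of_hasDerivAt (fun y _ => hg.hasDerivAt y)
    (hg.continuous_deriv.intervalIntegrable _ _)]
  ring

theorem integrable_mul_test (hF : LocallyIntegrable F volume) (hg : Continuous g)
    (hc : HasCompactSupport g) : Integrable (fun x => F x * g x) := by
  simpa using hF.integrable_smul_right_of_hasCompactSupport hg hc

theorem integrable_ibp (hF : LocallyIntegrable F volume) (c : ℝ) (hg : IsTestFunction Ω g) :
    Integrable (fun x => F x * g x + prim c F x * deriv g x) :=
  (integrable_mul_test hF hg.continuous hg.2.1).add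
    (integrable_mul_test (continuous_prim hF c).locallyIntegrable hg.continuous_deriv
      hg.hasCompactSupport_deriv)

theorem integral_ibp (hF : LocallyIntegrable F volume) (c a b : ℝ) (hg : IsTestFunction Ω g) :
    ∫ x in a..b, (F x * g x + prim c F x * deriv g x) = prim c F b * g b - prim c F a * g a := by
  have h := integral_prim_mul_prim hF hg.continuous_deriv.locallyIntegrable c (g 0) a b
  rwa [← hg.eq_prim] at h

theorem integral_Ioi_ibp (hF : LocallyIntegrable F volume) (c : ℝ) (hg : IsTestFunction Ω g) :
    ∫ x in Ioi (0 : ℝ), (F x * g x + prim c F x * deriv g x) = - (c * g 0) := by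
  refine tendsto_nhds_unique (intervalIntegral_tendsto_integral_Ioi 0
    (integrable_ibp hF c hg).integrableOn tendsto_id) (tendsto_const_nhds.congr' ?_)
  filter_upwards [HasCompactSupport.eventually_atTop hg.2.1] with N hN
  rw [integral_ibp hF c _ _ hg, prim_zero, id, hN]
  ring

theorem integral_Iio_ibp (hF : LocallyIntegrable F volume) (c : ℝ) (hg : IsTestFunction Ω g) :
    ∫ x in Iio (0 : ℝ), (F x * g x + prim c F x * deriv g x) = c * g 0 := by
  rw [← integral_Iic_eq_integral_Iio]
  refine tendsto_nhds_unique (intervalIntegral_tendsto_integral_Iic 0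
    (integrable_ibp hF c hg).integrableOn tendsto_id) (tendsto_const_nhds.congr' ?_)
  filter_upwards [HasCompactSupport.eventually_atBot hg.2.1] with N hN
  rw [integral_ibp hF c _ _ hg, prim_zero, id, hN]
  ring

theorem integral_eq_Ioi_add_Iio {f : ℝ → ℝ} (hf : Integrable f) :
    ∫ x, f x = (∫ x in Ioi (0 : ℝ), f x) + ∫ x in Iio (0 : ℝ), f x := by
  rw [← integral_Iic_eq_integral_Iio, add_comm, ← setIntegral_univ,
    ← Iic_union_Ioi (a := (0 : ℝ)), setIntegral_union (Iic_disjoint_Ioi le_rfl) measurableSet_Ioi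
      hf.integrableOn hf.integrableOn]

theorem integral_prim_mul_deriv (hF : LocallyIntegrable F volume) (c : ℝ)
    (hg : IsTestFunction Ω g) : ∫ x, prim c F x * deriv g x = - ∫ x, F x * g x := by
  have h := integral_eq_Ioi_add_Iio (integrable_ibp hF c hg)
  rw [integral_Ioi_ibp hF c hg, integral_Iio_ibp hF c hg, integral_add
    (integrable_mul_test hF hg.continuous hg.2.1)
    (integrable_mul_test (continuous_prim hF c).locallyIntegrable hg.continuous_deriv
      hg.hasCompactSupport_deriv)] at h
  linarith

end Prim

/-- The lemma of du Bois-Reymond. -/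
theorem ae_eq_const_of_integral_mul_deriv_eq_zero {Ω : Set ℝ} (hΩ : IsOpen Ω)
    (hconn : Ω.OrdConnected) (hne : Ω.Nonempty) {h : ℝ → ℝ} (hh : LocallyIntegrable h volume)
    (hz : ∀ g, IsTestFunction Ω g → ∫ x, h x * deriv g x = 0) :
    ∃ c, ∀ᵐ x, x ∈ Ω → h x = c := by
  obtain ⟨p, hp⟩ := hne
  obtain ⟨r, hr, hrΩ⟩ := Metric.isOpen_iff.1 hΩ p hp
  set φ : ContDiffBump p := ⟨r / 4, r / 2, by positivity, by linarith⟩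
  set η := φ.normed volume
  have hη : IsTestFunction Ω η := by
    refine ⟨φ.contDiff_normed, φ.hasCompactSupport_normed, ?_⟩
    rw [φ.tsupport_normed_eq]
    exact (Metric.closedBall_subset_ball (by simp only [φ]; linarith)).trans hrΩ
  have hη1 : ∫ x, η x = 1 := φ.integral_normed
  set c := ∫ x, h x * η x
  refine ⟨c, ?_⟩
  have key : ∀ ψ : ℝ → ℝ, ContDiff ℝ ∞ ψ → HasCompactSupport ψ → tsupport ψ ⊆ Ω →
      ∫ x, ψ x • (h x - c) = 0 := by
    intro ψ hψ1 hψ2 hψ3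
    set m := ∫ x, ψ x
    -- Subtracting `m η`, with `∫ η = 1`, makes the mean zero. The primitive `g` of `f` then
    -- vanishes outside the hull of the supports and is an admissible test function.
    set f : ℝ → ℝ := fun x => ψ x - m * η x
    have hf : ContDiff ℝ ∞ f := hψ1.sub (contDiff_const.mul hη.1)
    have hψi : Integrable ψ := hψ1.continuous.integrable_of_hasCompactSupport hψ2
    have hηi : Integrable η := hη.continuous.integrable_of_hasCompactSupport hη.2.1
    have hf0 : ∫ x, f x = 0 := by
      rw [integral_sub hψi (hηi.const_mul _), integral_const_mul, hη1]
      simp [m]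
    set T := tsupport ψ ∪ tsupport η
    have hT : IsCompact T := hψ2.isCompact.union hη.2.1.isCompact
    have hTΩ : T ⊆ Ω := union_subset hψ3 hη.2.2
    have hTne : T.Nonempty := by
      refine ⟨p, Or.inr ?_⟩
      rw [φ.tsupport_normed_eq]
      exact Metric.mem_closedBall_self (by simp only [φ]; positivity)
    have hfT : ∀ x, x ∉ T → f x = 0 := by
      intro x hx
      have h1 : ψ x = 0 := image_eq_zero_of_notMem_tsupport fun h => hx (Or.inl h)
      have h2 : η x = 0 := image_eq_zero_of_notMem_tsupport fun h => hx (Or.inr h)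
      simp [f, h1, h2]
    obtain ⟨A, hA, hA'⟩ := hT.exists_isLeast hTne
    obtain ⟨B, hB, hB'⟩ := hT.exists_isGreatest hTne
    set g : ℝ → ℝ := fun x => ∫ t in (A - 1)..x, f t
    have hgd : ∀ x, HasDerivAt g (f x) x := fun x =>
      (hf.continuous.integral_hasStrictDerivAt _ x).hasDerivAt
    have hgd' : deriv g = f := funext fun x => (hgd x).deriv
    have hgc : ContDiff ℝ ∞ g :=
      contDiff_infty_iff_deriv.2 ⟨fun x => (hgd x).differentiableAt, by rwa [hgd']⟩
    have hg0 : ∀ x, x ∉ Icc A B → g x = 0 := by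
      intro x hx
      rcases lt_or_ge x A with hxA | hxA
      · refine intervalIntegral.integral_zero_ae (Eventually.of_forall fun t ht => hfT t fun htT => ?_)
        have := hA' htT
        have h2 := ht.2
        rcases le_max_iff.1 h2 with h3 | h3 <;> linarith
      · have hxB : B < x := not_le.1 fun h => hx ⟨hxA, h⟩
        simp only [g]
        rw [intervalIntegral.integral_eq_integral_of_support_subset, hf0]
        intro t ht
        have htT : t ∈ T := by_contra fun h => ht (hfT t h)
        exact ⟨by linarith [hA' htT], by linarith [hB' htT]⟩
    have hgs : tsupport g ⊆ Icc A B :=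
      closure_minimal (fun x hx => by_contra fun h => hx (hg0 x h)) isClosed_Icc
    have hg : IsTestFunction Ω g :=
      ⟨hgc, HasCompactSupport.of_support_subset_isCompact isCompact_Icc (subset_closure.trans hgs),
        hgs.trans (hconn.out (hTΩ hA) (hTΩ hB))⟩
    have hmain := hz g hg
    rw [hgd'] at hmain
    have hi1 := integrable_mul_test hh hψ1.continuous hψ2
    have hi2 := integrable_mul_test hh hη.continuous hη.2.1
    have e1 : ∫ x, h x * f x = (∫ x, h x * ψ x) - m * c := by
      have : (fun x => h x * f x) = fun x => h x * ψ x - m * (h x * η x) := by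
        ext x; simp only [f]; ring
      rw [this, integral_sub hi1 (hi2.const_mul _), integral_const_mul]
    have e2 : ∫ x, ψ x • (h x - c) = (∫ x, h x * ψ x) - m * c := by
      have : (fun x => ψ x • (h x - c)) = fun x => h x * ψ x - ψ x * c := by
        ext x; simp only [smul_eq_mul]; ring
      rw [this, integral_sub hi1 (hψi.mul_const _), integral_mul_const]
    rw [e2, ← e1, hmain]
  have := hΩ.ae_eq_zero_of_integral_contDiff_smul_eq_zero (μ := volume)
    ((hh.sub (continuous_const (y := c)).locallyIntegrable).locallyIntegrableOn Ω) key
  filter_upwards [this] with x hx hxΩ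
  exact sub_eq_zero.1 (hx hxΩ)

/-- On an interval, a function with weak derivative `F` is a primitive of `F`. -/
theorem exists_ae_eq_prim {Ω : Set ℝ} (hΩ : IsOpen Ω) (hconn : Ω.OrdConnected) (hne : Ω.Nonempty)
    {f F : ℝ → ℝ} (hf : LocallyIntegrable f volume) (hF : LocallyIntegrable F volume)
    (h : HasWeakDerivOn Ω f F) : ∃ c, ∀ᵐ x, x ∈ Ω → f x = prim c F x := by
  obtain ⟨c, hc⟩ := ae_eq_const_of_integral_mul_deriv_eq_zero hΩ hconn hne
    (hf.sub (continuous_prim hF 0).locallyIntegrable) (fun g hg => by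
      have h1 := h g hg
      have h2 := integral_prim_mul_deriv hF 0 hg
      have e : (fun x => (f - prim 0 F) x * deriv g x) =
        fun x => f x * deriv g x - prim 0 F x * deriv g x := by
        ext x; simp only [Pi.sub_apply]; ring
      rw [e, integral_sub (integrable_mul_test hf hg.continuous_deriv hg.hasCompactSupport_deriv)
        (integrable_mul_test (continuous_prim hF 0).locallyIntegrable hg.continuous_deriv
          hg.hasCompactSupport_deriv), h1, h2, sub_self])
  refine ⟨c, ?_⟩
  filter_upwards [hc] with x hx hxΩ
  have := hx hxΩ
  simp only [Pi.sub_apply, prim] at this ⊢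
  linarith

/-! ### The Sobolev spaces on the line and on the split line -/

/-- The functional `(f, F) ↦ ∫ f g' + ∫ F g`. -/
def pairing {g : ℝ → ℝ} (hg : IsTestFunction univ g) : L2R × L2R →L[ℝ] ℝ :=
  innerSL ℝ hg.derivL2 ∘L ContinuousLinearMap.fst ℝ L2R L2R +
    innerSL ℝ hg.toL2 ∘L ContinuousLinearMap.snd ℝ L2R L2R

theorem pairing_apply {g : ℝ → ℝ} (hg : IsTestFunction univ g) (x : L2R × L2R) :
    pairing hg x = (∫ y, x.1 y * deriv g y) + ∫ y, x.2 y * g y := by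
  rw [← hg.inner_derivL2, ← hg.inner_toL2, real_inner_comm, real_inner_comm hg.toL2]
  rfl

/-- The jump `f(0+) - f(0-)` of an element `(f, f')` of the Sobolev space of the split line. -/
def jump : L2R × L2R →L[ℝ] ℝ := -pairing isTestFunction_bump

/-- The pairs `(f, f')` with `f` in the Sobolev space `H¹(ℝ)`. -/
def sobolev : Submodule ℝ (L2R × L2R) :=
  ⨅ g : {g // IsTestFunction univ g}, LinearMap.ker (pairing g.2).toLinearMap

/-- The pairs `(f, f')` with `f` in the Sobolev space `H¹(𝔾)` of the split line. -/
def splitSobolev : Submodule ℝ (L2R × L2R) :=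
  ⨅ g : {g // IsTestFunction univ g}, LinearMap.ker (pairing g.2 + g.1 0 • jump).toLinearMap

theorem mem_sobolev {x : L2R × L2R} : x ∈ sobolev ↔
    ∀ g, IsTestFunction univ g → (∫ y, x.1 y * deriv g y) + ∫ y, x.2 y * g y = 0 := by
  simp only [sobolev, Submodule.mem_iInf, Subtype.forall, LinearMap.mem_ker,
    ContinuousLinearMap.coe_coe, pairing_apply]

theorem mem_splitSobolev {x : L2R × L2R} : x ∈ splitSobolev ↔
    ∀ g, IsTestFunction univ g →
      (∫ y, x.1 y * deriv g y) + (∫ y, x.2 y * g y) + g 0 * jump x = 0 := by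
  simp only [splitSobolev, Submodule.mem_iInf, Subtype.forall, LinearMap.mem_ker,
    ContinuousLinearMap.coe_coe, add_apply, smul_apply, smul_eq_mul, pairing_apply]

theorem mem_sobolev_iff_hasWeakDerivOn {x : L2R × L2R} :
    x ∈ sobolev ↔ HasWeakDerivOn univ x.1 x.2 := by
  rw [mem_sobolev]
  exact forall₂_congr fun g hg => add_eq_zero_iff_eq_neg

theorem hasWeakDerivOn_of_mem_splitSobolev {x : L2R × L2R} (hx : x ∈ splitSobolev) :
    HasWeakDerivOn puncturedLine x.1 x.2 := by
  intro g hg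
  have h := mem_splitSobolev.1 hx g (hg.mono (subset_univ _))
  rw [hg.apply_zero (by simp [puncturedLine])] at h
  linarith

theorem jump_eq_zero_of_mem_sobolev {x : L2R × L2R} (hx : x ∈ sobolev) : jump x = 0 := by
  have h := mem_sobolev.1 hx _ isTestFunction_bump
  rw [← pairing_apply isTestFunction_bump] at h
  rw [jump, neg_apply, h, neg_zero]

theorem sobolev_le_splitSobolev : sobolev ≤ splitSobolev := by
  intro x hx
  rw [mem_splitSobolev]
  intro g hg
  rw [mem_sobolev.1 hx g hg, jump_eq_zero_of_mem_sobolev hx]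
  simp

theorem mem_sobolev_of_jump_eq_zero {x : L2R × L2R} (hx : x ∈ splitSobolev) (h : jump x = 0) :
    x ∈ sobolev := by
  rw [mem_sobolev]
  intro g hg
  have := mem_splitSobolev.1 hx g hg
  rwa [h, mul_zero, add_zero] at this

/-- An intersection of kernels of continuous functionals. The same argument serves for
`splitSobolev` because `jump` is a continuous functional on all of `L² × L²`, not a trace defined
only on a subspace. -/
theorem isClosed_sobolev : IsClosed (sobolev : Set (L2R × L2R)) := by
  rw [sobolev, Submodule.coe_iInf]
  exact isClosed_iInter fun g => (pairing g.2).isClosed_ker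

theorem isClosed_splitSobolev : IsClosed (splitSobolev : Set (L2R × L2R)) := by
  rw [splitSobolev, Submodule.coe_iInf]
  exact isClosed_iInter fun g => (pairing g.2 + g.1 0 • jump).isClosed_ker

instance : CompleteSpace sobolev := isClosed_sobolev.completeSpace_coe

instance : CompleteSpace splitSobolev := isClosed_splitSobolev.completeSpace_coe

/-! ### Boundary values at the origin -/

/-- `f` is a primitive of `F` on each half-line, with values `cp` at `0+` and `cm` at `0-`. -/
structure IsSplitPrim (f F : ℝ → ℝ) (cp cm : ℝ) : Prop where
  right : ∀ᵐ x, x ∈ Ioi (0 : ℝ) → f x = prim cp F x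
  left : ∀ᵐ x, x ∈ Iio (0 : ℝ) → f x = prim cm F x

theorem IsSplitPrim.integral_Ioi {f F : ℝ → ℝ} {cp cm : ℝ} (h : IsSplitPrim f F cp cm)
    (hF : LocallyIntegrable F volume) {g : ℝ → ℝ} (hg : IsTestFunction univ g) :
    ∫ x in Ioi (0 : ℝ), (F x * g x + f x * deriv g x) = - (cp * g 0) := by
  rw [← integral_Ioi_ibp hF cp hg]
  refine setIntegral_congr_ae measurableSet_Ioi ?_
  filter_upwards [h.right] with x hx hx0
  rw [hx hx0]

theorem IsSplitPrim.integral_Iio {f F : ℝ → ℝ} {cp cm : ℝ} (h : IsSplitPrim f F cp cm)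
    (hF : LocallyIntegrable F volume) {g : ℝ → ℝ} (hg : IsTestFunction univ g) :
    ∫ x in Iio (0 : ℝ), (F x * g x + f x * deriv g x) = cm * g 0 := by
  rw [← integral_Iio_ibp hF cm hg]
  refine setIntegral_congr_ae measurableSet_Iio ?_
  filter_upwards [h.left] with x hx hx0
  rw [hx hx0]

theorem IsSplitPrim.integral_add {f F : ℝ → ℝ} {cp cm : ℝ} (h : IsSplitPrim f F cp cm)
    (hf : LocallyIntegrable f volume) (hF : LocallyIntegrable F volume) {g : ℝ → ℝ}
    (hg : IsTestFunction univ g) :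
    (∫ x, f x * deriv g x) + ∫ x, F x * g x = -((cp - cm) * g 0) := by
  have i1 := integrable_mul_test hF hg.continuous hg.2.1
  have i2 := integrable_mul_test hf hg.continuous_deriv hg.hasCompactSupport_deriv
  have h1 := integral_eq_Ioi_add_Iio (i1.add i2)
  simp only [Pi.add_apply] at h1
  rw [add_comm, ← MeasureTheory.integral_add i1 i2, h1, h.integral_Ioi hF hg,
    h.integral_Iio hF hg]
  ring

/-- Integration by parts on both half-lines leaves `-(cp - cm) g(0)`, and `bump` has value `1` at
`0`. This justifies the definition of `jump` by a single test function. -/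
theorem IsSplitPrim.jump_eq {f F : L2R} {cp cm : ℝ} (h : IsSplitPrim f F cp cm) :
    jump (f, F) = cp - cm := by
  rw [jump, neg_apply, pairing_apply,
    h.integral_add (l2_locallyIntegrable f) (l2_locallyIntegrable F) isTestFunction_bump, bump_zero]
  ring

theorem IsSplitPrim.mem_splitSobolev {f F : L2R} {cp cm : ℝ} (h : IsSplitPrim f F cp cm) :
    (f, F) ∈ splitSobolev := by
  rw [_root_.mem_splitSobolev]
  intro g hg
  rw [h.integral_add (l2_locallyIntegrable f) (l2_locallyIntegrable F) hg, h.jump_eq]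
  ring

theorem exists_isSplitPrim {x : L2R × L2R} (hx : x ∈ splitSobolev) :
    ∃ cp cm, IsSplitPrim x.1 x.2 cp cm := by
  have hw := hasWeakDerivOn_of_mem_splitSobolev hx
  obtain ⟨cp, hp⟩ := exists_ae_eq_prim isOpen_Ioi ordConnected_Ioi nonempty_Ioi
    (l2_locallyIntegrable x.1) (l2_locallyIntegrable x.2)
    (fun g hg => hw g (hg.mono fun y (hy : (0 : ℝ) < y) => hy.ne'))
  obtain ⟨cm, hm⟩ := exists_ae_eq_prim isOpen_Iio ordConnected_Iio nonempty_Iio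
    (l2_locallyIntegrable x.1) (l2_locallyIntegrable x.2)
    (fun g hg => hw g (hg.mono fun y (hy : y < (0 : ℝ)) => hy.ne))
  exact ⟨cp, cm, hp, hm⟩

theorem exists_ae_eq_prim_of_mem_sobolev {x : L2R × L2R} (hx : x ∈ sobolev) :
    ∃ c, x.1 =ᵐ[volume] prim c x.2 := by
  obtain ⟨c, hc⟩ := exists_ae_eq_prim isOpen_univ ordConnected_univ univ_nonempty
    (l2_locallyIntegrable x.1) (l2_locallyIntegrable x.2) (mem_sobolev_iff_hasWeakDerivOn.1 hx)
  exact ⟨c, hc.mono fun y hy => hy (mem_univ y)⟩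

theorem mem_sobolev_of_ae_eq_prim {f F : L2R} {c : ℝ} (h : f =ᵐ[volume] prim c F) :
    (f, F) ∈ sobolev := by
  have h' : IsSplitPrim f F c c := ⟨h.mono fun x hx _ => hx, h.mono fun x hx _ => hx⟩
  exact mem_sobolev_of_jump_eq_zero h'.mem_splitSobolev (by rw [h'.jump_eq, sub_self])

/-- The boundary value is `c = f(x) - ∫₀ˣ F` for almost every `x ∈ s`; averaging over `s`, of length
`1`, bounds it by `L¹(s)` norms, hence by `L²` norms. -/
theorem abs_le_of_ae_eq_prim {f F : L2R} {c : ℝ} {s : Set ℝ} (hs : MeasurableSet s)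
    (hs1 : volume s = 1) (hs2 : ∀ x ∈ s, uIoc 0 x ⊆ s) (h : ∀ᵐ x, x ∈ s → f x = prim c F x) :
    |c| ≤ ‖f‖ + ‖F‖ := by
  have hr : volume.real s = 1 := by simp [measureReal_def, hs1]
  have hfin : volume s ≠ ⊤ := by simp [hs1]
  have hfi : IntegrableOn (fun x => |f x|) s := by
    have : IsFiniteMeasure (volume.restrict s) := ⟨by simp [hs1]⟩
    exact (((Lp.memLp f).restrict s).integrable (by norm_num)).abs
  have hFi : IntegrableOn (fun x => |F x|) s := by
    have : IsFiniteMeasure (volume.restrict s) := ⟨by simp [hs1]⟩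
    exact (((Lp.memLp F).restrict s).integrable (by norm_num)).abs
  have h1 := setIntegral_abs_le_l2 f hfin
  have h2 := setIntegral_abs_le_l2 F hfin
  rw [hr, Real.sqrt_one, one_mul] at h1 h2
  set I := ∫ x in s, |F x|
  have hconst : ∀ r : ℝ, ∫ _ in s, r = r := fun r => by simp [hr]
  have h3 : ∫ _ in s, |c| ≤ ∫ x in s, (|f x| + I) := by
    refine setIntegral_mono_on_ae (integrableOn_const hfin) (hfi.add (integrableOn_const hfin)) hs ?_
    filter_upwards [h] with x hx hxs
    have h4 : |∫ t in (0 : ℝ)..x, F t| ≤ I := by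
      refine (intervalIntegral.norm_integral_le_integral_norm_uIoc (f := F)).trans ?_
      exact setIntegral_mono_set hFi (Eventually.of_forall fun _ => abs_nonneg _)
        (hs2 x hxs).eventuallyLE
    have h5 : c = f x - ∫ t in (0 : ℝ)..x, F t := by rw [hx hxs, prim]; ring
    rw [h5]
    exact (abs_sub _ _).trans (add_le_add_right h4 _)
  rw [hconst, MeasureTheory.integral_add hfi (integrableOn_const hfin), hconst] at h3
  linarith

theorem IsSplitPrim.abs_right_le {f F : L2R} {cp cm : ℝ} (h : IsSplitPrim f F cp cm) :
    |cp| ≤ ‖f‖ + ‖F‖ := by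
  refine abs_le_of_ae_eq_prim (s := Ioc 0 1) measurableSet_Ioc (by simp) (fun x hx => ?_) ?_
  · rw [uIoc_of_le hx.1.le]
    exact Ioc_subset_Ioc_right hx.2
  · filter_upwards [h.right] with x hx hx0
    exact hx hx0.1

theorem IsSplitPrim.abs_left_le {f F : L2R} {cp cm : ℝ} (h : IsSplitPrim f F cp cm) :
    |cm| ≤ ‖f‖ + ‖F‖ := by
  refine abs_le_of_ae_eq_prim (s := Ioc (-1) 0) measurableSet_Ioc (by simp) (fun x hx => ?_) ?_
  · rw [uIoc_of_ge hx.2]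
    exact Ioc_subset_Ioc_left hx.1.le
  · have h0 : ∀ᵐ x : ℝ, x ≠ 0 := by simp [ae_iff]
    filter_upwards [h.left, h0] with x hx hx0 hxs
    exact hx (lt_of_le_of_ne hxs.2 hx0)

theorem eq_zero_of_forall_test {F : L2R} (h : ∀ g, IsTestFunction puncturedLine g →
    ∫ y, F y * g y = 0) : F = 0 := by
  refine Lp.ext ?_
  have h1 := (isOpen_compl_singleton (x := (0 : ℝ))).ae_eq_zero_of_integral_contDiff_smul_eq_zero
    ((l2_locallyIntegrable F).locallyIntegrableOn _) (fun g h1 h2 h3 => by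
      simpa [mul_comm] using h g ⟨h1, h2, h3⟩)
  have h0 : ∀ᵐ x : ℝ, x ≠ 0 := by simp [ae_iff]
  filter_upwards [h1, h0, Lp.coeFn_zero ℝ 2 (volume : Measure ℝ)] with x h2 h3 h4
  rw [h2 h3, h4, Pi.zero_apply]

/-- The weak derivative off the origin is determined by the function, and the origin is null. This
gives the injectivity demanded of a closed form. -/
theorem eq_zero_of_fst_eq_zero {x : L2R × L2R} (hx : x ∈ splitSobolev) (h : x.1 = 0) : x = 0 := by
  refine Prod.ext h (eq_zero_of_forall_test fun g hg => ?_)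
  have h1 := hasWeakDerivOn_of_mem_splitSobolev hx g hg
  have h2 : ∫ y, x.1 y * deriv g y = 0 := by
    rw [h]
    refine integral_eq_zero_of_ae ?_
    filter_upwards [Lp.coeFn_zero ℝ 2 (volume : Measure ℝ)] with y hy
    rw [hy]
    simp
  rw [h2] at h1
  linarith

theorem IsTestFunction.mem_sobolev {g : ℝ → ℝ} (hg : IsTestFunction univ g) :
    (hg.toL2, hg.derivL2) ∈ sobolev := by
  refine mem_sobolev_of_ae_eq_prim (c := g 0) ?_
  have h : prim (g 0) hg.derivL2 = g :=
    (prim_congr (coeFn_ccL2 hg.continuous_deriv hg.hasCompactSupport_deriv)).trans hg.eq_prim.symm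
  rw [h]
  exact coeFn_ccL2 hg.continuous hg.2.1

/-! ### Coefficients and the associated forms -/

/-- A measurable coefficient bounded above and away from `0`. -/
structure IsCoefficient (c : ℝ → ℝ) : Prop where
  meas : AEMeasurable c volume
  bdd : ∃ δ C : ℝ, 0 < δ ∧ 0 < C ∧ ∀ᵐ x ∂(volume : Measure ℝ), δ ≤ c x ∧ c x ≤ C

namespace IsCoefficient

variable {c : ℝ → ℝ}

theorem isBddMultiplier (hc : IsCoefficient c) : IsBddMultiplier c where
  meas := hc.meas.aestronglyMeasurable
  bdd := by
    obtain ⟨δ, C, hδ, hC, h⟩ := hc.bdd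
    refine ⟨C, h.mono fun x hx => ?_⟩
    rw [abs_of_nonneg (hδ.le.trans hx.1)]
    exact hx.2

theorem isBddMultiplier_sqrt (hc : IsCoefficient c) : IsBddMultiplier fun x => √(c x / 2) where
  meas := (hc.meas.div_const 2).sqrt.aestronglyMeasurable
  bdd := by
    obtain ⟨δ, C, hδ, hC, h⟩ := hc.bdd
    refine ⟨√(C / 2), h.mono fun x hx => ?_⟩
    rw [abs_of_nonneg (Real.sqrt_nonneg _)]
    exact Real.sqrt_le_sqrt (by linarith [hx.2])

/-- Multiplication by a coefficient. -/
def mul (hc : IsCoefficient c) : L2R →L[ℝ] L2R := mulL2 hc.isBddMultiplier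

theorem inner_sqrt (hc : IsCoefficient c) (F G : L2R) :
    inner ℝ (mulL2 hc.isBddMultiplier_sqrt F) (mulL2 hc.isBddMultiplier_sqrt G) =
      1 / 2 * inner ℝ (hc.mul F) G := by
  rw [inner_mulL2, mul, inner_mulL2, ← integral_const_mul]
  obtain ⟨δ, C, hδ, hC, h⟩ := hc.bdd
  refine integral_congr_ae ?_
  filter_upwards [coeFn_mulL2 hc.isBddMultiplier_sqrt G, h] with x hx h2
  rw [hx]
  have : √(c x / 2) * √(c x / 2) = c x / 2 := Real.mul_self_sqrt (by linarith [h2.1])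
  calc _ = (√(c x / 2) * √(c x / 2)) * F x * G x := by ring
    _ = _ := by rw [this]; ring

theorem le_inner_mul (hc : IsCoefficient c) {δ : ℝ}
    (h : ∀ᵐ x ∂(volume : Measure ℝ), δ ≤ c x) (F : L2R) : δ * ‖F‖ ^ 2 ≤ inner ℝ (hc.mul F) F := by
  rw [l2_norm_sq, l2_inner, ← integral_const_mul]
  refine integral_mono_ae ((Lp.memLp F).integrable_sq.const_mul _) (l2_integrable_mul _ _) ?_
  filter_upwards [h, coeFn_mulL2 hc.isBddMultiplier F] with x h1 h2
  have h3 : hc.mul F x = c x * F x := h2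
  simp only [h3]
  nlinarith [sq_nonneg (F x)]

theorem inner_mul_self_nonneg (hc : IsCoefficient c) (F : L2R) : 0 ≤ inner ℝ (hc.mul F) F := by
  obtain ⟨δ, C, hδ, hC, h⟩ := hc.bdd
  exact le_trans (by positivity) (hc.le_inner_mul (h.mono fun x hx => hx.1) F)

/-- The map realising the form `½ ∫ c f' g' + k [f] [g]`, where `[f]` is the jump of `f`. -/
def formMap (hc : IsCoefficient c) (k : ℝ) :
    L2R × L2R →L[ℝ] WithLp 2 (L2R × WithLp 2 (L2R × ℝ)) :=
  ((WithLp.prodContinuousLinearEquiv 2 ℝ L2R (WithLp 2 (L2R × ℝ))).symm :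
      L2R × WithLp 2 (L2R × ℝ) →L[ℝ] WithLp 2 (L2R × WithLp 2 (L2R × ℝ))) ∘L
    (ContinuousLinearMap.fst ℝ L2R L2R).prod
      (((WithLp.prodContinuousLinearEquiv 2 ℝ L2R ℝ).symm : L2R × ℝ →L[ℝ] WithLp 2 (L2R × ℝ)) ∘L
        (mulL2 hc.isBddMultiplier_sqrt ∘L ContinuousLinearMap.snd ℝ L2R L2R).prod (√k • jump))

theorem inner_formMap (hc : IsCoefficient c) {k : ℝ} (hk : 0 ≤ k) (x y : L2R × L2R) :
    inner ℝ (hc.formMap k x) (hc.formMap k y) =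
      inner ℝ x.1 y.1 + 1 / 2 * inner ℝ (hc.mul x.2) y.2 + k * (jump x * jump y) := by
  have h : inner ℝ (hc.formMap k x) (hc.formMap k y) = inner ℝ x.1 y.1 +
      (inner ℝ (mulL2 hc.isBddMultiplier_sqrt x.2) (mulL2 hc.isBddMultiplier_sqrt y.2)
        + inner ℝ (√k * jump x) (√k * jump y)) := rfl
  rw [h, hc.inner_sqrt, Real.inner_apply]
  linear_combination (jump x * jump y) * Real.mul_self_sqrt hk

theorem norm_formMap_sq (hc : IsCoefficient c) {k : ℝ} (hk : 0 ≤ k) (x : L2R × L2R) :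
    ‖hc.formMap k x‖ ^ 2 = ‖x.1‖ ^ 2 + 1 / 2 * inner ℝ (hc.mul x.2) x.2 + k * jump x ^ 2 := by
  rw [← real_inner_self_eq_norm_sq, hc.inner_formMap hk, real_inner_self_eq_norm_sq, sq (jump x)]

/-- The form with coefficient `c` and jump parameter `k` is closed on each closed subspace of the
Sobolev space of the split line. -/
theorem isClosedForm (hc : IsCoefficient c) {k : ℝ} (hk : 0 ≤ k) {W : Submodule ℝ (L2R × L2R)}
    (hW : W ≤ splitSobolev) :
    IsClosedForm (ContinuousLinearMap.fst ℝ L2R L2R ∘L W.subtypeL)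
      (hc.formMap k ∘L W.subtypeL) where
  injective := by
    rw [injective_iff_map_eq_zero]
    intro x hx
    exact Subtype.ext (eq_zero_of_fst_eq_zero (hW x.2) hx)
  norm_le x := by
    refine le_of_sq_le_sq ?_ (norm_nonneg _)
    have h := hc.norm_formMap_sq hk (x : L2R × L2R)
    have h1 := hc.inner_mul_self_nonneg (x : L2R × L2R).2
    have h2 : 0 ≤ k * jump (x : L2R × L2R) ^ 2 := by positivity
    simp only [ContinuousLinearMap.comp_apply, Submodule.subtypeL_apply,
      ContinuousLinearMap.coe_fst']
    rw [h]
    linarith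
  coercive := by
    obtain ⟨δ, C, hδ, hC, hb⟩ := hc.bdd
    -- `½∫ c F² ≥ (δ/2)‖F‖²` controls the gradient, and the norm of the product space is the maximum
    -- of the two norms.
    refine ⟨max 1 √(2 / δ), fun x => ?_⟩
    have h := hc.norm_formMap_sq hk (x : L2R × L2R)
    have h1 := hc.le_inner_mul (hb.mono fun x hx => hx.1) (x : L2R × L2R).2
    have h2 : 0 ≤ k * jump (x : L2R × L2R) ^ 2 := by positivity
    simp only [ContinuousLinearMap.comp_apply, Submodule.subtypeL_apply]
    set N := ‖hc.formMap k (x : L2R × L2R)‖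
    have hN : 0 ≤ N := norm_nonneg _
    have h3 : ‖(x : L2R × L2R).1‖ ≤ N := by
      refine le_of_sq_le_sq ?_ hN
      nlinarith [sq_nonneg ‖(x : L2R × L2R).2‖]
    have h4 : ‖(x : L2R × L2R).2‖ ≤ √(2 / δ) * N := by
      refine le_of_sq_le_sq ?_ (by positivity)
      rw [mul_pow, Real.sq_sqrt (by positivity), div_mul_eq_mul_div, le_div_iff₀ hδ]
      nlinarith [sq_nonneg ‖(x : L2R × L2R).1‖]
    have h5 : ‖x‖ = max ‖(x : L2R × L2R).1‖ ‖(x : L2R × L2R).2‖ := rfl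
    rw [h5]
    refine max_le (h3.trans ?_) (h4.trans ?_)
    · exact le_mul_of_one_le_left hN (le_max_left _ _)
    · gcongr
      exact le_max_right _ _

end IsCoefficient

/-! ### Integration by parts in `H¹(ℝ)` -/

/-- The product of the two primitives has an integrable derivative, so it converges at `±∞`. Being
itself integrable, it can only converge to `0`, and no boundary terms survive. -/
theorem inner_add_inner_eq_zero_of_mem_sobolev {x y : L2R × L2R} (hx : x ∈ sobolev)
    (hy : y ∈ sobolev) : inner ℝ x.1 y.2 + inner ℝ x.2 y.1 = 0 := by
  obtain ⟨c, hc⟩ := exists_ae_eq_prim_of_mem_sobolev hx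
  obtain ⟨d, hd⟩ := exists_ae_eq_prim_of_mem_sobolev hy
  have hF := l2_locallyIntegrable x.2
  have hG := l2_locallyIntegrable y.2
  set Φ := prim c x.2
  set Γ := prim d y.2
  have hi : Integrable (fun t => x.2 t * Γ t + Φ t * y.2 t) := by
    refine ((l2_integrable_mul x.2 y.1).add (l2_integrable_mul x.1 y.2)).congr ?_
    filter_upwards [hc, hd] with t h1 h2
    simp only [Pi.add_apply, h1, h2]
  have hp : Integrable (fun t => Φ t * Γ t) := by
    refine (l2_integrable_mul x.1 y.1).congr ?_
    filter_upwards [hc, hd] with t h1 h2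
    rw [h1, h2]
  have hftc := integral_prim_mul_prim hF hG c d
  have htop : ∫ t in Ioi (0 : ℝ), (x.2 t * Γ t + Φ t * y.2 t) = - (Φ 0 * Γ 0) := by
    have h1 : Tendsto (fun b => Φ b * Γ b) atTop
        (𝓝 (Φ 0 * Γ 0 + ∫ t in Ioi (0 : ℝ), (x.2 t * Γ t + Φ t * y.2 t))) := by
      refine ((intervalIntegral_tendsto_integral_Ioi 0 hi.integrableOn tendsto_id).const_add
        (Φ 0 * Γ 0)).congr fun b => ?_
      rw [hftc, id]
      ring
    have h2 := IntegrableAtFilter.eq_zero_of_tendsto (hp.integrableAtFilter atTop)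
      (fun s hs => by
        obtain ⟨N, hN⟩ := mem_atTop_sets.1 hs
        exact measure_mono_top hN Real.volume_Ici) h1
    linarith
  have hbot : ∫ t in Iic (0 : ℝ), (x.2 t * Γ t + Φ t * y.2 t) = Φ 0 * Γ 0 := by
    have h1 : Tendsto (fun b => Φ b * Γ b) atBot
        (𝓝 (Φ 0 * Γ 0 - ∫ t in Iic (0 : ℝ), (x.2 t * Γ t + Φ t * y.2 t))) := by
      refine ((intervalIntegral_tendsto_integral_Iic 0 hi.integrableOn tendsto_id).const_sub
        (Φ 0 * Γ 0)).congr fun b => ?_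
      rw [hftc, id]
      ring
    have h2 := IntegrableAtFilter.eq_zero_of_tendsto (hp.integrableAtFilter atBot)
      (fun s hs => by
        obtain ⟨N, hN⟩ := mem_atBot_sets.1 hs
        exact measure_mono_top hN Real.volume_Iic) h1
    linarith
  have htot := integral_eq_Ioi_add_Iio hi
  rw [← integral_Iic_eq_integral_Iio, htop, hbot] at htot
  rw [l2_inner, l2_inner, add_comm, ← integral_add (l2_integrable_mul _ _) (l2_integrable_mul _ _)]
  refine Eq.trans (integral_congr_ae ?_) (htot.trans (neg_add_cancel _))
  filter_upwards [hc, hd] with t h1 h2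
  rw [h1, h2]

/-! ### Weak solutions -/

/-- A curve in `L² × L²` whose first component satisfies the weak heat equation with flux given by
the second component. -/
structure IsWeakCurve (c : ℝ → ℝ) (x : ℝ → L2R × L2R) : Prop where
  continuous : Continuous x
  bounded : ∃ M, ∀ t, ‖x t‖ ≤ M
  weak : ∀ t, 0 < t → ∀ g, IsTestFunction univ g →
    ∫ y, ((x 0).1 y - (x t).1 y) * g y =
      1 / 2 * ∫ s in (0 : ℝ)..t, ∫ y, c y * (x s).2 y * deriv g y

theorem IsWeakCurve.isWeakSolution {c : ℝ → ℝ} {x : ℝ → L2R × L2R} (hx : IsWeakCurve c x)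
    {Ω : Set ℝ} (hΩ : ∀ t, HasWeakDerivOn Ω (x t).1 (x t).2) {u : ℝ → L2R}
    (hu : ∀ t, 0 ≤ t → u t = (x t).1) : IsWeakSolution Ω c (u 0) u := by
  obtain ⟨M, hM⟩ := hx.bounded
  have hae : ∀ᵐ t ∂(volume.restrict (Ici (0 : ℝ))), (x t).1 = u t := by
    filter_upwards [ae_restrict_mem measurableSet_Ici] with t ht
    exact (hu t ht).symm
  refine ⟨⟨(hx.continuous.fst.continuousOn).congr fun t ht => hu t ht, M, fun t ht => ?_⟩, rfl,
    fun t => (x t).2, ⟨?_, ?_, ?_⟩, fun t ht g hg => ?_⟩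
  · rw [hu t ht]
    exact (norm_fst_le _).trans (hM t)
  · refine (memLp_congr_ae hae).1 (memLp_top_of_bound hx.continuous.fst.aestronglyMeasurable M ?_)
    exact Eventually.of_forall fun t => (norm_fst_le _).trans (hM t)
  · refine memLp_top_of_bound hx.continuous.snd.aestronglyMeasurable M ?_
    exact Eventually.of_forall fun t => (norm_snd_le _).trans (hM t)
  · filter_upwards [hae] with t ht
    rw [← ht]
    exact hΩ t
  · rw [hu 0 le_rfl, hu t ht.le]
    exact hx.weak t ht g hg

theorem integral_coefficient_mul {c : ℝ → ℝ} (hc : IsCoefficient c) (F : L2R) {g : ℝ → ℝ}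
    (hg : IsTestFunction univ g) :
    ∫ y, c y * F y * deriv g y = inner ℝ (hc.mul F) hg.derivL2 := by
  rw [hg.inner_derivL2]
  refine integral_congr_ae ?_
  filter_upwards [coeFn_mulL2 hc.isBddMultiplier F] with y hy
  have : hc.mul F y = c y * F y := hy
  rw [this]

theorem integral_sub_mul_test (f f' : L2R) {g : ℝ → ℝ} (hg : IsTestFunction univ g) :
    ∫ y, (f y - f' y) * g y = inner ℝ (f - f') hg.toL2 := by
  rw [hg.inner_toL2]
  refine integral_congr_ae ?_
  filter_upwards [Lp.coeFn_sub f f'] with y hy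
  rw [hy, Pi.sub_apply]

theorem IsWeakCurve.sub {c : ℝ → ℝ} (hc : IsCoefficient c) {x y : ℝ → L2R × L2R}
    (hx : IsWeakCurve c x) (hy : IsWeakCurve c y) : IsWeakCurve c (x - y) where
  continuous := hx.continuous.sub hy.continuous
  bounded := by
    obtain ⟨M, hM⟩ := hx.bounded
    obtain ⟨N, hN⟩ := hy.bounded
    exact ⟨M + N, fun t => (norm_sub_le _ _).trans (add_le_add (hM t) (hN t))⟩
  weak t ht g hg := by
    have h1 := hx.weak t ht g hg
    have h2 := hy.weak t ht g hg
    have hci : ∀ {z : ℝ → L2R × L2R}, Continuous z →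
        IntervalIntegrable (fun s => inner ℝ (hc.mul (z s).2) hg.derivL2) volume 0 t := fun hz =>
      (Continuous.inner (hc.mul.continuous.comp hz.snd) continuous_const).intervalIntegrable _ _
    simp only [integral_sub_mul_test _ _ hg, integral_coefficient_mul hc _ hg] at h1 h2 ⊢
    simp only [Pi.sub_apply, Prod.fst_sub, Prod.snd_sub, map_sub, inner_sub_left]
    rw [intervalIntegral.integral_sub (hci hx.continuous) (hci hy.continuous), mul_sub, ← h1, ← h2]
    simp only [inner_sub_left]
    ring

/-- A test function on `ℝ` has zero jump, so the jump term of the form disappears from the weak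
equation: every `k ≥ 0` and every intermediate space `W` produce solutions of the same equation. -/
theorem isWeakCurve_of_evolution {c : ℝ → ℝ} (hc : IsCoefficient c) {k : ℝ} (hk : 0 ≤ k)
    {W : Submodule ℝ (L2R × L2R)} (hW : sobolev ≤ W) {x : ℝ → W} (hx : Continuous x)
    (hb : ∃ M, ∀ t, ‖x t‖ ≤ M)
    (hweak : ∀ t, 0 ≤ t → ∀ y : W,
      inner ℝ ((x 0 : L2R × L2R).1 - (x t : L2R × L2R).1) (y : L2R × L2R).1 =
      ∫ s in (0 : ℝ)..t, (inner ℝ (hc.formMap k (x s)) (hc.formMap k y)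
        - inner ℝ (x s : L2R × L2R).1 (y : L2R × L2R).1)) :
    IsWeakCurve c fun t => (x t : L2R × L2R) where
  continuous := continuous_subtype_val.comp hx
  bounded := hb
  weak t ht g hg := by
    have h := hweak t ht.le ⟨_, hW hg.mem_sobolev⟩
    simp only [integral_sub_mul_test _ _ hg, integral_coefficient_mul hc _ hg]
    simp only [hc.inner_formMap hk, jump_eq_zero_of_mem_sobolev hg.mem_sobolev, mul_zero,
      add_zero, add_sub_cancel_left] at h
    rw [h, intervalIntegral.integral_const_mul]

theorem integral_mem_sobolev {z dz : ℝ → L2R} {μ : Measure ℝ} (hz : Integrable z μ)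
    (hdz : Integrable dz μ) (h : ∀ᵐ s ∂μ, (z s, dz s) ∈ sobolev) :
    (∫ s, z s ∂μ, ∫ s, dz s ∂μ) ∈ sobolev := by
  rw [mem_sobolev]
  intro g hg
  rw [← integral_pair hz hdz, ← pairing_apply hg,
    ← (pairing hg).integral_comp_comm (hz.prodMk hdz)]
  refine integral_eq_zero_of_ae (h.mono fun s hs => ?_)
  simp only [pairing_apply, Pi.zero_apply]
  exact mem_sobolev.1 hs g hg

/-- Let `z = v - w`, `Z = ∫₀ᵗ z` and `D = ∫₀ᵗ dz`. The weak equation says that `c D` has weak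
derivative `2z`, while `Z` has weak derivative `D`. Integration by parts gives `2⟨Z, z⟩ = -⟨cD, D⟩ ≤
0`, so `‖Z‖²` decreases from `0`; thus `Z = 0`, and `z = Z' = 0`. Integrating in time avoids any
time derivative of `z`. -/
theorem IsWeakSolution.eq_of_univ {c : ℝ → ℝ} (hc : IsCoefficient c) {u₀ : L2R} {v w : ℝ → L2R}
    (hv : IsWeakSolution univ c u₀ v) (hw : IsWeakSolution univ c u₀ w) {t : ℝ} (ht : 0 ≤ t) :
    v t = w t := by
  obtain ⟨⟨hvc, -⟩, hv0, dv, ⟨hvm, hdvm, hvd⟩, hvw⟩ := hv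
  obtain ⟨⟨hwc, -⟩, hw0, dw, ⟨hwm, hdwm, hwd⟩, hww⟩ := hw
  -- Freezing the solutions at negative times makes `z` continuous on `ℝ`, so that `Z` is
  -- differentiable everywhere.
  set z : ℝ → L2R := fun t => v (max t 0) - w (max t 0)
  set dz : ℝ → L2R := fun t => dv t - dw t
  have hzc : Continuous z :=
    (hvc.comp_continuous (by fun_prop) fun t => le_max_right t 0).sub
      (hwc.comp_continuous (by fun_prop) fun t => le_max_right t 0)
  have hzt : ∀ t, 0 ≤ t → z t = v t - w t := fun t ht => by simp only [z, max_eq_left ht]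
  have hz0 : z 0 = 0 := by rw [hzt 0 le_rfl, hv0, hw0, sub_self]
  have hint : ∀ {d : ℝ → L2R}, MemLp d ⊤ (volume.restrict (Ici (0 : ℝ))) → ∀ t : ℝ,
      Integrable d (volume.restrict (Ioc 0 t)) := by
    intro d hd t
    have h1 : MemLp d ⊤ (volume.restrict (Ioc 0 t)) :=
      hd.mono_measure (Measure.restrict_mono (Ioc_subset_Icc_self.trans Icc_subset_Ici_self) le_rfl)
    exact memLp_one_iff_integrable.1 (h1.mono_exponent le_top)
  have hdzi : ∀ t : ℝ, Integrable dz (volume.restrict (Ioc 0 t)) := fun t =>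
    (hint hdvm t).sub (hint hdwm t)
  set Z : ℝ → L2R := fun t => ∫ s in (0 : ℝ)..t, z s
  have hZd : ∀ t, HasDerivAt Z (z t) t := fun t => (hzc.integral_hasStrictDerivAt 0 t).hasDerivAt
  have hmem : ∀ t : ℝ, 0 ≤ t → (Z t, ∫ s in Ioc 0 t, dz s) ∈ sobolev := by
    intro t ht
    simp only [Z]
    rw [intervalIntegral.integral_of_le ht]
    refine integral_mem_sobolev ?_ (hdzi t) ?_
    · exact (intervalIntegrable_iff_integrableOn_Ioc_of_le ht).1 (hzc.intervalIntegrable _ _)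
    · have hsub : volume.restrict (Ioc 0 t) ≤ volume.restrict (Ici (0 : ℝ)) :=
        Measure.restrict_mono (Ioc_subset_Icc_self.trans Icc_subset_Ici_self) le_rfl
      filter_upwards [ae_mono hsub hvd, ae_mono hsub hwd, ae_restrict_mem measurableSet_Ioc]
        with s h1 h2 h3
      rw [hzt s h3.1.le]
      exact sobolev.sub_mem (x := (v s, dv s)) (y := (w s, dw s))
        (mem_sobolev_iff_hasWeakDerivOn.2 h1) (mem_sobolev_iff_hasWeakDerivOn.2 h2)
  have hle : ∀ t : ℝ, 0 < t → inner ℝ (Z t) (z t) ≤ 0 := by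
    intro t ht
    set D := ∫ s in Ioc 0 t, dz s
    have hflux : (hc.mul D, (2 : ℝ) • z t) ∈ sobolev := by
      rw [mem_sobolev]
      intro g hg
      have h1 := hvw t ht g hg
      have h2 := hww t ht g hg
      simp only [integral_sub_mul_test _ _ hg, integral_coefficient_mul hc _ hg] at h1 h2
      rw [intervalIntegral.integral_of_le ht.le] at h1 h2
      have hcomm : ∀ {d : ℝ → L2R}, Integrable d (volume.restrict (Ioc 0 t)) →
          ∫ s in Ioc 0 t, inner ℝ (hc.mul (d s)) hg.derivL2 =
            inner ℝ (hc.mul (∫ s in Ioc 0 t, d s)) hg.derivL2 := by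
        intro d hd
        have h3 := (innerSL ℝ hg.derivL2 ∘L hc.mul).integral_comp_comm hd
        simp only [ContinuousLinearMap.comp_apply, innerSL_apply_apply] at h3
        rw [real_inner_comm, ← h3]
        simp only [real_inner_comm]
      rw [hcomm (hint hdvm t)] at h1
      rw [hcomm (hint hdwm t)] at h2
      have hD : D = (∫ s in Ioc 0 t, dv s) - ∫ s in Ioc 0 t, dw s :=
        integral_sub (hint hdvm t) (hint hdwm t)
      dsimp only
      rw [← hg.inner_derivL2, ← hg.inner_toL2, hzt t ht.le, hD, map_sub, inner_smul_left,
        inner_sub_left, inner_sub_left]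
      rw [inner_sub_left] at h1 h2
      simp only [conj_trivial]
      linarith
    have h1 := inner_add_inner_eq_zero_of_mem_sobolev (hmem t ht.le) hflux
    simp only [inner_smul_right] at h1
    have h2 := hc.inner_mul_self_nonneg D
    rw [real_inner_comm] at h2
    linarith
  have hsqd : ∀ t, HasDerivAt (fun t => ‖Z t‖ ^ 2) (2 * inner ℝ (Z t) (z t)) t := fun t =>
    (hZd t).norm_sq
  have hanti : AntitoneOn (fun t => ‖Z t‖ ^ 2) (Ici 0) := by
    refine antitoneOn_of_deriv_nonpos (convex_Ici 0)
      (fun t _ => (hsqd t).continuousAt.continuousWithinAt)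
      (fun t _ => (hsqd t).differentiableAt.differentiableWithinAt) fun t ht => ?_
    rw [interior_Ici] at ht
    rw [(hsqd t).deriv]
    linarith [hle t ht]
  have hZ0 : ∀ t : ℝ, 0 ≤ t → Z t = 0 := by
    intro t ht
    have h1 := hanti (mem_Ici.2 le_rfl) (mem_Ici.2 ht) ht
    have h2 : Z 0 = 0 := by simp [Z]
    simp only [h2, norm_zero] at h1
    have h3 : ‖Z t‖ ^ 2 = 0 := le_antisymm (by simpa using h1) (sq_nonneg _)
    exact norm_eq_zero.1 (pow_eq_zero_iff two_ne_zero |>.1 h3)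
  have hz : z t = 0 := by
    rcases ht.eq_or_lt with rfl | ht'
    · exact hz0
    · have h1 : HasDerivAt Z 0 t := by
        refine (hasDerivAt_const t (0 : L2R)).congr_of_eventuallyEq ?_
        filter_upwards [lt_mem_nhds ht'] with s hs
        exact hZ0 s hs.le
      exact (hZd t).unique h1
  rw [hzt t ht] at hz
  exact sub_eq_zero.1 hz

/-! ### Boundary conditions for elements of the operator domain -/

/-! ### Restriction operators and truncated test functions -/

theorem isBddMultiplier_indicator {s : Set ℝ} (hs : MeasurableSet s) :
    IsBddMultiplier (s.indicator fun _ => 1) where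
  meas := (measurable_const.indicator hs).aestronglyMeasurable
  bdd := ⟨1, Eventually.of_forall fun x => by
    by_cases h : x ∈ s <;> simp [h]⟩

/-- Restriction to a measurable set, on `L²(ℝ)`. -/
def restrictL2 {s : Set ℝ} (hs : MeasurableSet s) : L2R →L[ℝ] L2R :=
  mulL2 (isBddMultiplier_indicator hs)

theorem coeFn_restrictL2 {s : Set ℝ} (hs : MeasurableSet s) (f : L2R) :
    restrictL2 hs f =ᵐ[volume] s.indicator f := by
  filter_upwards [coeFn_mulL2 (isBddMultiplier_indicator hs) f] with x hx
  rw [restrictL2, hx]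
  by_cases h : x ∈ s <;> simp [h]

theorem inner_restrictL2_comm {s : Set ℝ} (hs : MeasurableSet s) (f g : L2R) :
    inner ℝ (restrictL2 hs f) g = inner ℝ f (restrictL2 hs g) :=
  inner_mulL2_comm _ f g

theorem norm_restrictL2_le {s : Set ℝ} (hs : MeasurableSet s) (f : L2R) :
    ‖restrictL2 hs f‖ ≤ ‖f‖ := by
  have := norm_mulL2_le (isBddMultiplier_indicator hs) (C := 1) (Eventually.of_forall fun x => by
    by_cases h : x ∈ s <;> simp [h]) f
  simpa [restrictL2] using this

theorem inner_restrictL2_ccL2 {s : Set ℝ} (hs : MeasurableSet s) (f : L2R) {g : ℝ → ℝ}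
    (hg : Continuous g) (hc : HasCompactSupport g) :
    inner ℝ f (restrictL2 hs (ccL2 hg hc)) = ∫ x in s, f x * g x := by
  rw [← inner_restrictL2_comm, inner_ccL2, ← integral_indicator hs]
  refine integral_congr_ae ?_
  filter_upwards [coeFn_restrictL2 hs f] with x hx
  rw [hx]
  by_cases h : x ∈ s <;> simp [h]

/-- Restriction to the right half-line. -/
def restrictRight : L2R →L[ℝ] L2R := restrictL2 (measurableSet_Ioi (a := (0 : ℝ)))

/-- Restriction to the left half-line. -/
def restrictLeft : L2R →L[ℝ] L2R := restrictL2 (measurableSet_Iio (a := (0 : ℝ)))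

theorem coeFn_restrictRight (f : L2R) : restrictRight f =ᵐ[volume] (Ioi 0).indicator f :=
  coeFn_restrictL2 _ f

theorem coeFn_restrictLeft (f : L2R) : restrictLeft f =ᵐ[volume] (Iio 0).indicator f :=
  coeFn_restrictL2 _ f

/-- Provides test elements with prescribed jump: truncating at the origin creates the jump `g 0` and
adds nothing to the gradient. -/
theorem IsTestFunction.isSplitPrim_restrict {g : ℝ → ℝ} (hg : IsTestFunction univ g) :
    IsSplitPrim (restrictRight hg.toL2) (restrictRight hg.derivL2) (g 0) 0 where
  right := by
    have h1 := coeFn_restrictRight hg.toL2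
    have h2 := coeFn_restrictRight hg.derivL2
    have h4 : (hg.derivL2 : ℝ → ℝ) =ᵐ[volume] deriv g := coeFn_ccL2 _ _
    have h5 : (hg.toL2 : ℝ → ℝ) =ᵐ[volume] g := coeFn_ccL2 _ _
    filter_upwards [h1, h5] with x hx hx5 hx0
    rw [hx, indicator_of_mem hx0, hx5]
    nth_rw 1 [hg.eq_prim]
    simp only [prim]
    congr 1
    refine intervalIntegral.integral_congr_ae ?_
    filter_upwards [h2, h4] with t ht ht4 ht0
    rw [uIoc_of_le (le_of_lt hx0)] at ht0
    rw [ht, indicator_of_mem (mem_Ioi.2 ht0.1), ht4]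
  left := by
    have h1 := coeFn_restrictRight hg.toL2
    have h2 := coeFn_restrictRight hg.derivL2
    filter_upwards [h1] with x hx hx0
    rw [hx, indicator_of_notMem (by simpa using le_of_lt hx0), prim, zero_add, eq_comm]
    refine intervalIntegral.integral_zero_ae ?_
    filter_upwards [h2] with t ht ht0
    rw [uIoc_of_ge (le_of_lt hx0)] at ht0
    rw [ht, indicator_of_notMem (by simpa using ht0.2)]

theorem IsTestFunction.restrict_mem_splitSobolev {g : ℝ → ℝ} (hg : IsTestFunction univ g) :
    (restrictRight hg.toL2,
      restrictRight hg.derivL2) ∈ splitSobolev :=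
  hg.isSplitPrim_restrict.mem_splitSobolev

theorem IsTestFunction.jump_restrict {g : ℝ → ℝ} (hg : IsTestFunction univ g) :
    jump (restrictRight hg.toL2,
      restrictRight hg.derivL2) = g 0 := by
  rw [hg.isSplitPrim_restrict.jump_eq, sub_zero]

/-- On `S` the derivative is `F = P / a`, the continuous flux over the coefficient. Replacing `a` by
the positive continuous `a'` gives a formula that is `C¹` on all of `ℝ`. -/
theorem exists_contDiff_version {a a' f F P : ℝ → ℝ} {c : ℝ} {S : Set ℝ}
    (hS : MeasurableSet S) (hS0 : ∀ y ∈ S, ∀ᵐ t, t ∈ uIoc 0 y → t ∈ S)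
    (ha' : Continuous a') (hpos : ∀ y, 0 < a' y) (haa' : ∀ y ∈ S, a' y = a y) (hP : Continuous P)
    (hF : ∀ᵐ t, a t * F t = P t) (hf : ∀ᵐ y, y ∈ S → f y = prim c F y) :
    ∃ φ : ℝ → ℝ, ContDiff ℝ 1 φ ∧ f =ᵐ[volume.restrict S] φ ∧ φ 0 = c ∧
      HasDerivAt φ (P 0 / a' 0) 0 := by
  have hq : Continuous fun t => P t / a' t := hP.div ha' fun t => (hpos t).ne'
  have hd : ∀ x, HasDerivAt (prim c fun t => P t / a' t) (P x / a' x) x := fun x =>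
    ((hq.integral_hasStrictDerivAt 0 x).hasDerivAt).const_add c
  refine ⟨prim c fun t => P t / a' t, ?_, ?_, prim_zero _ _, hd 0⟩
  · rw [contDiff_one_iff_deriv]
    refine ⟨fun x => (hd x).differentiableAt, ?_⟩
    rwa [show deriv (prim c fun t => P t / a' t) = fun t => P t / a' t from
      funext fun x => (hd x).deriv]
  · rw [EventuallyEq, ae_restrict_iff' hS]
    filter_upwards [hf] with y hy hyS
    rw [hy hyS, prim, prim]
    congr 1
    refine intervalIntegral.integral_congr_ae ?_
    filter_upwards [hF, hS0 y hyS] with t ht htS ht0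
    have h1 := haa' t (htS ht0)
    rw [eq_div_iff (hpos t).ne', h1, mul_comm, ht]

/-- The subset of `S` where `a < δ` is open and null, hence empty. -/
theorem le_of_ae_le_of_continuousOn {a : ℝ → ℝ} {S : Set ℝ} (hS : IsOpen S)
    (ha : ContinuousOn a S) {δ : ℝ} (h : ∀ᵐ x, δ ≤ a x) : ∀ x ∈ S, δ ≤ a x := by
  intro x hx
  by_contra hlt
  have ho : IsOpen (S ∩ a ⁻¹' Iio δ) := ha.isOpen_inter_preimage hS isOpen_Iio
  have h0 : volume (S ∩ a ⁻¹' Iio δ) = 0 := by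
    refine measure_mono_null (fun y hy => ?_) (ae_iff.1 h)
    simpa using hy.2
  have := ho.eq_empty_of_measure_zero h0
  exact (this ▸ (⟨hx, not_le.1 hlt⟩ : x ∈ S ∩ a ⁻¹' Iio δ) : x ∈ (∅ : Set ℝ))

theorem exists_hasBoundaryData {a : ℝ → ℝ} (ha : IsCoefficient a) {ap am : ℝ}
    (hG : IsContinuousOnG a ap am) {k : ℝ} {x : L2R × L2R} (hx : x ∈ splitSobolev) {h : L2R}
    (hres : ∀ y ∈ splitSobolev, inner ℝ x.1 y.1 + 1 / 2 * inner ℝ (ha.mul x.2) y.2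
      + k * (jump x * jump y) = inner ℝ h y.1) :
    0 < ap ∧ 0 < am ∧ ∃ vp vm dp dm, HasBoundaryData x.1 vp vm dp dm ∧
      ap * dp = 2 * k * (vp - vm) ∧ am * dm = 2 * k * (vp - vm) := by
  obtain ⟨δ, C, hδ, -, hb⟩ := ha.bdd
  -- Test functions without jump eliminate `k`: the flux has a weak derivative on the whole line, so
  -- it does not jump at the origin.
  have hflux : (ha.mul x.2, (2 : ℝ) • (x.1 - h)) ∈ sobolev := by
    rw [mem_sobolev]
    intro g hg
    have h1 := hres _ (sobolev_le_splitSobolev hg.mem_sobolev)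
    rw [jump_eq_zero_of_mem_sobolev hg.mem_sobolev] at h1
    dsimp only at h1 ⊢
    rw [← hg.inner_derivL2, ← hg.inner_toL2, inner_smul_left, inner_sub_left]
    simp only [conj_trivial]
    linarith
  obtain ⟨p, hp⟩ := exists_ae_eq_prim_of_mem_sobolev hflux
  set D : L2R := (2 : ℝ) • (x.1 - h)
  set P := prim p D
  have hPc : Continuous P := continuous_prim (l2_locallyIntegrable D) p
  have hP0 : P 0 = p := prim_zero _ _
  obtain ⟨cp, cm, hsp⟩ := exists_isSplitPrim hx
  have hjump : jump x = cp - cm := hsp.jump_eq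
  -- `bump` truncated to the right half-line has jump `1`. Integration by parts on `(0, ∞)` then
  -- isolates the boundary value `p` of the flux.
  have hpval : p = 2 * k * (cp - cm) := by
    have hg := isTestFunction_bump
    have h1 := hres _ hg.restrict_mem_splitSobolev
    rw [hg.jump_restrict, bump_zero, hjump] at h1
    dsimp only at h1
    have h2 := integral_Ioi_ibp (l2_locallyIntegrable D) p hg
    rw [integral_add, bump_zero] at h2
    rotate_left
    · exact (integrable_mul_test (l2_locallyIntegrable D) hg.continuous hg.2.1).integrableOn
    · exact (integrable_mul_test hPc.locallyIntegrable hg.continuous_deriv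
        hg.hasCompactSupport_deriv).integrableOn
    have h3 : inner ℝ (ha.mul x.2) (restrictRight hg.derivL2) =
        ∫ y in Ioi (0 : ℝ), P y * deriv bump y := by
      rw [IsTestFunction.derivL2, restrictRight, inner_restrictL2_ccL2]
      refine setIntegral_congr_ae measurableSet_Ioi ?_
      filter_upwards [hp] with y hy _
      rw [hy]
    have h4 : ∫ y in Ioi (0 : ℝ), D y * bump y =
        2 * (inner ℝ x.1 (restrictRight hg.toL2)
          - inner ℝ h (restrictRight hg.toL2)) := by
      rw [← inner_sub_left, IsTestFunction.toL2, restrictRight,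
        ← inner_restrictL2_ccL2 measurableSet_Ioi D hg.continuous hg.2.1, inner_smul_left]
      simp
    rw [h3] at h1
    rw [h4] at h2
    linarith
  have hF : ∀ᵐ t, a t * x.2 t = P t := by
    filter_upwards [hp, coeFn_mulL2 ha.isBddMultiplier x.2] with t h1 h2
    rw [← h1]
    exact h2.symm
  have haR : ∀ y ∈ Ioi (0 : ℝ), δ ≤ a y :=
    le_of_ae_le_of_continuousOn isOpen_Ioi hG.right (hb.mono fun y hy => hy.1)
  have haL : ∀ y ∈ Iio (0 : ℝ), δ ≤ a y :=
    le_of_ae_le_of_continuousOn isOpen_Iio hG.left (hb.mono fun y hy => hy.1)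
  have hap : 0 < ap := hδ.trans_le (ge_of_tendsto hG.right_lim
    (eventually_of_mem self_mem_nhdsWithin haR))
  have ham : 0 < am := hδ.trans_le (ge_of_tendsto hG.left_lim
    (eventually_of_mem self_mem_nhdsWithin haL))
  -- The coefficient is given its limit at `0` and continued to the other side by that constant.
  have hcR : Continuous fun y => Function.update a 0 ap (max y 0) := by
    refine ContinuousOn.comp_continuous (g := Function.update a 0 ap) (s := Ici 0) ?_
      (by fun_prop) fun y => le_max_right y 0
    rw [continuousOn_update_iff, Ici_sdiff_left]
    exact ⟨hG.right, fun _ => hG.right_lim⟩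
  have hcL : Continuous fun y => Function.update a 0 am (min y 0) := by
    refine ContinuousOn.comp_continuous (g := Function.update a 0 am) (s := Iic 0) ?_
      (by fun_prop) fun y => min_le_right y 0
    rw [continuousOn_update_iff, Iic_sdiff_right]
    exact ⟨hG.left, fun _ => hG.left_lim⟩
  obtain ⟨fp, hfp1, hfp2, hfp3, hfp4⟩ := exists_contDiff_version measurableSet_Ioi
    (fun y hy => Eventually.of_forall fun t ht => by
      rw [uIoc_of_le (le_of_lt hy)] at ht; exact ht.1) hcR
    (fun y => by
      rcases le_or_gt y 0 with hy | hy
      · simpa [max_eq_right hy] using hap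
      · rw [max_eq_left hy.le, Function.update_of_ne hy.ne']
        exact hδ.trans_le (haR y hy))
    (fun y (hy : 0 < y) => by rw [max_eq_left hy.le, Function.update_of_ne hy.ne']) hPc hF hsp.right
  obtain ⟨fm, hfm1, hfm2, hfm3, hfm4⟩ := exists_contDiff_version measurableSet_Iio
    (fun y hy => by
      have h0 : ∀ᵐ t : ℝ, t ≠ 0 := by simp [ae_iff]
      filter_upwards [h0] with t ht0 ht
      rw [uIoc_of_ge (le_of_lt hy)] at ht
      exact lt_of_le_of_ne ht.2 ht0) hcL
    (fun y => by
      rcases le_or_gt 0 y with hy | hy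
      · simpa [min_eq_right hy] using ham
      · rw [min_eq_left hy.le, Function.update_of_ne hy.ne]
        exact hδ.trans_le (haL y hy))
    (fun y (hy : y < 0) => by rw [min_eq_left hy.le, Function.update_of_ne hy.ne]) hPc hF hsp.left
  simp only [max_self, min_self, Function.update_self, hP0] at hfp4 hfm4
  refine ⟨hap, ham, cp, cm, p / ap, p / am, ⟨fp, fm, hfp1.contDiffOn, hfm1.contDiffOn, hfp2, hfm2,
    hfp3, hfm3, ?_, ?_⟩, ?_, ?_⟩
  · exact hfp4.hasDerivWithinAt.derivWithin (uniqueDiffOn_Ici 0 0 self_mem_Ici)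
  · exact hfm4.hasDerivWithinAt.derivWithin (uniqueDiffOn_Iic 0 0 self_mem_Iic)
  · rw [mul_div_cancel₀ _ hap.ne', hpval]
  · rw [mul_div_cancel₀ _ ham.ne', hpval]

/-! ### Squeezing the barrier out of the line -/

/-- Translation on `L²(ℝ)`. -/
def shift (r : ℝ) : L2R →L[ℝ] L2R :=
  (Lp.compMeasurePreservingₗᵢ ℝ (fun x : ℝ => x + r)
    (measurePreserving_add_right volume r)).toContinuousLinearMap

theorem coeFn_shift (r : ℝ) (f : L2R) : shift r f =ᵐ[volume] fun x => f (x + r) :=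
  Lp.coeFn_compMeasurePreserving f (measurePreserving_add_right volume r)

theorem ae_comp_add {p : ℝ → Prop} (h : ∀ᵐ x, p x) (r : ℝ) : ∀ᵐ x, p (x + r) :=
  (measurePreserving_add_right volume r).quasiMeasurePreserving.ae h

theorem inner_shift (r : ℝ) (f g : L2R) :
    inner ℝ (shift r f) g = inner ℝ f (shift (-r) g) := by
  rw [l2_inner, l2_inner, ← integral_add_right_eq_self (fun x => f x * shift (-r) g x) r]
  refine integral_congr_ae ?_
  filter_upwards [coeFn_shift r f, ae_comp_add (coeFn_shift (-r) g) r] with x h1 h2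
  rw [h1, h2, add_neg_cancel_right]

theorem tendsto_shift {r : ℕ → ℝ} (hr : Tendsto r atTop (𝓝 0)) (f : L2R) :
    Tendsto (fun n => shift (r n) f) atTop (𝓝 f) := by
  have hcont : Continuous fun s : ℝ => (⟨fun x => x + s, by fun_prop⟩ : C(ℝ, ℝ)) :=
    ContinuousMap.continuous_of_continuous_uncurry _ (by
      simp only [Function.uncurry_def, ContinuousMap.coe_mk]
      fun_prop)
  have h := Filter.Tendsto.compMeasurePreservingLp (p := 2) (μ := (volume : Measure ℝ))
    (tendsto_const_nhds (x := f)) ((hcont.tendsto 0).comp hr)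
    (fun n => measurePreserving_add_right volume (r n)) (measurePreserving_add_right volume 0)
    (by norm_num)
  have h0 : shift 0 f = f := by
    refine Lp.ext ?_
    filter_upwards [coeFn_shift 0 f] with x hx
    rw [hx, add_zero]
  rw [show 𝓝 f = 𝓝 (shift 0 f) by rw [h0]]
  exact h

/-- Remove `(-ε, ε)` from the line and glue. -/
def squeeze (ε : ℝ) : L2R →L[ℝ] L2R := restrictRight ∘L shift ε + restrictLeft ∘L shift (-ε)

/-- Insert `(-ε, ε)` into the line, extending functions by zero there. -/
def unsqueeze (ε : ℝ) : L2R →L[ℝ] L2R := shift (-ε) ∘L restrictRight + shift ε ∘L restrictLeft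

theorem coeFn_squeeze (ε : ℝ) (f : L2R) :
    ∀ᵐ x, (0 < x → squeeze ε f x = f (x + ε)) ∧ (x < 0 → squeeze ε f x = f (x - ε)) := by
  filter_upwards [Lp.coeFn_add (restrictRight (shift ε f)) (restrictLeft (shift (-ε) f)),
    coeFn_restrictRight (shift ε f), coeFn_restrictLeft (shift (-ε) f), coeFn_shift ε f,
    coeFn_shift (-ε) f] with x h1 h2 h3 h4 h5
  have h : squeeze ε f x = (Ioi 0).indicator (shift ε f) x + (Iio 0).indicator (shift (-ε) f) x := by
    rw [← h2, ← h3]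
    exact h1
  constructor
  · intro hx
    rw [h, indicator_of_mem (mem_Ioi.2 hx), indicator_of_notMem (by simpa using hx.le), h4, add_zero]
  · intro hx
    rw [h, indicator_of_mem (mem_Iio.2 hx), indicator_of_notMem (by simpa using hx.le), h5, zero_add,
      sub_eq_add_neg]

theorem coeFn_unsqueeze {ε : ℝ} (hε : 0 < ε) (f : L2R) :
    ∀ᵐ x, (ε < x → unsqueeze ε f x = f (x - ε)) ∧ (x < -ε → unsqueeze ε f x = f (x + ε)) ∧
      (x ∈ Ioo (-ε) ε → unsqueeze ε f x = 0) := by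
  filter_upwards [Lp.coeFn_add (shift (-ε) (restrictRight f)) (shift ε (restrictLeft f)),
    coeFn_shift (-ε) (restrictRight f), coeFn_shift ε (restrictLeft f),
    ae_comp_add (coeFn_restrictRight f) (-ε), ae_comp_add (coeFn_restrictLeft f) ε]
    with x h1 h2 h3 h4 h5
  have h : unsqueeze ε f x = (Ioi 0).indicator f (x + -ε) + (Iio 0).indicator f (x + ε) := by
    rw [← h4, ← h5, ← h2, ← h3]
    exact h1
  refine ⟨fun hx => ?_, fun hx => ?_, fun hx => ?_⟩
  · rw [h, indicator_of_mem (mem_Ioi.2 (by linarith)), indicator_of_notMem (by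
      simp only [mem_Iio, not_lt]; linarith), add_zero, sub_eq_add_neg]
  · rw [h, indicator_of_mem (mem_Iio.2 (by linarith)), indicator_of_notMem (by
      simp only [mem_Ioi, not_lt]; linarith), zero_add]
  · rw [h, indicator_of_notMem (by simp only [mem_Ioi, not_lt]; linarith [hx.2]),
      indicator_of_notMem (by simp only [mem_Iio, not_lt]; linarith [hx.1]), add_zero]

/-- The two operators are adjoint, so testing the barrier equation with an unsqueezed function
amounts to testing the squeezed equation with the original one. -/
theorem inner_squeeze (ε : ℝ) (f g : L2R) :
    inner ℝ (squeeze ε f) g = inner ℝ f (unsqueeze ε g) := by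
  simp only [squeeze, unsqueeze, add_apply, ContinuousLinearMap.comp_apply, inner_add_left,
    inner_add_right]
  rw [restrictRight, restrictLeft, inner_restrictL2_comm, inner_restrictL2_comm, inner_shift,
    inner_shift, neg_neg]

theorem norm_shift (r : ℝ) (f : L2R) : ‖shift r f‖ = ‖f‖ :=
  LinearIsometry.norm_map _ f

theorem norm_unsqueeze_le (ε : ℝ) (f : L2R) : ‖unsqueeze ε f‖ ≤ 2 * ‖f‖ := by
  rw [two_mul]
  refine (norm_add_le _ _).trans (add_le_add ?_ ?_)
  · exact (norm_shift _ _).le.trans (norm_restrictL2_le _ _)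
  · exact (norm_shift _ _).le.trans (norm_restrictL2_le _ _)

theorem restrictRight_add_restrictLeft (f : L2R) : restrictRight f + restrictLeft f = f := by
  refine Lp.ext ?_
  have h0 : ∀ᵐ x : ℝ, x ≠ 0 := by simp [ae_iff]
  filter_upwards [Lp.coeFn_add (restrictRight f) (restrictLeft f), coeFn_restrictRight f,
    coeFn_restrictLeft f, h0] with x h1 h2 h3 h4
  rw [h1, Pi.add_apply, h2, h3]
  rcases lt_or_gt_of_ne h4 with h | h
  · rw [indicator_of_notMem (by simpa using h.le), indicator_of_mem (mem_Iio.2 h), zero_add]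
  · rw [indicator_of_mem (mem_Ioi.2 h), indicator_of_notMem (by simpa using h.le), add_zero]

theorem tendsto_squeeze {r : ℕ → ℝ} (hr : Tendsto r atTop (𝓝 0)) (f : L2R) :
    Tendsto (fun n => squeeze (r n) f) atTop (𝓝 f) := by
  have h1 := (restrictRight.continuous.tendsto _).comp (tendsto_shift hr f)
  have h2 := (restrictLeft.continuous.tendsto _).comp
    (tendsto_shift (r := fun n => -r n) (by simpa using hr.neg) f)
  have h3 := h1.add h2
  rwa [restrictRight_add_restrictLeft] at h3

theorem tendsto_unsqueeze {r : ℕ → ℝ} (hr : Tendsto r atTop (𝓝 0)) (f : L2R) :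
    Tendsto (fun n => unsqueeze (r n) f) atTop (𝓝 f) := by
  have h1 := tendsto_shift (r := fun n => -r n) (by simpa using hr.neg) (restrictRight f)
  have h2 := tendsto_shift hr (restrictLeft f)
  have h3 := h1.add h2
  rwa [restrictRight_add_restrictLeft] at h3

theorem ae_ne_and_ne (c d : ℝ) : ∀ᵐ x : ℝ, x ≠ c ∧ x ≠ d := by
  have h1 : ∀ᵐ x : ℝ, x ≠ c := by simp [ae_iff]
  have h2 : ∀ᵐ x : ℝ, x ≠ d := by simp [ae_iff]
  exact h1.and h2

theorem unsqueeze_squeeze {ε : ℝ} (hε : 0 < ε) (f : L2R) :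
    ∀ᵐ x, unsqueeze ε (squeeze ε f) x = if x ∈ Ioo (-ε) ε then 0 else f x := by
  filter_upwards [coeFn_unsqueeze hε (squeeze ε f), ae_comp_add (coeFn_squeeze ε f) (-ε),
    ae_comp_add (coeFn_squeeze ε f) ε, ae_ne_and_ne ε (-ε)] with x h1 h2 h3 h4
  split_ifs with hx
  · exact h1.2.2 hx
  · rcases lt_or_gt_of_ne h4.1 with h5 | h5
    · have h6 : x < -ε := lt_of_le_of_ne (not_lt.1 fun h => hx ⟨h, h5⟩) h4.2
      rw [h1.2.1 h6, h3.2 (by linarith), add_sub_cancel_right]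
    · rw [h1.1 h5, sub_eq_add_neg, h2.1 (by linarith), neg_add_cancel_right]

theorem norm_le_of_support_Ioo {ε : ℝ} (hε : 0 < ε) {f : L2R} {M : ℝ} (hM : 0 ≤ M)
    (h0 : ∀ᵐ x, x ∉ Ioo (-ε) ε → f x = 0) (h1 : ∀ᵐ x, x ∈ Ioo (-ε) ε → |f x| ≤ M) :
    ‖f‖ ≤ √(2 * ε) * M := by
  refine le_of_sq_le_sq ?_ (by positivity)
  rw [l2_norm_sq, mul_pow, Real.sq_sqrt (by positivity)]
  have h2 : ∫ x, f x ^ 2 = ∫ x in Ioo (-ε) ε, f x ^ 2 := by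
    rw [← integral_indicator measurableSet_Ioo]
    refine integral_congr_ae ?_
    filter_upwards [h0] with x hx
    by_cases h : x ∈ Ioo (-ε) ε
    · rw [indicator_of_mem h]
    · rw [indicator_of_notMem h, hx h]; simp
  have h3 : ∫ x in Ioo (-ε) ε, f x ^ 2 ≤ ∫ _ in Ioo (-ε) ε, M ^ 2 := by
    refine setIntegral_mono_on_ae (Lp.memLp f).integrable_sq.integrableOn
      (integrableOn_const (by simp)) measurableSet_Ioo ?_
    filter_upwards [h1] with x hx hxI
    exact sq_le_sq' (by linarith [abs_le.1 (hx hxI)]) (abs_le.1 (hx hxI)).2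
  rw [h2]
  refine h3.trans (le_of_eq ?_)
  rw [setIntegral_const, measureReal_def, Real.volume_Ioo, ENNReal.toReal_ofReal (by linarith)]
  simp only [smul_eq_mul]
  ring

/-- Removing the barrier turns the values at `±ε` into boundary values at `0±`; the jump is the
increment across the barrier. -/
theorem isSplitPrim_squeeze {ε : ℝ} {x : L2R × L2R} {c : ℝ} (hc : x.1 =ᵐ[volume] prim c x.2) :
    IsSplitPrim (squeeze ε x.1) (squeeze ε x.2) (prim c x.2 ε) (prim c x.2 (-ε)) where
  right := by
    filter_upwards [coeFn_squeeze ε x.1, ae_comp_add hc ε] with y h1 h2 hy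
    have hy' : 0 < y := hy
    have h3 : ∫ t in (0 : ℝ)..y, squeeze ε x.2 t = ∫ t in ε..(y + ε), x.2 t := by
      have h4 := intervalIntegral.integral_comp_add_right (a := 0) (b := y) (fun t => x.2 t) ε
      rw [zero_add] at h4
      rw [← h4]
      refine intervalIntegral.integral_congr_ae ?_
      filter_upwards [coeFn_squeeze ε x.2] with t ht ht0
      rw [uIoc_of_le hy'.le] at ht0
      exact ht.1 ht0.1
    have h5 : prim (prim c x.2 ε) (squeeze ε x.2) y =
        prim c x.2 ε + ∫ t in (0 : ℝ)..y, squeeze ε x.2 t := rfl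
    rw [h1.1 hy, h2, h5, h3, ← prim_sub_prim (l2_locallyIntegrable x.2) c]
    ring
  left := by
    filter_upwards [coeFn_squeeze ε x.1, ae_comp_add hc (-ε)] with y h1 h2 hy
    have hy' : y < 0 := hy
    have h3 : ∫ t in (0 : ℝ)..y, squeeze ε x.2 t = ∫ t in (-ε)..(y + -ε), x.2 t := by
      have h4 := intervalIntegral.integral_comp_add_right (a := 0) (b := y) (fun t => x.2 t) (-ε)
      rw [zero_add] at h4
      rw [← h4]
      refine intervalIntegral.integral_congr_ae ?_
      filter_upwards [coeFn_squeeze ε x.2, ae_ne_and_ne 0 0] with t ht ht1 ht0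
      rw [uIoc_of_ge hy'.le] at ht0
      rw [ht.2 (lt_of_le_of_ne ht0.2 ht1.1), sub_eq_add_neg]
    have h5 : prim (prim c x.2 (-ε)) (squeeze ε x.2) y =
        prim c x.2 (-ε) + ∫ t in (0 : ℝ)..y, squeeze ε x.2 t := rfl
    rw [h1.2 hy, sub_eq_add_neg, h2, h5, h3, ← prim_sub_prim (l2_locallyIntegrable x.2) c]
    ring

/-! ### The barrier -/

/-- The conductivity `b` in the barrier `(-ε, ε)` is measurable and bounded above and away from
zero. -/
structure IsBarrier (b : ℝ → ℝ) (ε : ℝ) : Prop where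
  pos : 0 < ε
  meas : AEMeasurable b (volume.restrict (Ioo (-ε) ε))
  bdd : ∃ δ C : ℝ, 0 < δ ∧ 0 < C ∧ ∀ᵐ x ∂(volume.restrict (Ioo (-ε) ε)), δ ≤ b x ∧ b x ≤ C

theorem barrierConductivity_of_mem {a b : ℝ → ℝ} {ε x : ℝ} (hx : x ∈ Ioo (-ε) ε) :
    barrierConductivity a b ε x = b x := by
  simp only [barrierConductivity, not_le.2 hx.1, not_le.2 hx.2, if_false]

theorem isCoefficient_barrier {a b : ℝ → ℝ} {ε : ℝ} (ha : IsCoefficient a) (hb : IsBarrier b ε) :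
    IsCoefficient (barrierConductivity a b ε) := by
  have hR : ∀ x ∈ Ici ε, barrierConductivity a b ε x = a (x + -ε) := fun x hx => by
    simp only [barrierConductivity, mem_Ici.1 hx, if_true, sub_eq_add_neg]
  have hL : ∀ x ∈ Iic (-ε), barrierConductivity a b ε x = a (x + ε) := fun x hx => by
    have h1 := mem_Iic.1 hx
    have h2 : ¬ ε ≤ x := by linarith [hb.pos]
    simp only [barrierConductivity, h1, h2, if_true, if_false]
  have hsh : ∀ r, AEMeasurable (fun x => a (x + r)) volume := fun r =>
    ha.meas.comp_quasiMeasurePreserving (measurePreserving_add_right volume r).quasiMeasurePreserving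
  constructor
  · have hu : (univ : Set ℝ) = (Ici ε ∪ Iic (-ε)) ∪ Ioo (-ε) ε := by
      ext x
      simp only [mem_univ, mem_union, mem_Ici, mem_Iic, mem_Ioo, true_iff]
      rcases le_or_gt ε x with h | h
      · exact Or.inl (Or.inl h)
      rcases le_or_gt x (-ε) with h' | h'
      · exact Or.inl (Or.inr h')
      · exact Or.inr ⟨h', h⟩
    rw [← Measure.restrict_univ (μ := (volume : Measure ℝ)), hu, aemeasurable_union_iff,
      aemeasurable_union_iff]
    refine ⟨⟨(hsh (-ε)).restrict.congr ?_, (hsh ε).restrict.congr ?_⟩, hb.meas.congr ?_⟩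
    · filter_upwards [ae_restrict_mem measurableSet_Ici] with x hx using (hR x hx).symm
    · filter_upwards [ae_restrict_mem measurableSet_Iic] with x hx using (hL x hx).symm
    · filter_upwards [ae_restrict_mem measurableSet_Ioo] with x hx
      exact (barrierConductivity_of_mem hx).symm
  · obtain ⟨δ, C, hδ, hC, h⟩ := ha.bdd
    obtain ⟨δ', C', hδ', hC', h'⟩ := hb.bdd
    refine ⟨min δ δ', max C C', lt_min hδ hδ', lt_max_of_lt_left hC, ?_⟩
    filter_upwards [ae_comp_add h (-ε), ae_comp_add h ε,
      (ae_restrict_iff' measurableSet_Ioo).1 h'] with x h1 h2 h3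
    rcases le_or_gt ε x with hx | hx
    · rw [hR x hx]
      exact ⟨(min_le_left _ _).trans h1.1, h1.2.trans (le_max_left _ _)⟩
    rcases le_or_gt x (-ε) with hx' | hx'
    · rw [hL x hx']
      exact ⟨(min_le_left _ _).trans h2.1, h2.2.trans (le_max_left _ _)⟩
    · rw [barrierConductivity_of_mem ⟨hx', hx⟩]
      exact ⟨(min_le_right _ _).trans (h3 ⟨hx', hx⟩).1, (h3 ⟨hx', hx⟩).2.trans (le_max_right _ _)⟩

/-- Outside the barrier the coefficient is `a` pushed outwards by `ε`, which is exactly the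
displacement that `squeeze` undoes. -/
theorem squeeze_mul_barrier {a b : ℝ → ℝ} {ε : ℝ} (ha : IsCoefficient a) (hb : IsBarrier b ε)
    (F : L2R) :
    squeeze ε ((isCoefficient_barrier ha hb).mul F) = ha.mul (squeeze ε F) := by
  refine Lp.ext ?_
  have hε := hb.pos
  have hmul : ∀ᵐ x, (isCoefficient_barrier ha hb).mul F x = barrierConductivity a b ε x * F x :=
    coeFn_mulL2 _ F
  have hmul' : ∀ᵐ x, ha.mul (squeeze ε F) x = a x * squeeze ε F x := coeFn_mulL2 _ _
  filter_upwards [coeFn_squeeze ε ((isCoefficient_barrier ha hb).mul F), coeFn_squeeze ε F,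
    ae_comp_add hmul ε, ae_comp_add hmul (-ε), hmul', ae_ne_and_ne 0 0] with x h1 h2 h3 h4 h5 h6
  rcases lt_or_gt_of_ne h6.1 with h | h
  · rw [h1.2 h, h5, h2.2 h, sub_eq_add_neg, h4]
    have e1 : ¬ ε ≤ x + -ε := by linarith
    have e2 : x + -ε ≤ -ε := by linarith
    simp only [barrierConductivity, e1, e2, if_true, if_false, neg_add_cancel_right]
  · rw [h1.1 h, h5, h2.1 h, h3]
    have e1 : ε ≤ x + ε := by linarith
    simp only [barrierConductivity, e1, if_true, add_sub_cancel_right]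

namespace IsBarrier

variable {b : ℝ → ℝ} {ε : ℝ}

theorem integrableOn_inv (hb : IsBarrier b ε) : IntegrableOn (fun x => 1 / b x) (Ioo (-ε) ε) := by
  obtain ⟨δ, C, hδ, hC, h⟩ := hb.bdd
  refine Integrable.of_bound (hb.meas.const_div 1).aestronglyMeasurable (1 / δ) ?_
  filter_upwards [h] with x hx
  rw [Real.norm_eq_abs, abs_of_pos (one_div_pos.2 (hδ.trans_le hx.1))]
  exact one_div_le_one_div_of_le hδ hx.1

theorem totalResistance_eq (hb : IsBarrier b ε) :
    totalResistance b ε = ∫ x in Ioo (-ε) ε, 1 / b x := by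
  rw [totalResistance, intervalIntegral.integral_of_le (by linarith [hb.pos]),
    integral_Ioc_eq_integral_Ioo]

theorem totalResistance_pos (hb : IsBarrier b ε) : 0 < totalResistance b ε := by
  obtain ⟨δ, C, hδ, hC, h⟩ := hb.bdd
  have hε := hb.pos
  rw [hb.totalResistance_eq]
  have h1 : ∫ _ in Ioo (-ε) ε, 1 / C ≤ ∫ x in Ioo (-ε) ε, 1 / b x := by
    refine integral_mono_ae (integrableOn_const (by simp)) hb.integrableOn_inv ?_
    filter_upwards [h] with x hx
    exact one_div_le_one_div_of_le (hδ.trans_le hx.1) hx.2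
  rw [setIntegral_const, measureReal_def, Real.volume_Ioo, ENNReal.toReal_ofReal (by linarith)]
    at h1
  refine lt_of_lt_of_le ?_ h1
  have : 0 < ε - -ε := by linarith
  simp only [smul_eq_mul]
  positivity

/-- The normalised resistance density of the barrier. -/
theorem memLp_density (hb : IsBarrier b ε) :
    MemLp ((Ioo (-ε) ε).indicator fun x => 1 / (totalResistance b ε * b x)) 2 volume := by
  rw [memLp_indicator_iff_restrict measurableSet_Ioo]
  obtain ⟨δ, C, hδ, hC, h⟩ := hb.bdd
  have hγ := hb.totalResistance_pos
  refine MemLp.of_bound ((hb.meas.const_mul _).const_div 1).aestronglyMeasurable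
    (1 / (totalResistance b ε * δ)) ?_
  filter_upwards [h] with x hx
  have hbx : 0 < b x := hδ.trans_le hx.1
  rw [Real.norm_eq_abs, abs_of_pos (by positivity)]
  exact one_div_le_one_div_of_le (by positivity) (by gcongr; exact hx.1)

/-- The normalised resistance density of the barrier, as an element of `L²(ℝ)`. -/
def density (hb : IsBarrier b ε) : L2R := hb.memLp_density.toLp

theorem coeFn_density (hb : IsBarrier b ε) : hb.density =ᵐ[volume]
    (Ioo (-ε) ε).indicator fun x => 1 / (totalResistance b ε * b x) :=
  MemLp.coeFn_toLp _

theorem density_nonneg (hb : IsBarrier b ε) : ∀ᵐ x, 0 ≤ hb.density x := by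
  obtain ⟨δ, C, hδ, hC, h⟩ := hb.bdd
  filter_upwards [hb.coeFn_density, (ae_restrict_iff' measurableSet_Ioo).1 h] with x h1 h2
  rw [h1]
  by_cases hx : x ∈ Ioo (-ε) ε
  · rw [indicator_of_mem hx]
    have hbx : 0 < b x := hδ.trans_le (h2 hx).1
    have hγ := hb.totalResistance_pos
    positivity
  · rw [indicator_of_notMem hx]

theorem integral_density (hb : IsBarrier b ε) : ∫ x in (-ε)..ε, hb.density x = 1 := by
  have hγ := hb.totalResistance_pos
  rw [intervalIntegral.integral_of_le (by linarith [hb.pos]), integral_Ioc_eq_integral_Ioo]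
  have h1 : ∫ x in Ioo (-ε) ε, hb.density x =
      ∫ x in Ioo (-ε) ε, (totalResistance b ε)⁻¹ * (1 / b x) := by
    refine setIntegral_congr_ae measurableSet_Ioo ?_
    filter_upwards [hb.coeFn_density] with x hx hxI
    rw [hx, indicator_of_mem hxI, one_div, mul_inv, one_div]
  rw [h1, integral_const_mul, ← hb.totalResistance_eq, inv_mul_cancel₀ hγ.ne']

/-- Every function on the split line lifts to a function on the line with barrier, which
interpolates its jump inside the barrier. -/
theorem exists_lift (hb : IsBarrier b ε) {z : L2R × L2R} (hz : z ∈ splitSobolev) :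
    ∃ s : L2R, ‖s‖ ≤ √(2 * ε) * (2 * (‖z.1‖ + ‖z.2‖)) ∧
      (unsqueeze ε z.1 + s, unsqueeze ε z.2 + jump z • hb.density) ∈ sobolev := by
  have hε := hb.pos
  obtain ⟨cp, cm, hsp⟩ := exists_isSplitPrim hz
  have hJ : jump z = cp - cm := hsp.jump_eq
  set β : L2R := hb.density
  -- The derivative of the lift. As the density has integral `1`, multiplying it by the jump carries
  -- the value from `cm` at `-ε` to `cp` at `ε`.
  set G : L2R := unsqueeze ε z.2 + jump z • β
  have hG : LocallyIntegrable G volume := l2_locallyIntegrable G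
  have hβi := LocallyIntegrable.intervalIntegrable' (l2_locallyIntegrable β)
  have hGae : ∀ᵐ x, G x = unsqueeze ε z.2 x + jump z * β x := by
    filter_upwards [Lp.coeFn_add (unsqueeze ε z.2) (jump z • β), Lp.coeFn_smul (jump z) β]
      with x h1 h2
    rw [h1, Pi.add_apply, h2, Pi.smul_apply, smul_eq_mul]
  have hβ0 : ∀ᵐ x, x ∉ Ioo (-ε) ε → β x = 0 := by
    filter_upwards [hb.coeFn_density] with x hx hxI
    rw [hx, indicator_of_notMem hxI]
  -- Primitives are normalised at `0`, in the middle of the barrier; this constant makes the value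
  -- at `-ε` equal to `cm`.
  set c := cm + jump z * ∫ t in (-ε)..0, β t
  set Φ := prim c G
  have hin : ∀ x ∈ Icc (-ε) ε, Φ x = cm + jump z * ∫ t in (-ε)..x, β t := by
    intro x hx
    have h1 : ∫ t in (0 : ℝ)..x, G t = jump z * ∫ t in (0 : ℝ)..x, β t := by
      rw [← intervalIntegral.integral_const_mul]
      refine intervalIntegral.integral_congr_ae ?_
      filter_upwards [hGae, coeFn_unsqueeze hε z.2, ae_ne_and_ne (-ε) ε] with t h1 h2 h3 ht
      have ht' : t ∈ Ioo (-ε) ε := by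
        have h4 := uIoc_subset_uIcc ht
        have h5 : uIcc 0 x ⊆ Icc (-ε) ε :=
          (ordConnected_Icc).uIcc_subset ⟨by linarith, hε.le⟩ hx
        exact ⟨lt_of_le_of_ne (h5 h4).1 h3.1.symm, lt_of_le_of_ne (h5 h4).2 h3.2⟩
      rw [h1, h2.2.2 ht', zero_add]
    simp only [Φ, prim, c]
    rw [h1, ← intervalIntegral.integral_add_adjacent_intervals (hβi (-ε) 0) (hβi 0 x)]
    ring
  have hright : ∀ x, ε < x → Φ x = prim cp z.2 (x - ε) := by
    intro x hx
    have h1 := prim_sub_prim hG c ε x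
    have h2 : ∫ t in ε..x, G t = ∫ t in (0 : ℝ)..(x - ε), z.2 t := by
      have h3 := intervalIntegral.integral_comp_sub_right (a := ε) (b := x) (fun t => z.2 t) ε
      rw [sub_self] at h3
      rw [← h3]
      refine intervalIntegral.integral_congr_ae ?_
      filter_upwards [hGae, coeFn_unsqueeze hε z.2, hβ0] with t h1 h2 h3 ht
      rw [uIoc_of_le hx.le] at ht
      rw [h1, h2.1 ht.1, h3 (fun h => absurd h.2 (not_lt.2 ht.1.le)), mul_zero, add_zero]
    have h4 : Φ ε = cp := by
      rw [hin ε ⟨by linarith, le_rfl⟩, hb.integral_density, hJ]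
      ring
    rw [prim, ← h2, ← h1]
    change Φ x = cp + (Φ x - Φ ε)
    rw [h4]
    ring
  have hleft : ∀ x, x < -ε → Φ x = prim cm z.2 (x + ε) := by
    intro x hx
    have h1 := prim_sub_prim hG c (-ε) x
    have h2 : ∫ t in (-ε)..x, G t = ∫ t in (0 : ℝ)..(x + ε), z.2 t := by
      have h3 := intervalIntegral.integral_comp_add_right (a := -ε) (b := x) (fun t => z.2 t) ε
      rw [neg_add_cancel] at h3
      rw [← h3]
      refine intervalIntegral.integral_congr_ae ?_
      filter_upwards [hGae, coeFn_unsqueeze hε z.2, hβ0, ae_ne_and_ne (-ε) (-ε)]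
        with t h1 h2 h3 h5 ht
      rw [uIoc_of_ge hx.le] at ht
      have ht' : t < -ε := lt_of_le_of_ne ht.2 h5.1
      rw [h1, h2.2.1 ht', h3 (fun h => absurd h.1 (not_lt.2 ht'.le)), mul_zero, add_zero]
    have h4 : Φ (-ε) = cm := by
      rw [hin (-ε) ⟨le_rfl, by linarith⟩, intervalIntegral.integral_same, mul_zero, add_zero]
    rw [prim, ← h2, ← h1]
    change Φ x = cm + (Φ x - Φ (-ε))
    rw [h4]
    ring
  have hbd : ∀ x ∈ Ioo (-ε) ε, |Φ x| ≤ |cp| + |cm| := by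
    intro x hx
    have h0 : 0 ≤ ∫ t in (-ε)..x, β t :=
      intervalIntegral.integral_nonneg_of_ae_restrict hx.1.le (ae_restrict_of_ae hb.density_nonneg)
    have h1 : ∫ t in (-ε)..x, β t ≤ 1 := by
      rw [← hb.integral_density]
      exact intervalIntegral.integral_mono_interval le_rfl hx.1.le hx.2.le
        (ae_restrict_of_ae hb.density_nonneg) (hβi _ _)
    rw [hin x ⟨hx.1.le, hx.2.le⟩, hJ]
    set θ := ∫ t in (-ε)..x, β t
    have h2 : cm + (cp - cm) * θ = θ * cp + (1 - θ) * cm := by ring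
    rw [h2]
    refine (abs_add_le _ _).trans ?_
    -- Inside the barrier the lift is a convex combination of `cp` and `cm`, because the density is
    -- nonnegative with integral `1`. The bound is therefore independent of `b`.
    rw [abs_mul, abs_mul, abs_of_nonneg h0, abs_of_nonneg (sub_nonneg.2 h1)]
    nlinarith [abs_nonneg cp, abs_nonneg cm]
  have hsmem : MemLp ((Ioo (-ε) ε).indicator Φ) 2 volume := by
    rw [memLp_indicator_iff_restrict measurableSet_Ioo]
    refine MemLp.of_bound (continuous_prim hG c).aestronglyMeasurable (|cp| + |cm|) ?_
    filter_upwards [ae_restrict_mem measurableSet_Ioo] with x hx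
    exact hbd x hx
  refine ⟨hsmem.toLp, ?_, ?_⟩
  · have hM : |cp| + |cm| ≤ 2 * (‖z.1‖ + ‖z.2‖) := by
      have h1 := hsp.abs_right_le
      have h2 := hsp.abs_left_le
      linarith
    refine norm_le_of_support_Ioo hε (by positivity) ?_ ?_
    · filter_upwards [hsmem.coeFn_toLp] with x hx hxI
      rw [hx, indicator_of_notMem hxI]
    · filter_upwards [hsmem.coeFn_toLp] with x hx hxI
      rw [hx, indicator_of_mem hxI]
      exact (hbd x hxI).trans hM
  · refine mem_sobolev_of_ae_eq_prim (c := c) ?_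
    filter_upwards [Lp.coeFn_add (unsqueeze ε z.1) hsmem.toLp, hsmem.coeFn_toLp,
      coeFn_unsqueeze hε z.1, ae_comp_add hsp.right (-ε), ae_comp_add hsp.left ε,
      ae_ne_and_ne ε (-ε)] with x h1 h2 h3 h4 h5 h6
    rw [h1, Pi.add_apply, h2]
    change _ = Φ x
    by_cases hxI : x ∈ Ioo (-ε) ε
    · rw [indicator_of_mem hxI, h3.2.2 hxI, zero_add]
    rw [indicator_of_notMem hxI, add_zero]
    rcases lt_or_gt_of_ne h6.1 with h7 | h7
    · have h8 : x < -ε := lt_of_le_of_ne (not_lt.1 fun h => hxI ⟨h, h7⟩) h6.2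
      rw [h3.2.1 h8, hleft x h8, h5 (mem_Iio.2 (by linarith))]
    · rw [h3.1 h7, hright x h7, sub_eq_add_neg, h4 (mem_Ioi.2 (by linarith))]

variable {a : ℝ → ℝ}

/-- The density is `1/(γ b)`, so multiplication by `b` leaves the constant `1/γ` and the pairing
becomes `1/γ` times the increment across the barrier. This is the source of the jump term of the
limit form. -/
theorem inner_mul_density (hb : IsBarrier b ε) (ha : IsCoefficient a) {x : L2R × L2R}
    (hx : x ∈ sobolev) :
    inner ℝ ((isCoefficient_barrier ha hb).mul x.2) hb.density =
      (totalResistance b ε)⁻¹ * jump (squeeze ε x.1, squeeze ε x.2) := by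
  obtain ⟨c, hc⟩ := exists_ae_eq_prim_of_mem_sobolev hx
  rw [(isSplitPrim_squeeze hc).jump_eq, prim_sub_prim (l2_locallyIntegrable x.2),
    intervalIntegral.integral_of_le (by linarith [hb.pos]), integral_Ioc_eq_integral_Ioo,
    ← integral_const_mul, ← integral_indicator measurableSet_Ioo, l2_inner]
  obtain ⟨δ, C, hδ, hC, h⟩ := hb.bdd
  have hmul : ∀ᵐ y, (isCoefficient_barrier ha hb).mul x.2 y =
    barrierConductivity a b ε y * x.2 y := coeFn_mulL2 _ _
  have hγ := hb.totalResistance_pos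
  refine integral_congr_ae ?_
  filter_upwards [hb.coeFn_density, hmul, (ae_restrict_iff' measurableSet_Ioo).1 h]
    with y h1 h2 h3
  rw [h1, h2]
  by_cases hy : y ∈ Ioo (-ε) ε
  · have hby : 0 < b y := hδ.trans_le (h3 hy).1
    rw [indicator_of_mem hy, indicator_of_mem hy, barrierConductivity_of_mem hy]
    field_simp
  · rw [indicator_of_notMem hy, indicator_of_notMem hy, mul_zero]

theorem squeeze_mem_splitSobolev {x : L2R × L2R} (hx : x ∈ sobolev) :
    (squeeze ε x.1, squeeze ε x.2) ∈ splitSobolev := by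
  obtain ⟨c, hc⟩ := exists_ae_eq_prim_of_mem_sobolev hx
  exact (isSplitPrim_squeeze hc).mem_splitSobolev

/-- The squeezed solution of the resolvent equation with barrier almost solves the resolvent
equation with a semi-permeable membrane. -/
theorem abs_squeeze_resolvent_le (hb : IsBarrier b ε) (ha : IsCoefficient a) {x : L2R × L2R}
    (hx : x ∈ sobolev) {h : L2R}
    (hres : ∀ y ∈ sobolev, inner ℝ x.1 y.1
      + 1 / 2 * inner ℝ ((isCoefficient_barrier ha hb).mul x.2) y.2 = inner ℝ h y.1)
    {z : L2R × L2R} (hz : z ∈ splitSobolev) :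
    |inner ℝ (squeeze ε x.1) z.1 + 1 / 2 * inner ℝ (ha.mul (squeeze ε x.2)) z.2
      + (2 * totalResistance b ε)⁻¹ * (jump (squeeze ε x.1, squeeze ε x.2) * jump z)
      - inner ℝ h z.1| ≤
      (‖squeeze ε h - h‖ + 2 * √(2 * ε) * ‖h - x.1‖) * (‖z.1‖ + ‖z.2‖) := by
  -- The equation is tested with the lift of `z`. The density yields the jump term, adjointness
  -- handles the exterior, and the errors are `squeeze ε h - h` and the pairing of `h - x.1` with
  -- the small interior part `s`.
  obtain ⟨s, hs, hmem⟩ := hb.exists_lift hz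
  have h1 := hres _ hmem
  simp only [inner_add_right, inner_smul_right] at h1
  rw [hb.inner_mul_density ha hx, ← inner_squeeze, ← inner_squeeze, ← inner_squeeze,
    squeeze_mul_barrier ha hb] at h1
  have h2 : inner ℝ (squeeze ε x.1) z.1 + 1 / 2 * inner ℝ (ha.mul (squeeze ε x.2)) z.2
      + (2 * totalResistance b ε)⁻¹ * (jump (squeeze ε x.1, squeeze ε x.2) * jump z)
      - inner ℝ h z.1 = inner ℝ (squeeze ε h - h) z.1 + inner ℝ (h - x.1) s := by
    rw [inner_sub_left, inner_sub_left, mul_inv]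
    linarith
  rw [h2]
  refine (abs_add_le _ _).trans ?_
  have h3 := abs_real_inner_le_norm (squeeze ε h - h) z.1
  have h4 := abs_real_inner_le_norm (h - x.1) s
  have h5 : ‖h - x.1‖ * ‖s‖ ≤ ‖h - x.1‖ * (√(2 * ε) * (2 * (‖z.1‖ + ‖z.2‖))) := by gcongr
  have h6 : ‖squeeze ε h - h‖ * ‖z.1‖ ≤ ‖squeeze ε h - h‖ * (‖z.1‖ + ‖z.2‖) := by
    gcongr
    linarith [norm_nonneg z.2]
  linarith

/-- The difference is `x` inside the barrier. There `|x(t)| ≤ |x(ε)| + ∫|x'|`, and Cauchy–Schwarz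
for `|x'| = b^{-1/2} · b^{1/2}|x'|` bounds the integral by `√γ` times the square root of the energy.
The factor `√(2ε)` comes from the length of the barrier. -/
theorem norm_sub_unsqueeze_le (hb : IsBarrier b ε) (ha : IsCoefficient a) {x : L2R × L2R}
    (hx : x ∈ sobolev) :
    ‖x.1 - unsqueeze ε (squeeze ε x.1)‖ ≤ √(2 * ε) * (‖squeeze ε x.1‖ + ‖squeeze ε x.2‖
      + √(totalResistance b ε) * √(inner ℝ ((isCoefficient_barrier ha hb).mul x.2) x.2)) := by
  have hε := hb.pos
  obtain ⟨c, hc⟩ := exists_ae_eq_prim_of_mem_sobolev hx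
  have hsp := isSplitPrim_squeeze (ε := ε) hc
  obtain ⟨δ, C, hδ, hC, hbd⟩ := hb.bdd
  have hbd' := (ae_restrict_iff' measurableSet_Ioo).1 hbd
  have hmul : ∀ᵐ y, (isCoefficient_barrier ha hb).mul x.2 y =
    barrierConductivity a b ε y * x.2 y := coeFn_mulL2 _ _
  have hFI : ∫ t in Ioo (-ε) ε, |x.2 t| ≤
      √(totalResistance b ε) * √(inner ℝ ((isCoefficient_barrier ha hb).mul x.2) x.2) := by
    have hu : MemLp (fun t => √(1 / b t)) 2 (volume.restrict (Ioo (-ε) ε)) := by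
      rw [memLp_two_iff_integrable_sq (hb.meas.const_div 1).sqrt.aestronglyMeasurable]
      refine hb.integrableOn_inv.congr ?_
      filter_upwards [hbd] with t ht
      rw [Real.sq_sqrt (one_div_nonneg.2 (hδ.le.trans ht.1))]
    have hv : MemLp (fun t => √(b t) * x.2 t) 2 (volume.restrict (Ioo (-ε) ε)) := by
      refine ((Lp.memLp x.2).restrict _).of_le_mul (c := √C)
        (hb.meas.sqrt.aestronglyMeasurable.mul (Lp.aestronglyMeasurable x.2).restrict) ?_
      filter_upwards [hbd] with t ht
      rw [norm_mul, Real.norm_eq_abs, abs_of_nonneg (Real.sqrt_nonneg _)]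
      gcongr
      exact ht.2
    have h1 := integral_abs_mul_le hu hv
    have e1 : ∫ t in Ioo (-ε) ε, |√(1 / b t) * (√(b t) * x.2 t)| = ∫ t in Ioo (-ε) ε, |x.2 t| := by
      refine integral_congr_ae ?_
      filter_upwards [hbd] with t ht
      have hbt : 0 < b t := hδ.trans_le ht.1
      rw [← mul_assoc, ← Real.sqrt_mul (by positivity), one_div_mul_cancel hbt.ne', Real.sqrt_one,
        one_mul]
    have e2 : ∫ t in Ioo (-ε) ε, √(1 / b t) ^ 2 = totalResistance b ε := by
      rw [hb.totalResistance_eq]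
      refine integral_congr_ae ?_
      filter_upwards [hbd] with t ht
      rw [Real.sq_sqrt (one_div_nonneg.2 (hδ.le.trans ht.1))]
    have e3 : ∫ t in Ioo (-ε) ε, (√(b t) * x.2 t) ^ 2 ≤
        inner ℝ ((isCoefficient_barrier ha hb).mul x.2) x.2 := by
      have e4 : ∫ t in Ioo (-ε) ε, (√(b t) * x.2 t) ^ 2 =
          ∫ t in Ioo (-ε) ε, (isCoefficient_barrier ha hb).mul x.2 t * x.2 t := by
        refine setIntegral_congr_ae measurableSet_Ioo ?_
        filter_upwards [hbd', hmul] with t ht h2 htI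
        rw [h2, barrierConductivity_of_mem htI, mul_pow, Real.sq_sqrt (hδ.le.trans (ht htI).1)]
        ring
      rw [e4, l2_inner]
      refine setIntegral_le_integral (l2_integrable_mul _ _) ?_
      obtain ⟨δ', C', hδ', -, hcb⟩ := (isCoefficient_barrier ha hb).bdd
      filter_upwards [hmul, hcb] with t ht h2
      rw [ht, mul_assoc]
      exact mul_nonneg (hδ'.le.trans h2.1) (mul_self_nonneg _)
    rw [e1, e2] at h1
    exact h1.trans (mul_le_mul_of_nonneg_left (Real.sqrt_le_sqrt e3) (Real.sqrt_nonneg _))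
  have hFint : IntegrableOn (fun t => |x.2 t|) (Ioo (-ε) ε) := by
    have : IsFiniteMeasure (volume.restrict (Ioo (-ε) ε)) := ⟨by simp⟩
    exact (((Lp.memLp x.2).restrict _).integrable (by norm_num)).abs
  refine norm_le_of_support_Ioo hε (by positivity) ?_ ?_
  · filter_upwards [Lp.coeFn_sub x.1 (unsqueeze ε (squeeze ε x.1)), unsqueeze_squeeze hε x.1]
      with t h1 h2 ht
    rw [h1, Pi.sub_apply, h2, if_neg ht, sub_self]
  · filter_upwards [Lp.coeFn_sub x.1 (unsqueeze ε (squeeze ε x.1)), unsqueeze_squeeze hε x.1, hc]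
      with t h1 h2 h3 ht
    rw [h1, Pi.sub_apply, h2, if_pos ht, sub_zero, h3]
    have h4 := prim_sub_prim (l2_locallyIntegrable x.2) c ε t
    have h5 : |∫ r in ε..t, x.2 r| ≤ ∫ r in Ioo (-ε) ε, |x.2 r| := by
      refine (intervalIntegral.norm_integral_le_integral_norm_uIoc (f := x.2)).trans ?_
      rw [uIoc_of_ge ht.2.le, integral_Ioc_eq_integral_Ioo]
      exact setIntegral_mono_set hFint (Eventually.of_forall fun _ => abs_nonneg _)
        (Ioo_subset_Ioo_left ht.1.le).eventuallyLE
    have h6 := hsp.abs_right_le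
    have h7 : prim c x.2 t = prim c x.2 ε + ∫ r in ε..t, x.2 r := by linarith
    rw [h7]
    exact (abs_add_le _ _).trans (add_le_add h6 (h5.trans hFI))

end IsBarrier

/-! ### Convergence of the resolvents as the barrier disappears -/

theorem tendsto_zero_of_sq_le {D η r : ℕ → ℝ} {c : ℝ} (hc : 0 < c) (hD : ∀ n, 0 ≤ D n)
    (h : ∀ n, c * D n ^ 2 ≤ η n * D n + r n) (hη : Tendsto η atTop (𝓝 0))
    (hr : Tendsto r atTop (𝓝 0)) : Tendsto D atTop (𝓝 0) := by
  have h1 : ∀ n, D n ^ 2 ≤ 2 / c * (η n ^ 2 / (2 * c) + r n) := by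
    intro n
    have h2 : η n * D n ≤ c * D n ^ 2 / 2 + η n ^ 2 / (2 * c) := by
      have h3 : c * D n ^ 2 / 2 + η n ^ 2 / (2 * c) - η n * D n
          = (c * D n - η n) ^ 2 / (2 * c) := by
        field_simp
        ring
      have h4 : 0 ≤ (c * D n - η n) ^ 2 / (2 * c) := by positivity
      linarith
    rw [div_mul_eq_mul_div, le_div_iff₀ hc]
    linarith [h n]
  have h2 : Tendsto (fun n => √(2 / c * (η n ^ 2 / (2 * c) + r n))) atTop (𝓝 0) := by
    have h3 := ((((hη.pow 2).div_const (2 * c)).add hr).const_mul (2 / c)).sqrt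
    simpa using h3
  refine squeeze_zero hD (fun n => ?_) h2
  rw [← Real.sqrt_sq (hD n)]
  exact Real.sqrt_le_sqrt (h1 n)

theorem abs_jump_le {x : L2R × L2R} (hx : x ∈ splitSobolev) :
    |jump x| ≤ 2 * (‖x.1‖ + ‖x.2‖) := by
  obtain ⟨cp, cm, h⟩ := exists_isSplitPrim hx
  have h1 : jump x = cp - cm := h.jump_eq
  rw [h1]
  have h2 := h.abs_right_le
  have h3 := h.abs_left_le
  linarith [abs_sub cp cm]

theorem exists_jump_eq_one : ∃ e ∈ splitSobolev, jump e = 1 :=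
  ⟨_, isTestFunction_bump.restrict_mem_splitSobolev, by
    rw [isTestFunction_bump.jump_restrict, bump_zero]⟩

namespace IsCoefficient

variable {a : ℝ → ℝ}

/-- Energy estimate for the difference of an approximate solution `w` and the solution `x` of a
resolvent equation, where the solution has boundary flux `l`. -/
theorem sq_le_of_approx (ha : IsCoefficient a) : ∃ c₀ : ℝ, 0 < c₀ ∧
    ∀ (h : L2R) (w x : L2R × L2R) (k η l : ℝ), w ∈ splitSobolev → x ∈ splitSobolev →
      (∀ z ∈ splitSobolev, |inner ℝ w.1 z.1 + 1 / 2 * inner ℝ (ha.mul w.2) z.2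
        + k * (jump w * jump z) - inner ℝ h z.1| ≤ η * (‖z.1‖ + ‖z.2‖)) →
      (∀ z ∈ splitSobolev, inner ℝ x.1 z.1 + 1 / 2 * inner ℝ (ha.mul x.2) z.2
        - inner ℝ h z.1 = l * jump z) →
      c₀ * (‖(w - x).1‖ + ‖(w - x).2‖) ^ 2 ≤ η * (‖(w - x).1‖ + ‖(w - x).2‖)
        - (k * jump w + l) * jump (w - x) := by
  obtain ⟨δ, C, hδ, hC, hb⟩ := ha.bdd
  -- The extra division by `2` accounts for `(p + q)² ≤ 2(p² + q²)`.
  refine ⟨min 1 (δ / 2) / 2, by positivity, fun h w x k η l hw hx hwz hxz => ?_⟩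
  have hd := splitSobolev.sub_mem hw hx
  have h1 := (le_abs_self _).trans (hwz _ hd)
  have h2 := hxz _ hd
  have h3 := ha.le_inner_mul (hb.mono fun y hy => hy.1) (w - x).2
  have h4 : inner ℝ (w - x).1 (w - x).1 = ‖(w - x).1‖ ^ 2 := real_inner_self_eq_norm_sq _
  set d := w - x
  have h5 : inner ℝ d.1 d.1 = inner ℝ w.1 d.1 - inner ℝ x.1 d.1 := by
    rw [← inner_sub_left]; rfl
  have h6 : inner ℝ (ha.mul d.2) d.2 = inner ℝ (ha.mul w.2) d.2 - inner ℝ (ha.mul x.2) d.2 := by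
    rw [← inner_sub_left, ← map_sub]; rfl
  have hm1 : min 1 (δ / 2) ≤ 1 := min_le_left _ _
  have hm2 : min 1 (δ / 2) ≤ δ / 2 := min_le_right _ _
  have hm0 : 0 ≤ min 1 (δ / 2) := by positivity
  set m := min 1 (δ / 2)
  have h7 : m / 2 * (‖d.1‖ + ‖d.2‖) ^ 2 ≤ m * ‖d.1‖ ^ 2 + m * ‖d.2‖ ^ 2 := by
    nlinarith [mul_nonneg hm0 (sq_nonneg (‖d.1‖ - ‖d.2‖))]
  have h8 : m * ‖d.1‖ ^ 2 ≤ 1 * ‖d.1‖ ^ 2 := by gcongr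
  have h9 : m * ‖d.2‖ ^ 2 ≤ δ / 2 * ‖d.2‖ ^ 2 := by gcongr
  nlinarith

theorem tendsto_of_norm_sum {w : ℕ → L2R × L2R} {x : L2R × L2R}
    (h : Tendsto (fun n => ‖(w n - x).1‖ + ‖(w n - x).2‖) atTop (𝓝 0)) :
    Tendsto w atTop (𝓝 x) := by
  rw [tendsto_iff_norm_sub_tendsto_zero]
  refine squeeze_zero (fun n => norm_nonneg _) (fun n => ?_) h
  exact max_le (le_add_of_nonneg_right (norm_nonneg _)) (le_add_of_nonneg_left (norm_nonneg _))

/-- In the energy estimate for `w n - x` the term `κ n J²` has a good sign. What remains, `(κ n -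
k)[x]J`, is a vanishing multiple of the norm because the jump is bounded by it. -/
theorem tendsto_of_approx (ha : IsCoefficient a) {h : L2R} {w : ℕ → L2R × L2R} {x : L2R × L2R}
    {κ η : ℕ → ℝ} {k : ℝ} (hκ0 : ∀ n, 0 ≤ κ n) (hκ : Tendsto κ atTop (𝓝 k))
    (hη : Tendsto η atTop (𝓝 0)) (hw : ∀ n, w n ∈ splitSobolev)
    (hwz : ∀ n, ∀ z ∈ splitSobolev, |inner ℝ (w n).1 z.1 + 1 / 2 * inner ℝ (ha.mul (w n).2) z.2
        + κ n * (jump (w n) * jump z) - inner ℝ h z.1| ≤ η n * (‖z.1‖ + ‖z.2‖))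
    (hx : x ∈ splitSobolev)
    (hres : ∀ z ∈ splitSobolev, inner ℝ x.1 z.1 + 1 / 2 * inner ℝ (ha.mul x.2) z.2
        + k * (jump x * jump z) = inner ℝ h z.1) : Tendsto w atTop (𝓝 x) := by
  obtain ⟨c₀, hc₀, H⟩ := ha.sq_le_of_approx
  refine tendsto_of_norm_sum (tendsto_zero_of_sq_le (r := fun _ => 0)
    (η := fun n => η n + 2 * (|κ n - k| * |jump x|)) hc₀ (fun n => by positivity) (fun n => ?_) ?_
    tendsto_const_nhds)
  · have h1 := H h (w n) x (κ n) (η n) (-(k * jump x)) (hw n) hx (hwz n) fun z hz => by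
      linarith [hres z hz]
    have h2 := abs_jump_le (splitSobolev.sub_mem (hw n) hx)
    have h3 : jump (w n) = jump (w n - x) + jump x := by rw [map_sub]; ring
    rw [h3] at h1
    set D := ‖(w n - x).1‖ + ‖(w n - x).2‖
    set J := jump (w n - x)
    have h4 : -((κ n - k) * jump x * J) ≤ |κ n - k| * |jump x| * (2 * D) := by
      refine (neg_le_abs _).trans ?_
      rw [abs_mul, abs_mul]
      gcongr
    have h5 : 0 ≤ κ n * J ^ 2 := mul_nonneg (hκ0 n) (sq_nonneg J)
    nlinarith
  · have h1 : Tendsto (fun n => |κ n - k|) atTop (𝓝 0) := by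
      simpa using (hκ.sub_const k).abs
    simpa using hη.add ((h1.mul_const |jump x|).const_mul 2)

/-- The limit solves its equation only against functions without jump; against all of `splitSobolev`
there is an additional multiple `l` of the jump, the flux through the origin. Completing the square
gives `-(κJ + l)J ≤ l²/(4κ)`, which vanishes as `κ → ∞`. -/
theorem tendsto_of_approx_atTop (ha : IsCoefficient a) {h : L2R} {w : ℕ → L2R × L2R}
    {x : L2R × L2R} {κ η : ℕ → ℝ} (hκ0 : ∀ n, 0 < κ n)
    (hκ : Tendsto (fun n => (κ n)⁻¹) atTop (𝓝 0))
    (hη : Tendsto η atTop (𝓝 0)) (hw : ∀ n, w n ∈ splitSobolev)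
    (hwz : ∀ n, ∀ z ∈ splitSobolev, |inner ℝ (w n).1 z.1 + 1 / 2 * inner ℝ (ha.mul (w n).2) z.2
        + κ n * (jump (w n) * jump z) - inner ℝ h z.1| ≤ η n * (‖z.1‖ + ‖z.2‖))
    (hx : x ∈ sobolev)
    (hres : ∀ z ∈ sobolev, inner ℝ x.1 z.1 + 1 / 2 * inner ℝ (ha.mul x.2) z.2 = inner ℝ h z.1) :
    Tendsto w atTop (𝓝 x) := by
  obtain ⟨c₀, hc₀, H⟩ := ha.sq_le_of_approx
  obtain ⟨e, he, hje⟩ := exists_jump_eq_one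
  set l := inner ℝ x.1 e.1 + 1 / 2 * inner ℝ (ha.mul x.2) e.2 - inner ℝ h e.1 with hl
  have hflux : ∀ z ∈ splitSobolev, inner ℝ x.1 z.1 + 1 / 2 * inner ℝ (ha.mul x.2) z.2
        - inner ℝ h z.1 = l * jump z := by
    intro z hz
    have hmem : z - jump z • e ∈ sobolev := by
      refine mem_sobolev_of_jump_eq_zero
        (splitSobolev.sub_mem hz (splitSobolev.smul_mem _ he)) ?_
      rw [map_sub, map_smul, hje, smul_eq_mul, mul_one, sub_self]
    have h1 := hres _ hmem
    simp only [Prod.fst_sub, Prod.snd_sub, Prod.smul_fst, Prod.smul_snd, inner_sub_right,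
      inner_smul_right] at h1
    rw [hl]
    linarith
  have hx' := sobolev_le_splitSobolev hx
  refine tendsto_of_norm_sum (tendsto_zero_of_sq_le (r := fun n => l ^ 2 / 4 * (κ n)⁻¹)
    (η := η) hc₀ (fun n => by positivity) (fun n => ?_) hη ?_)
  · have h1 := H h (w n) x (κ n) (η n) l (hw n) hx' (hwz n) hflux
    have h3 : jump (w n) = jump (w n - x) := by
      rw [map_sub, jump_eq_zero_of_mem_sobolev hx, sub_zero]
    rw [h3] at h1
    set J := jump (w n - x)
    have h4 : l ^ 2 / 4 * (κ n)⁻¹ + (κ n * J + l) * J = (κ n * J + l / 2) ^ 2 * (κ n)⁻¹ := by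
      have := (hκ0 n).ne'
      field_simp
      ring
    have h5 : 0 ≤ (κ n * J + l / 2) ^ 2 * (κ n)⁻¹ :=
      mul_nonneg (sq_nonneg _) (inv_nonneg.2 (hκ0 n).le)
    linarith
  · simpa using hκ.const_mul (l ^ 2 / 4)

/-- The resolvent equation. -/
theorem resolvent_equation (ha : IsCoefficient a) {k : ℝ} (hk : 0 ≤ k)
    {W : Submodule ℝ (L2R × L2R)} [CompleteSpace W] (hW : W ≤ splitSobolev) (h : L2R)
    {y : L2R × L2R} (hy : y ∈ W) :
    inner ℝ ((ha.isClosedForm hk hW).resolvent h : L2R × L2R).1 y.1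
      + 1 / 2 * inner ℝ (ha.mul ((ha.isClosedForm hk hW).resolvent h : L2R × L2R).2) y.2
      + k * (jump ((ha.isClosedForm hk hW).resolvent h : L2R × L2R) * jump y)
      = inner ℝ h y.1 := by
  rw [← ha.inner_formMap hk]
  exact (ha.isClosedForm hk hW).inner_resolvent h ⟨y, hy⟩

/-- The resolvent equation in the Sobolev space of the line. -/
theorem resolvent_equation_sobolev (ha : IsCoefficient a) {k : ℝ} (hk : 0 ≤ k) (h : L2R)
    {y : L2R × L2R} (hy : y ∈ sobolev) :
    inner ℝ ((ha.isClosedForm hk sobolev_le_splitSobolev).resolvent h : L2R × L2R).1 y.1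
      + 1 / 2 * inner ℝ (ha.mul
        ((ha.isClosedForm hk sobolev_le_splitSobolev).resolvent h : L2R × L2R).2) y.2
      = inner ℝ h y.1 := by
  have h1 := ha.resolvent_equation hk sobolev_le_splitSobolev h hy
  rwa [jump_eq_zero_of_mem_sobolev hy, mul_zero, mul_zero, add_zero] at h1

theorem norm_le_of_resolvent_equation (ha : IsCoefficient a) {h : L2R} {x : L2R × L2R}
    (hx : inner ℝ x.1 x.1 + 1 / 2 * inner ℝ (ha.mul x.2) x.2 = inner ℝ h x.1) :
    ‖x.1‖ ≤ ‖h‖ ∧ inner ℝ (ha.mul x.2) x.2 ≤ 2 * ‖h‖ ^ 2 := by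
  rw [real_inner_self_eq_norm_sq] at hx
  have h1 := real_inner_le_norm h x.1
  have h2 := ha.inner_mul_self_nonneg x.2
  have h3 : ‖x.1‖ ≤ ‖h‖ := by
    by_contra! hlt
    nlinarith [norm_nonneg h]
  refine ⟨h3, ?_⟩
  nlinarith [norm_nonneg h, norm_nonneg x.1]

end IsCoefficient

section Barrier

variable {a : ℝ → ℝ} (ha : IsCoefficient a) {b : ℕ → ℝ → ℝ} {ε : ℕ → ℝ}
  (hb : ∀ n, IsBarrier (b n) (ε n))

/-- `x n` is split into its part inside the barrier, the unsqueezed error of the squeezed function,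
and the unsqueezed limit. The energy bound `2‖h‖²` makes the first part of order `√ε + √(εγ)`. -/
theorem tendsto_of_tendsto_squeeze (hε : Tendsto ε atTop (𝓝 0))
    (hγ : Tendsto (fun n => ε n * totalResistance (b n) (ε n)) atTop (𝓝 0)) {h : L2R}
    {x : ℕ → L2R × L2R} {y : L2R × L2R} (hx : ∀ n, x n ∈ sobolev)
    (hres : ∀ n, ∀ z ∈ sobolev, inner ℝ (x n).1 z.1
      + 1 / 2 * inner ℝ ((isCoefficient_barrier ha (hb n)).mul (x n).2) z.2 = inner ℝ h z.1)
    (hy : Tendsto (fun n => (squeeze (ε n) (x n).1, squeeze (ε n) (x n).2)) atTop (𝓝 y)) :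
    Tendsto (fun n => (x n).1) atTop (𝓝 y.1) := by
  have h1 : Tendsto (fun n => squeeze (ε n) (x n).1) atTop (𝓝 y.1) :=
    (continuous_fst.tendsto y).comp hy
  have h2 : Tendsto (fun n => squeeze (ε n) (x n).2) atTop (𝓝 y.2) :=
    (continuous_snd.tendsto y).comp hy
  have hs : Tendsto (fun n => √(2 * ε n)) atTop (𝓝 0) := by
    simpa using (hε.const_mul 2).sqrt
  have h3 : Tendsto (fun n => (x n).1 - unsqueeze (ε n) (squeeze (ε n) (x n).1)) atTop (𝓝 0) := by
    have hb1 : Tendsto (fun n => √(2 * ε n) * (‖squeeze (ε n) (x n).1‖ + ‖squeeze (ε n) (x n).2‖)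
        + √(2 * (ε n * totalResistance (b n) (ε n))) * √(2 * ‖h‖ ^ 2)) atTop (𝓝 0) := by
      have e1 := hs.mul (h1.norm.add h2.norm)
      have e2 := (hγ.const_mul 2).sqrt.mul_const √(2 * ‖h‖ ^ 2)
      simpa using e1.add e2
    refine squeeze_zero_norm (fun n => ?_) hb1
    refine ((hb n).norm_sub_unsqueeze_le ha (hx n)).trans ?_
    have h4 := ((isCoefficient_barrier ha (hb n)).norm_le_of_resolvent_equation
      (hres n _ (hx n))).2
    rw [mul_add, ← mul_assoc, ← mul_assoc 2, Real.sqrt_mul (mul_nonneg two_pos.le (hb n).pos.le)]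
    gcongr
  have h4 : Tendsto (fun n => unsqueeze (ε n) (squeeze (ε n) (x n).1 - y.1)) atTop (𝓝 0) := by
    have e1 : Tendsto (fun n => 2 * ‖squeeze (ε n) (x n).1 - y.1‖) atTop (𝓝 0) := by
      simpa using (tendsto_iff_norm_sub_tendsto_zero.1 h1).const_mul 2
    exact squeeze_zero_norm (fun n => norm_unsqueeze_le _ _) e1
  have h5 := (h3.add h4).add (tendsto_unsqueeze hε y.1)
  simp only [map_sub, zero_add] at h5
  refine h5.congr fun n => ?_
  abel

theorem exists_approx (hε : Tendsto ε atTop (𝓝 0)) {h : L2R}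
    {x : ℕ → L2R × L2R} (hx : ∀ n, x n ∈ sobolev)
    (hres : ∀ n, ∀ z ∈ sobolev, inner ℝ (x n).1 z.1
      + 1 / 2 * inner ℝ ((isCoefficient_barrier ha (hb n)).mul (x n).2) z.2 = inner ℝ h z.1) :
    ∃ η : ℕ → ℝ, Tendsto η atTop (𝓝 0) ∧ ∀ n, ∀ z ∈ splitSobolev,
      |inner ℝ (squeeze (ε n) (x n).1) z.1 + 1 / 2 * inner ℝ (ha.mul (squeeze (ε n) (x n).2)) z.2
        + (2 * totalResistance (b n) (ε n))⁻¹ *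
          (jump (squeeze (ε n) (x n).1, squeeze (ε n) (x n).2) * jump z)
        - inner ℝ h z.1| ≤ η n * (‖z.1‖ + ‖z.2‖) := by
  refine ⟨fun n => ‖squeeze (ε n) h - h‖ + 2 * √(2 * ε n) * (2 * ‖h‖), ?_, fun n z hz => ?_⟩
  · have hs : Tendsto (fun n => √(2 * ε n)) atTop (𝓝 0) := by
      simpa using (hε.const_mul 2).sqrt
    simpa using (tendsto_iff_norm_sub_tendsto_zero.1 (tendsto_squeeze hε h)).add
      ((hs.const_mul 2).mul_const (2 * ‖h‖))
  · refine ((hb n).abs_squeeze_resolvent_le ha (hx n) (hres n) hz).trans ?_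
    have h1 := ((isCoefficient_barrier ha (hb n)).norm_le_of_resolvent_equation
      (hres n _ (hx n))).1
    have h2 : ‖h - (x n).1‖ ≤ 2 * ‖h‖ := (norm_sub_le _ _).trans (by linarith)
    dsimp only
    gcongr

theorem tendsto_resolvent_semipermeable (hε : Tendsto ε atTop (𝓝 0))
    (hγ : Tendsto (fun n => ε n * totalResistance (b n) (ε n)) atTop (𝓝 0)) {k : ℝ} (hk : 0 ≤ k)
    (hlim : Tendsto (fun n => (2 * totalResistance (b n) (ε n))⁻¹) atTop (𝓝 k)) (h : L2R) :
    Tendsto (fun n => (((isCoefficient_barrier ha (hb n)).isClosedForm le_rfl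
      sobolev_le_splitSobolev).resolvent h : L2R × L2R).1) atTop
      (𝓝 ((ha.isClosedForm hk le_rfl).resolvent h : L2R × L2R).1) := by
  have hres := fun n z (hz : z ∈ sobolev) =>
    (isCoefficient_barrier ha (hb n)).resolvent_equation_sobolev le_rfl h hz
  have hx := fun n => (((isCoefficient_barrier ha (hb n)).isClosedForm le_rfl
      sobolev_le_splitSobolev).resolvent h).2
  refine tendsto_of_tendsto_squeeze ha hb hε hγ hx hres ?_
  obtain ⟨η, hη, happ⟩ := exists_approx ha hb hε hx hres
  exact ha.tendsto_of_approx (fun n => by have := (hb n).totalResistance_pos; positivity) hlim hη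
    (fun n => IsBarrier.squeeze_mem_splitSobolev (hx n)) happ (Subtype.property _)
    fun z hz => ha.resolvent_equation hk le_rfl h hz

theorem tendsto_resolvent_permeable (hε : Tendsto ε atTop (𝓝 0))
    (hγ : Tendsto (fun n => ε n * totalResistance (b n) (ε n)) atTop (𝓝 0))
    (hlim : Tendsto (fun n => totalResistance (b n) (ε n)) atTop (𝓝 0)) (h : L2R) :
    Tendsto (fun n => (((isCoefficient_barrier ha (hb n)).isClosedForm le_rfl
      sobolev_le_splitSobolev).resolvent h : L2R × L2R).1) atTop
      (𝓝 ((ha.isClosedForm le_rfl sobolev_le_splitSobolev).resolvent h : L2R × L2R).1) := by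
  have hres := fun n z (hz : z ∈ sobolev) =>
    (isCoefficient_barrier ha (hb n)).resolvent_equation_sobolev le_rfl h hz
  have hx := fun n => (((isCoefficient_barrier ha (hb n)).isClosedForm le_rfl
      sobolev_le_splitSobolev).resolvent h).2
  refine tendsto_of_tendsto_squeeze ha hb hε hγ hx hres ?_
  obtain ⟨η, hη, happ⟩ := exists_approx ha hb hε hx hres
  exact ha.tendsto_of_approx_atTop (fun n => by have := (hb n).totalResistance_pos; positivity)
    (by simpa using hlim.const_mul 2) hη
    (fun n => IsBarrier.squeeze_mem_splitSobolev (hx n)) happ (Subtype.property _)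
    fun z hz => ha.resolvent_equation_sobolev le_rfl h hz

end Barrier

/-! ### Weak solutions from semigroups -/

theorem exists_mem_sobolev_of_memH1 {u : L2R} (hu : MemH1 univ u) : ∃ x ∈ sobolev, x.1 = u := by
  obtain ⟨-, du, hdu, hw⟩ := hu
  refine ⟨(u, hdu.toLp), mem_sobolev_iff_hasWeakDerivOn.2 fun g hg => ?_, rfl⟩
  rw [hw g hg]
  congr 1
  refine integral_congr_ae ?_
  filter_upwards [hdu.coeFn_toLp] with y hy
  rw [hy]

/-- A function orthogonal to all test functions vanishes. -/
theorem dense_fst_sobolev : Dense (Submodule.span ℝ (Prod.fst '' (sobolev : Set (L2R × L2R))) :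
    Set L2R) := by
  rw [Submodule.dense_iff_topologicalClosure_eq_top, Submodule.topologicalClosure_eq_top_iff,
    Submodule.eq_bot_iff]
  intro F hF
  refine eq_zero_of_forall_test fun g hg => ?_
  have hg' := hg.mono (subset_univ _)
  have h1 := (Submodule.mem_orthogonal' _ _).1 hF hg'.toL2
    (Submodule.subset_span ⟨_, hg'.mem_sobolev, rfl⟩)
  rwa [hg'.inner_toL2] at h1

theorem eq_zero_of_forall_pos_eq_zero {f : ℝ → ℝ} (hf : Continuous f) (h : ∀ t, 0 < t → f t = 0) :
    f 0 = 0 := by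
  have h1 : Tendsto f (𝓝[>] 0) (𝓝 (f 0)) := hf.continuousWithinAt
  refine tendsto_nhds_unique h1 (tendsto_const_nhds.congr' ?_)
  filter_upwards [self_mem_nhdsWithin] with t ht using (h t ht).symm

namespace IsCoefficient

variable {a : ℝ → ℝ}

theorem exists_weakCurve (ha : IsCoefficient a) {k : ℝ} (hk : 0 ≤ k)
    {W : Submodule ℝ (L2R × L2R)} [CompleteSpace W] (hW : W ≤ splitSobolev) (hW' : sobolev ≤ W)
    {x₀ : L2R × L2R} (hx₀ : x₀ ∈ W) : ∃ x : ℝ → L2R × L2R, IsWeakCurve a x ∧ x 0 = x₀ ∧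
      (∀ t, x t ∈ W) ∧ (∀ t, (ha.isClosedForm hk hW).semigroup t x₀.1 = (x t).1) ∧
      (∀ t, 0 < t → ∃ h, x t = (ha.isClosedForm hk hW).resolvent h) ∧
      ∀ α, 0 < α → ∃ h, ∫ t in Ioi (0 : ℝ), Real.exp (-α * t) • (x t).1 =
        ((ha.isClosedForm hk hW).resolvent h : L2R × L2R).1 := by
  obtain ⟨x, hxc, hx0, hxb, hxs, hxw, hxr, hxl⟩ := (ha.isClosedForm hk hW).exists_evolution ⟨x₀, hx₀⟩
  refine ⟨fun t => x t, isWeakCurve_of_evolution ha hk hW' hxc hxb fun t ht y => ?_, ?_,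
    fun t => (x t).2, fun t => (hxs t).symm, fun t ht => ?_, fun α hα => hxl α hα⟩
  · rw [hx0]
    exact hxw t ht y
  · exact congrArg Subtype.val hx0
  · obtain ⟨h, hh⟩ := hxr t ht
    exact ⟨h, congrArg Subtype.val hh⟩

theorem isUniqueWeakSolution_semigroup (ha : IsCoefficient a) {x₀ : L2R × L2R}
    (hx₀ : x₀ ∈ sobolev) : IsUniqueWeakSolution univ a x₀.1
      fun t => (ha.isClosedForm le_rfl sobolev_le_splitSobolev).semigroup t x₀.1 := by
  obtain ⟨x, hx, hx0, hxW, hxs, -⟩ :=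
    ha.exists_weakCurve le_rfl sobolev_le_splitSobolev le_rfl hx₀
  have h1 := hx.isWeakSolution (fun t => mem_sobolev_iff_hasWeakDerivOn.1 (hxW t))
    (fun t _ => hxs t)
  rw [hxs, hx0] at h1
  exact ⟨h1, fun v hv t ht => hv.eq_of_univ ha h1 ht⟩

theorem isWeakSolution_semigroup (ha : IsCoefficient a) {k : ℝ} (hk : 0 ≤ k) {x₀ : L2R × L2R}
    (hx₀ : x₀ ∈ sobolev) : IsWeakSolution puncturedLine a x₀.1
      fun t => (ha.isClosedForm hk le_rfl).semigroup t x₀.1 := by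
  obtain ⟨x, hx, hx0, hxW, hxs, -⟩ :=
    ha.exists_weakCurve hk le_rfl sobolev_le_splitSobolev (sobolev_le_splitSobolev hx₀)
  have h1 := hx.isWeakSolution (fun t => hasWeakDerivOn_of_mem_splitSobolev (hxW t))
    (fun t _ => hxs t)
  rwa [hxs, hx0] at h1

/-- The semigroups for transmission and for reflection at the origin differ. -/
theorem exists_semigroup_ne (ha : IsCoefficient a) : ∃ x ∈ sobolev, ∃ t : ℝ, 0 < t ∧
    (ha.isClosedForm le_rfl sobolev_le_splitSobolev).semigroup t x.1 ≠
      (ha.isClosedForm le_rfl le_rfl).semigroup t x.1 := by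
  by_contra! hcon
  have heq : ∀ t : ℝ, 0 < t → (ha.isClosedForm le_rfl sobolev_le_splitSobolev).semigroup t =
      (ha.isClosedForm le_rfl le_rfl).semigroup t := fun t ht => by
    refine ContinuousLinearMap.ext_on dense_fst_sobolev ?_
    rintro _ ⟨x, hx, rfl⟩
    exact hcon x hx t ht
  obtain ⟨e, he, hje⟩ := exists_jump_eq_one
  obtain ⟨x, hx, hx0, hxW, hxs, -⟩ :=
    ha.exists_weakCurve le_rfl le_rfl sobolev_le_splitSobolev he
  -- If the semigroups agreed, smoothing would place the reflected evolution of `e` in `H¹(ℝ)` at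
  -- every positive time. Its continuity in the form norm would then force `jump e = 0`, whereas
  -- `jump e = 1`.
  have h1 : ∀ t : ℝ, 0 < t → jump (x t) = 0 := by
    intro t ht
    obtain ⟨h', hh'⟩ :=
      (ha.isClosedForm le_rfl sobolev_le_splitSobolev).semigroup_mem_range ht e.1
    rw [heq t ht, hxs t] at hh'
    set y := (ha.isClosedForm le_rfl sobolev_le_splitSobolev).resolvent h'
    have h2 : x t - (y : L2R × L2R) = 0 :=
      eq_zero_of_fst_eq_zero (splitSobolev.sub_mem (hxW t) (sobolev_le_splitSobolev y.2))
        (sub_eq_zero.2 hh')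
    rw [sub_eq_zero.1 h2]
    exact jump_eq_zero_of_mem_sobolev y.2
  have h2 := eq_zero_of_forall_pos_eq_zero (jump.continuous.comp hx.continuous) h1
  rw [Function.comp_apply, hx0, hje] at h2
  exact one_ne_zero h2

/-- The difference of the transmitted and the reflected evolution of a suitable datum is a nonzero
solution with zero initial value. By linearity it perturbs the solution for any datum. -/
theorem exists_isWeakSolution_ne (ha : IsCoefficient a) {x₀ : L2R × L2R} (hx₀ : x₀ ∈ sobolev) :
    ∃ v w : ℝ → L2R, IsWeakSolution puncturedLine a x₀.1 v ∧
      IsWeakSolution puncturedLine a x₀.1 w ∧ ∃ t : ℝ, 0 < t ∧ v t ≠ w t := by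
  obtain ⟨y₀, hy₀, t, ht, hne⟩ := ha.exists_semigroup_ne
  obtain ⟨x, hx, hx0, hxW, -⟩ := ha.exists_weakCurve le_rfl sobolev_le_splitSobolev le_rfl hx₀
  obtain ⟨y, hy, hy0, hyW, hys, -⟩ := ha.exists_weakCurve le_rfl sobolev_le_splitSobolev le_rfl hy₀
  obtain ⟨z, hz, hz0, hzW, hzs, -⟩ := ha.exists_weakCurve le_rfl le_rfl sobolev_le_splitSobolev
    (sobolev_le_splitSobolev hy₀)
  rw [hys, hzs] at hne
  have hxS := fun t => sobolev_le_splitSobolev (hxW t)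
  have h1 := hx.isWeakSolution (fun t => hasWeakDerivOn_of_mem_splitSobolev (hxS t))
    (u := fun t => (x t).1) fun t _ => rfl
  have h2 := (hx.sub ha (hy.sub ha hz)).isWeakSolution (fun t => hasWeakDerivOn_of_mem_splitSobolev
    (splitSobolev.sub_mem (hxS t) (splitSobolev.sub_mem (sobolev_le_splitSobolev (hyW t)) (hzW t))))
    (u := fun t => (x t).1 - ((y t).1 - (z t).1)) fun t _ => rfl
  simp only [hx0, hy0, hz0, sub_self, sub_zero] at h1 h2
  refine ⟨_, _, h1, h2, t, ht, fun h => hne ?_⟩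
  have h3 : (y t).1 - (z t).1 = 0 := sub_eq_self.1 h.symm
  exact sub_eq_zero.1 h3

/-- Elements of the domain of the operator with jump parameter `k` satisfy the membrane condition
at the origin. -/
theorem exists_hasBoundaryData_resolvent (ha : IsCoefficient a) {ap am : ℝ}
    (hG : IsContinuousOnG a ap am) {k : ℝ} (hk : 0 ≤ k) (h : L2R) :
    0 < ap ∧ 0 < am ∧ ∃ vp vm dp dm,
      HasBoundaryData ((ha.isClosedForm hk le_rfl).resolvent h : L2R × L2R).1 vp vm dp dm ∧
      ap * dp = 2 * k * (vp - vm) ∧ am * dm = 2 * k * (vp - vm) :=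
  exists_hasBoundaryData ha hG (Subtype.property _)
    fun _ hy => ha.resolvent_equation hk le_rfl h hy

theorem neumannCondition_resolvent (ha : IsCoefficient a) {ap am : ℝ}
    (hG : IsContinuousOnG a ap am) (h : L2R) :
    NeumannCondition ((ha.isClosedForm le_rfl le_rfl).resolvent h : L2R × L2R).1 := by
  obtain ⟨hap, ham, vp, vm, dp, dm, hd, h1, h2⟩ :=
    ha.exists_hasBoundaryData_resolvent hG le_rfl h
  rw [mul_zero, zero_mul] at h1 h2
  rw [(mul_eq_zero.1 h1).resolve_left hap.ne', (mul_eq_zero.1 h2).resolve_left ham.ne'] at hd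
  exact ⟨vp, vm, hd⟩

/-- The parameter is `4 * k` because the flux is `2k[f] = (4k/2)[f]`. -/
theorem semiPermeableCondition_resolvent (ha : IsCoefficient a) {ap am : ℝ}
    (hG : IsContinuousOnG a ap am) {k : ℝ} (hk : 0 ≤ k) (h : L2R) :
    SemiPermeableCondition ap am (4 * k)
      ((ha.isClosedForm hk le_rfl).resolvent h : L2R × L2R).1 := by
  obtain ⟨-, -, vp, vm, dp, dm, hd, h1, h2⟩ := ha.exists_hasBoundaryData_resolvent hG hk h
  refine ⟨vp, vm, dp, dm, hd, h1.trans h2.symm, ?_⟩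
  rw [h2]
  ring

end IsCoefficient

/-! ### Limits of the resistance and the main theorem -/

theorem tendsto_toReal_of_tendsto_ofReal {r : ℕ → ℝ} (hr : ∀ n, 0 ≤ r n) {γ : ℝ≥0∞}
    (h : Tendsto (fun n => ENNReal.ofReal (r n)) atTop (𝓝 γ)) (hγ : γ ≠ ⊤) :
    Tendsto r atTop (𝓝 γ.toReal) :=
  ((ENNReal.tendsto_toReal hγ).comp h).congr fun n => ENNReal.toReal_ofReal (hr n)

/-- Treats finite `γ` and `γ = ⊤` together: `⊤.toReal⁻¹` is `0` by convention, which is the correct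
limit when the resistance diverges. -/
theorem tendsto_inv_of_tendsto_ofReal {r : ℕ → ℝ} (hr : ∀ n, 0 < r n) {γ : ℝ≥0∞}
    (h : Tendsto (fun n => ENNReal.ofReal (r n)) atTop (𝓝 γ)) (hγ : γ ≠ 0) :
    Tendsto (fun n => (2 * r n)⁻¹) atTop (𝓝 (γ.toReal⁻¹ / 2)) := by
  have h1 : Tendsto (fun n => (r n)⁻¹) atTop (𝓝 (γ⁻¹).toReal) := by
    refine tendsto_toReal_of_tendsto_ofReal (fun n => (inv_pos.2 (hr n)).le) ?_
      (ENNReal.inv_ne_top.2 hγ)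
    exact (tendsto_inv_iff.2 h).congr fun n => (ENNReal.ofReal_inv_of_pos (hr n)).symm
  rw [← ENNReal.toReal_inv]
  refine (h1.div_const 2).congr fun n => ?_
  rw [mul_inv, mul_comm, div_eq_mul_inv]

theorem theorem4p14
    (a : ℝ → ℝ) (ha_meas : AEMeasurable a volume)
    (ha : ∃ δ C : ℝ, 0 < δ ∧ 0 < C ∧ ∀ᵐ x ∂(volume : Measure ℝ), δ ≤ a x ∧ a x ≤ C)
    (b : ℝ → ℝ → ℝ)
    (hb_meas : ∀ ε : ℝ, 0 < ε → AEMeasurable (b ε) (volume.restrict (Ioo (-ε) ε)))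
    (hb : ∀ ε : ℝ, 0 < ε → ∃ δε Cε : ℝ, 0 < δε ∧ 0 < Cε ∧
      ∀ᵐ x ∂(volume.restrict (Ioo (-ε) ε)), δε ≤ b ε x ∧ b ε x ≤ Cε)
    (u₀ : L2R) (hu₀ : MemH1 univ u₀)
    (ε : ℕ → ℝ) (hε_pos : ∀ n, 0 < ε n) (hε_anti : Antitone ε)
    (hε_lim : Tendsto ε atTop (𝓝 0))
    (hγ_small : Tendsto (fun n => ε n * totalResistance (b (ε n)) (ε n)) atTop (𝓝 0))
    (γ : ℝ≥0∞)
    (hγ : Tendsto (fun n => ENNReal.ofReal (totalResistance (b (ε n)) (ε n))) atTop (𝓝 γ)) :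
    -- the weak solutions `uⁿ` of the problems with barrier, and their limit `u`
    (∃ un : ℕ → ℝ → L2R,
      (∀ n, IsUniqueWeakSolution univ (barrierConductivity a (b (ε n)) (ε n)) u₀ (un n)) ∧
      ∃ u : ℝ → L2R, u 0 = u₀ ∧
        (∀ t : ℝ, 0 < t → Tendsto (fun n => un n t) atTop (𝓝 (u t))) ∧
        ∀ ap am : ℝ, IsContinuousOnG a ap am →
          -- impermeable phase
          (γ = ⊤ →
            IsWeakSolution puncturedLine a u₀ u ∧
            (∀ α : ℝ, 0 < α → NeumannCondition (laplaceTransform u α)) ∧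
            (RegularInitialDatum a u₀ → ∀ t : ℝ, 0 < t → NeumannCondition (u t))) ∧
          -- semi-permeable phase
          (0 < γ → γ < ⊤ →
            IsWeakSolution puncturedLine a u₀ u ∧
            (∀ α : ℝ, 0 < α →
              SemiPermeableCondition ap am (2 / γ.toReal) (laplaceTransform u α)) ∧
            (RegularInitialDatum a u₀ → ∀ t : ℝ, 0 < t →
              SemiPermeableCondition ap am (2 / γ.toReal) (u t))) ∧
          -- permeable phase
          (γ = 0 →
            IsUniqueWeakSolution univ a u₀ u ∧
            ∀ t : ℝ, 0 < t → ∃ w : ℝ → ℝ, Continuous w ∧ u t =ᵐ[volume] w)) ∧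
    -- uniqueness in `ℋ(ℝ)`, non-uniqueness in `ℋ(𝔾)`
    (∃ v : ℝ → L2R, IsUniqueWeakSolution univ a u₀ v) ∧
    (∃ v w : ℝ → L2R, IsWeakSolution puncturedLine a u₀ v ∧
      IsWeakSolution puncturedLine a u₀ w ∧ ∃ t : ℝ, 0 < t ∧ v t ≠ w t) := by
  have hA : IsCoefficient a := ⟨ha_meas, ha⟩
  have hB : ∀ n, IsBarrier (b (ε n)) (ε n) := fun n =>
    ⟨hε_pos n, hb_meas _ (hε_pos n), hb _ (hε_pos n)⟩
  have hR := fun n => (hB n).totalResistance_pos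
  obtain ⟨x₀, hx₀, rfl⟩ := exists_mem_sobolev_of_memH1 hu₀
  refine ⟨⟨_, fun n => (isCoefficient_barrier hA (hB n)).isUniqueWeakSolution_semigroup hx₀, ?_⟩,
    ⟨_, hA.isUniqueWeakSolution_semigroup hx₀⟩, hA.exists_isWeakSolution_ne hx₀⟩
  -- For `γ = 0` the jump parameter would be infinite, so the limit form lives on the smaller space
  -- `sobolev`. In all other cases it lives on `splitSobolev` with a finite parameter.
  rcases eq_or_ne γ 0 with hγ0 | hγ0
  · have hlim : Tendsto (fun n => totalResistance (b (ε n)) (ε n)) atTop (𝓝 0) := by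
      have := tendsto_toReal_of_tendsto_ofReal (fun n => (hR n).le) hγ (by simp [hγ0])
      rwa [hγ0, ENNReal.toReal_zero] at this
    have hu := hA.isUniqueWeakSolution_semigroup hx₀
    refine ⟨_, hu.1.2.1, fun t _ => IsClosedForm.tendsto_semigroup _ _
      (tendsto_resolvent_permeable hA hB hε_lim hγ_small hlim) t x₀.1, fun ap am _ =>
      ⟨fun h => absurd (hγ0.symm.trans h) ENNReal.zero_ne_top, fun h => absurd hγ0 h.ne',
        fun _ => ⟨hu, fun t ht => ?_⟩⟩⟩
    obtain ⟨h', hh'⟩ :=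
      (hA.isClosedForm le_rfl sobolev_le_splitSobolev).semigroup_mem_range ht x₀.1
    set y := (hA.isClosedForm le_rfl sobolev_le_splitSobolev).resolvent h'
    obtain ⟨c, hc⟩ := exists_ae_eq_prim_of_mem_sobolev y.2
    refine ⟨_, continuous_prim (l2_locallyIntegrable (y : L2R × L2R).2) c, ?_⟩
    rw [hh']
    exact hc
  -- Here `k = 1/(2γ)`, so that `4k = 2/γ`; for `γ = ⊤` this is `k = 0`, the decoupled form, and the
  -- flux condition becomes the Neumann condition.
  · have hlim := tendsto_inv_of_tendsto_ofReal hR hγ hγ0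
    have hk0 : 0 ≤ γ.toReal⁻¹ / 2 := by positivity
    have hκ : 4 * (γ.toReal⁻¹ / 2) = 2 / γ.toReal := by ring
    have hγt : γ = ⊤ → γ.toReal⁻¹ / 2 = 0 := fun h => by simp [h]
    set k := γ.toReal⁻¹ / 2
    have hu := hA.isWeakSolution_semigroup hk0 hx₀
    obtain ⟨x, -, -, -, hxs, hxr, hxl⟩ := hA.exists_weakCurve hk0 le_rfl sobolev_le_splitSobolev
      (sobolev_le_splitSobolev hx₀)
    have hL : ∀ α : ℝ, 0 < α → ∃ h, laplaceTransform
        (fun t => (hA.isClosedForm hk0 le_rfl).semigroup t x₀.1) α =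
          ((hA.isClosedForm hk0 le_rfl).resolvent h : L2R × L2R).1 := fun α hα => by
      simp only [laplaceTransform, hxs]
      exact hxl α hα
    -- Smoothing puts the solution in the operator domain at every positive time, where the boundary
    -- condition is available.
    have hT : ∀ t : ℝ, 0 < t → ∃ h, (hA.isClosedForm hk0 le_rfl).semigroup t x₀.1 =
        ((hA.isClosedForm hk0 le_rfl).resolvent h : L2R × L2R).1 := fun t ht =>
      (hA.isClosedForm hk0 le_rfl).semigroup_mem_range ht x₀.1
    refine ⟨_, hu.2.1, fun t _ => IsClosedForm.tendsto_semigroup _ _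
      (tendsto_resolvent_semipermeable hA hB hε_lim hγ_small hk0 hlim) t x₀.1, fun ap am hG =>
      ⟨fun h => ⟨hu, ?_⟩, fun _ _ => ⟨hu, ?_⟩, fun h => absurd h hγ0⟩⟩
    · have hN : ∀ h, NeumannCondition ((hA.isClosedForm hk0 le_rfl).resolvent h : L2R × L2R).1 := by
        have h0 := hγt h
        clear_value k
        subst h0
        exact hA.neumannCondition_resolvent hG
      refine ⟨fun α hα => ?_, fun _ t ht => ?_⟩
      · obtain ⟨h, hh⟩ := hL α hα
        rw [hh]
        exact hN h
      · obtain ⟨h, hh⟩ := hT t ht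
        rw [hh]
        exact hN h
    · rw [← hκ]
      refine ⟨fun α hα => ?_, fun _ t ht => ?_⟩
      · obtain ⟨h, hh⟩ := hL α hα
        rw [hh]
        exact hA.semiPermeableCondition_resolvent hG hk0 h
      · obtain ⟨h, hh⟩ := hT t ht
        rw [hh]
        exact hA.semiPermeableCondition_resolvent hG hk0 h

end
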